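/- **Setting.** Let $H=\sum_{j=1}^m H_j$ be a Hamiltonian on a finite-dimensional Hilbert space with Hermitian terms $H_j$, let $(A^a)_{a\in\mathbf A}$ be a finite family of Hermitian jump operators, $(p_a)$ a probability distribution on $\mathbf A$, $\gamma\ge 0$ and $\beta>0$. Write $\|\cdot\|$ for the operator norm, $\|\cdot\|_1$ for the trace norm, $B_H=\{E-E' : E,E'\in\mathrm{Spec}\,H\}$, $\mathcal U_t[\rho]=e^{-itH}\rho\, e^{itH}$, $A^a(t)=e^{itH}A^ae^{-itH}$, and $$g(t)=\pi^{-3/4}\beta^{-1/2}e^{it/\beta}e^{-2t^2/\beta^2},\qquad L^a=\int_{-\infty}^{\infty} g(t)A^a(t)\,dt,$$ $$\mathcal L[\rho]=\sum_a p_a\Big(-i[H,\rho]+\gamma\big(L^a\rho L^{a\dagger}-\tfrac12\{L^{a\dagger}L^a,\rho\}\big)\Big).$$ If $\mathcal L$ has a unique steady state $\sigma$ and $\sigma$ has full rank, let $t_{\rm mix}(\epsilon)=\inf\{t\ge0:\ \|e^{t\mathcal L}[\rho]-\sigma\|_1\le\epsilon \text{ for all states }\rho\}$. **Protocol.** Let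 $\delta t,\Delta t>0$, let $S,r_\delta,r_\Delta\ge1$ be integers and $T=S\Delta t$. Put $\Delta t_s=\Delta t$ for $|s|<S$ and $\Delta t_{\pm S}=\Delta t/2$, and $$B^a_s=\exp\Big[-\tfrac{i}{2}\sqrt{\delta t\,\gamma}\,\Delta t_s\big(\mathrm{Re}\,g(s\Delta t)\,X+\mathrm{Im}\,g(s\Delta t)\,Y\big)\otimes A^a\Big]$$ on ancilla qubit $\otimes$ system. Let $F_\delta$ and $F_\Delta$ be the implementations of $e^{-i\delta tH}$ and $e^{-i\Delta tH}$ by the symmetric second-order product formula in the terms $H_j$ with $r_\delta$, respectively $r_\Delta$, steps. Put $$V^a=\Big(\prod_{s=-S,\dots,S}B^a_s(I\otimes F_\Delta^\dagger)\Big)\Big(\prod_{s=S,\dots,-S}(I\otimes F_\Delta)B^a_s\Big)$$ (factors written from left to right) and $$\widetilde{\mathcal W}^a[\rho]=\mathrm{Tr}_{\rm anc}\big[V^a(|0\rangle\langle0|\otimes F_\delta\rho F_\delta^\dagger)V^{a\dagger}\big],$$ and let $\mathcal W^a$ be defined like $\widetilde{\mathcal W}^a$, with $V^a$ replaced by $(I\otimes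 F_\Delta^{S})V^a(I\otimes F_\Delta^{\dagger S})$. In each step the label $a$ is drawn independently from $(p_a)$; $\mathbb E$ denotes the average over the labels $a_1,\dots,a_M$. **Proposition.** For all real $\Lambda,\alpha,\Gamma,\beta_0$ and all $\kappa>0$ there is a constant $C>0$, depending on these five numbers only, such that the following holds for every protocol as above (in any dimension) with $$\sum_j\|H_j\|\le\Lambda,\quad \|A^a\|\le\alpha\ \ (a\in\mathbf A),\quad \gamma\le\Gamma,\quad \beta\le\beta_0,\quad T\Delta t\ge\kappa\beta^2,\quad \frac{2\pi\beta}{\Delta t}-2\beta\|H\|-1>0.$$ For every $M\ge0$ and every density matrix $\rho$, with $t=M\delta t$, both $$\Big\|e^{t\mathcal L}[\rho]-\mathbb E\big[\mathcal W^{a_M}\circ\cdots\circ\mathcal W^{a_1}[\rho]\big]\Big\|_1 \quad\text{and}\quad \Big\|\mathcal U_{-T}\circ e^{t\mathcal L}\circ\mathcal U_{T}[\rho]-\mathbb E\big[\widetilde{\mathcal W}^{a_M}\circ\cdots\circ\widetilde{\mathcal W}^{a_1}[\rho]\big]\Big\|_1$$ are at most $$t\cdot C\Big(\delta t+\frac{\Delta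 t}{\sqrt\beta}e^{-2(T/\beta)^2}+\sqrt\beta\,|B_H|\,e^{-\frac18\left(\frac{2\pi\beta}{\Delta t}-2\beta\|H\|-1\right)^2}+\frac{\delta t^2}{r_\delta^2}+\frac{T\Delta t^2}{\delta t\,r_\Delta^2}\Big).$$ In particular, if $\mathcal L$ has a unique steady state, of full rank, and $M\delta t=t_{\rm mix}(\epsilon)$ for some $\epsilon>0$, the bound holds with $t=t_{\rm mix}(\epsilon)$. -/

import Mathlib

open scoped Matrix Kronecker ComplexOrder Matrix.Norms.L2Operator

noncomputable section

namespace GibbsProtocol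

/-! ### States, norms, spectra.  Throughout, `‖·‖` on matrices is the operator (spectral) norm. -/

section Basics

variable {d : Type*} [Fintype d] [DecidableEq d]

/-- The trace norm `Tr √(Xᴴ X)`, i.e. the sum of the singular values of `X`. -/
def traceNorm (X : Matrix d d ℂ) : ℝ :=
  ∑ i, Real.sqrt ((Matrix.isHermitian_conjTranspose_mul_self X).eigenvalues i)

/-- Density matrices. -/
def IsDensity (ρ : Matrix d d ℂ) : Prop :=
  ρ.PosSemidef ∧ ρ.trace = 1

/-- The set of Bohr frequencies: differences of two eigenvalues of `H`. -/
def bohrFrequencies (H : Matrix d d ℂ) : Set ℝ :=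
  {ν | ∃ E ∈ spectrum ℝ H, ∃ E' ∈ spectrum ℝ H, ν = E - E'}

/-- `e^{-i t H}`. -/
def evol (H : Matrix d d ℂ) (t : ℝ) : Matrix d d ℂ :=
  NormedSpace.exp ((-(Complex.I * t)) • H)

/-- The Heisenberg-evolved operator `A(t) = e^{i t H} A e^{-i t H}`. -/
def heisenberg (H A : Matrix d d ℂ) (t : ℝ) : Matrix d d ℂ :=
  evol H (-t) * A * evol H t

/-- Conjugation `ρ ↦ U ρ Uᴴ`. -/
def conjBy (U ρ : Matrix d d ℂ) : Matrix d d ℂ := U * ρ * Uᴴ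

/-- Second-order product formula for `e^{-i t (H₁ + ⋯ + Hₘ)}`:
`(e^{-i t H₁ / 2} ⋯ e^{-i t Hₘ / 2}) (e^{-i t Hₘ / 2} ⋯ e^{-i t H₁ / 2})`. -/
def strang {m : ℕ} (h : Fin m → Matrix d d ℂ) (t : ℝ) : Matrix d d ℂ :=
  (List.ofFn fun j => evol (h j) (t / 2)).prod *
    (List.ofFn fun j => evol (h j) (t / 2)).reverse.prod

/-- Second-order product formula with `r` steps. -/
def productFormula {m : ℕ} (h : Fin m → Matrix d d ℂ) (r : ℕ) (t : ℝ) : Matrix d d ℂ :=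
  strang h (t / r) ^ r

end Basics

/-! ### The Lindbladian -/

section Lindblad

variable {d : Type*} [Fintype d] [DecidableEq d]

/-- The Gaussian filter `g(t) = π^{-3/4} β^{-1/2} e^{i t / β} e^{-2 t² / β²}`. -/
def filter (β t : ℝ) : ℂ :=
  ((1 / (Real.pi ^ (3 / 4 : ℝ) * Real.sqrt β) : ℝ) : ℂ) *
    Complex.exp (Complex.I * ((t / β : ℝ) : ℂ)) * ((Real.exp (-2 * t ^ 2 / β ^ 2) : ℝ) : ℂ)

/-- The Lindblad operator `L = ∫ g(t) A(t) dt` (operator Fourier transform of `A`). -/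
def lindbladOp (β : ℝ) (H A : Matrix d d ℂ) : Matrix d d ℂ :=
  ∫ t : ℝ, filter β t • heisenberg H A t

/-- `ρ ↦ L ρ Lᴴ - ½ {Lᴴ L, ρ}`. -/
def dissipator (L : Matrix d d ℂ) : Matrix d d ℂ →ₗ[ℂ] Matrix d d ℂ where
  toFun ρ := L * ρ * Lᴴ - (1 / 2 : ℂ) • (Lᴴ * L * ρ + ρ * (Lᴴ * L))
  map_add' ρ σ := by
    simp only [mul_add, add_mul, smul_add]
    abel
  map_smul' c ρ := by
    simp only [Matrix.mul_smul, Matrix.smul_mul, smul_add, smul_sub, RingHom.id_apply,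
      smul_comm c (1 / 2 : ℂ)]

/-- `ρ ↦ -i [H, ρ]`. -/
def coherentPart (H : Matrix d d ℂ) : Matrix d d ℂ →ₗ[ℂ] Matrix d d ℂ where
  toFun ρ := (-Complex.I) • (H * ρ - ρ * H)
  map_add' ρ σ := by
    rw [← smul_add]
    congr 1
    simp only [mul_add, add_mul]
    abel
  map_smul' c ρ := by
    simp only [Matrix.mul_smul, Matrix.smul_mul, ← smul_sub, RingHom.id_apply,
      smul_comm c (-Complex.I)]

/-- The semigroup `e^{t 𝓛}` generated by a superoperator `𝓛`. -/
def semigroup (𝓛 : Matrix d d ℂ →ₗ[ℂ] Matrix d d ℂ) (t : ℝ) :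
    Matrix d d ℂ →L[ℂ] Matrix d d ℂ :=
  NormedSpace.exp ((t : ℂ) • LinearMap.toContinuousLinearMap 𝓛)

/-- `σ` is the unique steady state of `𝓛` and has full rank. -/
def IsUniqueFullRankSteadyState (𝓛 : Matrix d d ℂ →ₗ[ℂ] Matrix d d ℂ)
    (σ : Matrix d d ℂ) : Prop :=
  IsDensity σ ∧ σ.PosDef ∧ 𝓛 σ = 0 ∧ ∀ τ, IsDensity τ → 𝓛 τ = 0 → τ = σ

/-- The mixing time `t_mix(ε) = inf {t ≥ 0 | ∀ ρ, ‖e^{t 𝓛} ρ - σ‖₁ ≤ ε}` towards `σ`. -/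
def mixingTime (𝓛 : Matrix d d ℂ →ₗ[ℂ] Matrix d d ℂ) (σ : Matrix d d ℂ) (ε : ℝ) : ℝ :=
  sInf {t : ℝ | 0 ≤ t ∧ ∀ ρ, IsDensity ρ → traceNorm (semigroup 𝓛 t ρ - σ) ≤ ε}

end Lindblad

/-! ### The ancilla qubit -/

section Ancilla

variable {d : Type*} [Fintype d] [DecidableEq d]

/-- Partial trace over the ancilla qubit (the first tensor factor). -/
def trAnc (X : Matrix (Fin 2 × d) (Fin 2 × d) ℂ) : Matrix d d ℂ :=
  Matrix.of fun i j => ∑ k : Fin 2, X (k, i) (k, j)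

/-- `|0⟩⟨0| ⊗ ρ`. -/
def withAnc (ρ : Matrix d d ℂ) : Matrix (Fin 2 × d) (Fin 2 × d) ℂ :=
  !![1, 0; 0, 0] ⊗ₖ ρ

/-- `I ⊗ U`. -/
def onSystem (U : Matrix d d ℂ) : Matrix (Fin 2 × d) (Fin 2 × d) ℂ :=
  (1 : Matrix (Fin 2) (Fin 2) ℂ) ⊗ₖ U

/-- The Pauli matrix `X`. -/
def pauliX : Matrix (Fin 2) (Fin 2) ℂ := !![0, 1; 1, 0]

/-- The Pauli matrix `Y`. -/
def pauliY : Matrix (Fin 2) (Fin 2) ℂ := !![0, -Complex.I; Complex.I, 0]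

end Ancilla

/-! ### The randomized single-ancilla protocol -/

/-- The data of the protocol on a system with index set `d`, jump operators indexed by `ι`, and a
Hamiltonian given as a sum of `m` Hermitian terms. -/
structure Protocol (m : ℕ) (ι d : Type*) [Fintype ι] [Fintype d] [DecidableEq d] where
  /-- the terms of the Hamiltonian, `H = ∑ⱼ Hⱼ` -/
  term : Fin m → Matrix d d ℂ
  term_hermitian : ∀ j, (term j).IsHermitian
  /-- the jump operators `Aᵃ` -/
  jump : ι → Matrix d d ℂ
  jump_hermitian : ∀ a, (jump a).IsHermitian
  /-- the sampling probabilities `pₐ` -/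
  prob : ι → ℝ
  prob_nonneg : ∀ a, 0 ≤ prob a
  prob_sum : ∑ a, prob a = 1
  /-- the dissipation strength `γ` -/
  γ : ℝ
  γ_nonneg : 0 ≤ γ
  /-- the inverse temperature `β` -/
  β : ℝ
  β_pos : 0 < β
  /-- the evolution step `δt` -/
  δt : ℝ
  δt_pos : 0 < δt
  /-- the discretization step `Δt` of the operator Fourier transform -/
  Δt : ℝ
  Δt_pos : 0 < Δt
  /-- the integral is discretized at the points `s Δt`, `-S ≤ s ≤ S` -/
  S : ℕ
  S_pos : 0 < S
  /-- the number of product-formula steps for `e^{-i δt H}` -/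
  rδ : ℕ
  rδ_pos : 0 < rδ
  /-- the number of product-formula steps for `e^{-i Δt H}` -/
  rΔ : ℕ
  rΔ_pos : 0 < rΔ

namespace Protocol

variable {m : ℕ} {ι d : Type*} [Fintype ι] [Fintype d] [DecidableEq d] (P : Protocol m ι d)

/-- The Hamiltonian. -/
def H : Matrix d d ℂ := ∑ j, P.term j

/-- The limit `T = S Δt` of the truncated integral. -/
def T : ℝ := P.S * P.Δt

/-- The Lindbladian
`𝓛[ρ] = ∑ₐ pₐ (-i [H, ρ] + γ (Lᵃ ρ Lᵃᴴ - ½ {Lᵃᴴ Lᵃ, ρ}))`. -/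
def lindbladian : Matrix d d ℂ →ₗ[ℂ] Matrix d d ℂ :=
  ∑ a, (P.prob a : ℂ) •
    (coherentPart P.H + (P.γ : ℂ) • dissipator (lindbladOp P.β P.H (P.jump a)))

/-- Trapezoidal weights `Δtₛ`. -/
def weight (s : ℤ) : ℝ := if s.natAbs = P.S then P.Δt / 2 else P.Δt

/-- The gate `Bₛᵃ = exp(-i (√(δt γ) / 2) Δtₛ (Re gₛ X + Im gₛ Y) ⊗ Aᵃ)` with `gₛ = g(s Δt)`. -/
def gateB (a : ι) (s : ℤ) : Matrix (Fin 2 × d) (Fin 2 × d) ℂ :=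
  NormedSpace.exp
    ((-(Complex.I * ((Real.sqrt (P.δt * P.γ) / 2 * P.weight s : ℝ) : ℂ))) •
      ((((filter P.β (s * P.Δt)).re : ℂ) • pauliX + ((filter P.β (s * P.Δt)).im : ℂ) • pauliY)
        ⊗ₖ P.jump a))

/-- The implementation of `e^{-i Δt H}` by the product formula with `r_Δ` steps. -/
def shortEvol : Matrix d d ℂ := productFormula P.term P.rΔ P.Δt

/-- The implementation of `e^{-i δt H}` by the product formula with `r_δ` steps. -/
def stepEvol : Matrix d d ℂ := productFormula P.term P.rδ P.δt

/-- The unitary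
`Vᵃ = (∏_{s = -S, …, S} Bₛᵃ (I ⊗ e^{i Δt H})) (∏_{s = S, …, -S} (I ⊗ e^{-i Δt H}) Bₛᵃ)`
(factors written from left to right), with the evolutions `e^{∓ i Δt H}` implemented by the product
formula. -/
def gateV (a : ι) : Matrix (Fin 2 × d) (Fin 2 × d) ℂ :=
  ((List.range (2 * P.S + 1)).map fun j : ℕ =>
      P.gateB a ((j : ℤ) - P.S) * onSystem P.shortEvolᴴ).prod *
    ((List.range (2 * P.S + 1)).reverse.map fun j : ℕ =>
      onSystem P.shortEvol * P.gateB a ((j : ℤ) - P.S)).prod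

/-- One step of the circuit:
`ρ ↦ Tr_anc[Vᵃ (|0⟩⟨0| ⊗ e^{-i δt H} ρ e^{i δt H}) Vᵃᴴ]`, with implemented evolutions. -/
def circuitStep (a : ι) (ρ : Matrix d d ℂ) : Matrix d d ℂ :=
  trAnc (conjBy (P.gateV a) (withAnc (conjBy P.stepEvol ρ)))

/-- One step of the simulated Lindblad evolution, including the outer evolutions:
`Vᵃ` is replaced by `(I ⊗ e^{-i S Δt H}) Vᵃ (I ⊗ e^{i S Δt H})`, with implemented evolutions. -/
def simulationStep (a : ι) (ρ : Matrix d d ℂ) : Matrix d d ℂ :=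
  trAnc (conjBy
    (onSystem (P.shortEvol ^ P.S) * P.gateV a * onSystem (P.shortEvolᴴ ^ P.S))
    (withAnc (conjBy P.stepEvol ρ)))

/-- The expected output after `M` steps with jump labels `a₁, …, a_M` drawn independently from the
distribution `p`: `E[(W^{a_M} ∘ ⋯ ∘ W^{a₁})(ρ)]`. -/
def expectedOutput (W : ι → Matrix d d ℂ → Matrix d d ℂ) (M : ℕ) (ρ : Matrix d d ℂ) :
    Matrix d d ℂ :=
  ∑ a : Fin M → ι, ((∏ i, P.prob (a i) : ℝ) : ℂ) • (List.ofFn a).foldl (fun σ b => W b σ) ρ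

/-- The algorithmic error of the simulation of `e^{M δt 𝓛}` on the initial state `ρ`. -/
def simulationError (M : ℕ) (ρ : Matrix d d ℂ) : ℝ :=
  traceNorm (semigroup P.lindbladian (M * P.δt) ρ - P.expectedOutput P.simulationStep M ρ)

/-- The algorithmic error of the circuit without the outer evolutions, whose target is
`𝓤_{-SΔt} ∘ e^{M δt 𝓛} ∘ 𝓤_{SΔt}` with `𝓤_t[ρ] = e^{-i t H} ρ e^{i t H}`. -/
def circuitError (M : ℕ) (ρ : Matrix d d ℂ) : ℝ :=
  traceNorm
    (conjBy (evol P.H (-P.T)) (semigroup P.lindbladian (M * P.δt) (conjBy (evol P.H P.T) ρ)) -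
      P.expectedOutput P.circuitStep M ρ)

/-- The error rate
`δt + (Δt/√β) e^{-2(T/β)²} + √β |B_H| e^{-(2πβ/Δt - 2β‖H‖ - 1)²/8} + δt²/r_δ² + T Δt²/(δt r_Δ²)`. -/
def errorRate : ℝ :=
  P.δt
    + P.Δt / Real.sqrt P.β * Real.exp (-2 * (P.T / P.β) ^ 2)
    + Real.sqrt P.β * (bohrFrequencies P.H).ncard *
        Real.exp (-(1 / 8) * (2 * Real.pi * (P.β / P.Δt) - 2 * P.β * ‖P.H‖ - 1) ^ 2)
    + P.δt ^ 2 / (P.rδ : ℝ) ^ 2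
    + P.T * P.Δt ^ 2 / (P.δt * (P.rΔ : ℝ) ^ 2)

end Protocol

end GibbsProtocol

end

/-!
Why the bound holds. Both circuits are compared with the Lindblad evolution one step at a time, in the
trace norm and for every matrix `X` rather than for states only. The trace norm is handled by duality
with the operator norm (`norm_trace_mul_le`, `exists_trace_mul_eq_traceNorm`); this makes it a norm,
and makes every channel `X ↦ Tr_anc[G (|0⟩⟨0| ⊗ X) Gᴴ]` with `‖G‖ ≤ 1` a contraction
(`traceNorm_stepMap_le`).

Assume first that the evolutions in the circuit are exact. In the interaction picture
(`interaction_picture`) the evolutions between the gates `Bₛᵃ` cancel, and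
`e^{-iTH} Vᵃ e^{iTH}` becomes a symmetric product of exponentials of Hermitian dilations of
`Δtₛ g(s Δt) Aᵃ(s Δt)`, a `symGate`. A symmetric product agrees with the exponential of the sum of its
exponents up to a term of third order and a remainder of fourth order (`exists_hasJet_symm_prod`). Terms
of odd order flip the ancilla, so the third-order term enters the channel only through products of
order at least four, and the channel is `1 + θ² 𝓓[L̄ᵃ] + O(θ⁴)` with `θ² = γ δt` and
`L̄ᵃ = ∑ₛ Δtₛ g(s Δt) Aᵃ(s Δt)` (`traceNorm_stepMap_symGate_sub_le`). Together with the free evolution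
this agrees with `e^{δt 𝓛}` up to `O(δt²)` and `O(δt ‖L̄ᵃ - Lᵃ‖)`
(`traceNorm_semigroup_sub_symGate_le`). The same expansion with the exact `Lᵃ` in place of `L̄ᵃ` exhibits
`e^{δ 𝓛}` as a limit of products of contractions, so that the semigroup contracts the trace norm
(`traceNorm_semigroup_generator_le`) without any appeal to complete positivity.

The difference `L̄ᵃ - Lᵃ` has two parts. For the infinite trapezoidal sum, `Aᵃ(t)` is decomposed into
its Bohr frequencies, and at each frequency Poisson summation turns the error into the values of a
Gaussian at the nonzero points of the dual lattice (`norm_trapezoid_sub_lindbladOp_le`). The neglected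
tail of the sum is dominated by a geometric series with ratio `e^{-4κ}`, because `T Δt ≥ κ β²`
(`norm_truncation_le`).

Replacing the exact evolutions by product formulas costs `3 (Λ t)³ / r²` per evolution
(`norm_productFormula_sub_evol_le`), and there are `O(S)` evolutions for time `Δt` in one step. The
circuit without the outer evolutions has, up to this error, the conjugate by `e^{-iTH}` of the channel
of the other one (`conjBy_idealStep_conjBy`). Since all maps involved are contractions, the errors of
the `M` steps add up (`traceNorm_iterate_sub_expectedOutput_le`).
-/

set_option linter.unusedSectionVars false

namespace GibbsProtocol

/-! ### The trace norm -/

section TraceNorm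

variable {d n : Type*} [Fintype d] [DecidableEq d] [Fintype n]

lemma norm_one_matrix_le : ‖(1 : Matrix d d ℂ)‖ ≤ 1 := by
  rw [← Matrix.diagonal_one, Matrix.l2_opNorm_diagonal]
  exact (pi_norm_le_iff_of_nonneg zero_le_one).2 fun i => by simp

lemma norm_le_one_of_conjTranspose_mul_self {U : Matrix n d ℂ} (h : Uᴴ * U = 1) : ‖U‖ ≤ 1 := by
  have h1 := Matrix.l2_opNorm_conjTranspose_mul_self U
  rw [h] at h1
  have h2 := norm_one_matrix_le (d := d)
  nlinarith [norm_nonneg U]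

/-- A Hermitian matrix in the form `V D Vᴴ`, with `V` unitary and `D` the real diagonal matrix of
its eigenvalues. -/
lemma exists_unitary_diagonalization {H : Matrix d d ℂ} (hH : H.IsHermitian) :
    ∃ V : Matrix d d ℂ, V * Vᴴ = 1 ∧ Vᴴ * V = 1 ∧
      H = V * Matrix.diagonal (fun i => (hH.eigenvalues i : ℂ)) * Vᴴ := by
  refine ⟨_, Unitary.coe_mul_star_self hH.eigenvectorUnitary,
    Unitary.coe_star_mul_self hH.eigenvectorUnitary, ?_⟩
  conv_lhs => rw [hH.spectral_theorem, Unitary.conjStarAlgAut_apply]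
  rfl

lemma norm_mul_apply_self_le (A : Matrix n d ℂ) (Y : Matrix d n ℂ) (i : n) :
    ‖(A * Y) i i‖ ≤ ‖A‖ * Real.sqrt (((Yᴴ * Y) i i).re) := by
  set y : EuclideanSpace ℂ d := WithLp.toLp 2 (fun j => Y j i) with hy
  have h1 : ‖y‖ = Real.sqrt (((Yᴴ * Y) i i).re) := by
    rw [EuclideanSpace.norm_eq]
    congr 1
    simp only [Matrix.mul_apply, Matrix.conjTranspose_apply, Complex.re_sum]
    refine Finset.sum_congr rfl fun j _ => ?_
    rw [hy, ← Complex.normSq_eq_norm_sq, Complex.star_def, ← Complex.normSq_eq_conj_mul_self]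
    simp
  have h2 := Matrix.l2_opNorm_mulVec A y
  rw [h1] at h2
  refine le_trans ?_ h2
  exact PiLp.norm_apply_le (WithLp.toLp 2 (A *ᵥ y.ofLp)) i

/-- Duality of the operator norm and the trace norm: the trace is computed in the eigenbasis of
`Xᴴ X`, where the columns of `X` are orthogonal with the singular values as their lengths. -/
lemma norm_trace_mul_le (U X : Matrix d d ℂ) : ‖(U * X).trace‖ ≤ ‖U‖ * traceNorm X := by
  have hH := Matrix.isHermitian_conjTranspose_mul_self X
  obtain ⟨V, hVV, hVV', hX⟩ := exists_unitary_diagonalization hH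
  have hVn : ‖Vᴴ‖ ≤ 1 := norm_le_one_of_conjTranspose_mul_self (by simpa using hVV)
  change _ ≤ ‖U‖ * ∑ i, Real.sqrt (hH.eigenvalues i)
  obtain ⟨l, hl⟩ : ∃ l, l = hH.eigenvalues := ⟨_, rfl⟩
  rw [← hl] at hX ⊢
  have h1 : (U * X).trace = (Vᴴ * U * (X * V)).trace := by
    rw [show Vᴴ * U * (X * V) = Vᴴ * (U * X * V) by simp only [mul_assoc],
      Matrix.trace_mul_comm Vᴴ, mul_assoc, hVV, mul_one]
  have hd : (X * V)ᴴ * (X * V) = Matrix.diagonal (fun i => (l i : ℂ)) := by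
    rw [Matrix.conjTranspose_mul, show Vᴴ * Xᴴ * (X * V) = Vᴴ * (Xᴴ * X) * V by
      simp only [mul_assoc], hX]
    calc _ = (Vᴴ * V) * Matrix.diagonal (fun i => (l i : ℂ)) * (Vᴴ * V) := by
          simp only [mul_assoc]
      _ = _ := by rw [hVV', one_mul, mul_one]
  rw [h1, Matrix.trace, Finset.mul_sum]
  refine (norm_sum_le _ _).trans (Finset.sum_le_sum fun i _ => ?_)
  refine (norm_mul_apply_self_le _ _ i).trans ?_
  rw [hd, Matrix.diagonal_apply_eq, Complex.ofReal_re]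
  gcongr
  refine (Matrix.l2_opNorm_mul _ _).trans ?_
  calc ‖Vᴴ‖ * ‖U‖ ≤ 1 * ‖U‖ := by gcongr
    _ = ‖U‖ := one_mul _

/-- The trace norm is attained as a trace: the adjoint of the partial isometry in the polar
decomposition of `X` is a maximizer. -/
lemma exists_trace_mul_eq_traceNorm (X : Matrix d d ℂ) :
    ∃ U : Matrix d d ℂ, ‖U‖ ≤ 1 ∧ (U * X).trace = traceNorm X := by
  have hH := Matrix.isHermitian_conjTranspose_mul_self X
  obtain ⟨V, hVV, hVV', hX⟩ := exists_unitary_diagonalization hH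
  have hVn : ‖V‖ ≤ 1 := norm_le_one_of_conjTranspose_mul_self hVV'
  have hVn' : ‖Vᴴ‖ ≤ 1 := norm_le_one_of_conjTranspose_mul_self (by simpa using hVV)
  change ∃ U : Matrix d d ℂ, ‖U‖ ≤ 1 ∧
    (U * X).trace = ((∑ i, Real.sqrt (hH.eigenvalues i) : ℝ) : ℂ)
  obtain ⟨l, hl⟩ : ∃ l, l = hH.eigenvalues := ⟨_, rfl⟩
  rw [← hl] at hX ⊢
  -- the pseudo-inverse of `|X|` in the eigenbasis; `0⁻¹ = 0` takes care of the kernel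
  set D : Matrix d d ℂ := Matrix.diagonal fun i => (((Real.sqrt (l i))⁻¹ : ℝ) : ℂ)
    with hD
  have hDD : Dᴴ = D := by
    rw [hD, Matrix.diagonal_conjTranspose]
    congr 1
    ext i
    exact Complex.conj_ofReal _
  have hDL : D * Matrix.diagonal (fun i => (l i : ℂ)) =
      Matrix.diagonal fun i => ((Real.sqrt (l i) : ℝ) : ℂ) := by
    rw [hD, Matrix.diagonal_mul_diagonal]
    congr 1
    ext i
    rw [← Complex.ofReal_mul]
    congr 1
    rw [inv_mul_eq_div, Real.div_sqrt]
  refine ⟨V * D * Vᴴ * Xᴴ, ?_, ?_⟩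
  · set U := V * D * Vᴴ * Xᴴ with hU
    have h1 : ‖Uᴴᴴ * Uᴴ‖ ≤ 1 := by
      have : Uᴴᴴ * Uᴴ =
          V * Matrix.diagonal (fun i => (((Real.sqrt (l i)) *
            (Real.sqrt (l i))⁻¹ : ℝ) : ℂ)) * Vᴴ := by
        calc Uᴴᴴ * Uᴴ = V * D * Vᴴ * (Xᴴ * X) * V * Dᴴ * Vᴴ := by
              rw [hU]
              simp only [Matrix.conjTranspose_mul, Matrix.conjTranspose_conjTranspose, mul_assoc]
          _ = V * (D * ((Vᴴ * V) * (Matrix.diagonal (fun i => (l i : ℂ)) *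
                ((Vᴴ * V) * D)))) * Vᴴ := by
              rw [hDD, hX]
              simp only [mul_assoc]
          _ = _ := by
              rw [hVV', one_mul, one_mul, ← mul_assoc D, hDL, hD, Matrix.diagonal_mul_diagonal]
              simp only [Complex.ofReal_mul]
      rw [this]
      refine (Matrix.l2_opNorm_mul _ _).trans (mul_le_one₀ ?_ (norm_nonneg _) hVn')
      refine (Matrix.l2_opNorm_mul _ _).trans (mul_le_one₀ hVn (norm_nonneg _) ?_)
      rw [Matrix.l2_opNorm_diagonal]
      refine (pi_norm_le_iff_of_nonneg zero_le_one).2 fun i => ?_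
      rw [Complex.norm_real, Real.norm_of_nonneg (by positivity)]
      exact mul_inv_le_one
    rw [Matrix.l2_opNorm_conjTranspose_mul_self, Matrix.l2_opNorm_conjTranspose] at h1
    nlinarith [norm_nonneg U]
  · calc (V * D * Vᴴ * Xᴴ * X).trace
        = (V * (D * ((Vᴴ * V) * Matrix.diagonal (fun i => (l i : ℂ))) * Vᴴ)).trace := by
          rw [mul_assoc _ Xᴴ, hX]
          simp only [mul_assoc]
      _ = (D * Matrix.diagonal (fun i => (l i : ℂ))).trace := by
          rw [Matrix.trace_mul_comm, hVV', one_mul, mul_assoc, hVV', mul_one]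
      _ = _ := by
          rw [hDL, Matrix.trace_diagonal, Complex.ofReal_sum]

lemma traceNorm_le_of_forall {X : Matrix d d ℂ} {B : ℝ}
    (h : ∀ U : Matrix d d ℂ, ‖U‖ ≤ 1 → ‖(U * X).trace‖ ≤ B) : traceNorm X ≤ B := by
  obtain ⟨U, hU, hX⟩ := exists_trace_mul_eq_traceNorm X
  have := h U hU
  rw [hX, Complex.norm_real] at this
  exact (le_abs_self _).trans this

lemma traceNorm_nonneg (X : Matrix d d ℂ) : 0 ≤ traceNorm X :=
  Finset.sum_nonneg fun _ _ => Real.sqrt_nonneg _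

lemma traceNorm_add_le (X Y : Matrix d d ℂ) : traceNorm (X + Y) ≤ traceNorm X + traceNorm Y := by
  refine traceNorm_le_of_forall fun U hU => ?_
  rw [mul_add, Matrix.trace_add]
  refine (norm_add_le _ _).trans (add_le_add ?_ ?_)
  · exact (norm_trace_mul_le U X).trans (mul_le_of_le_one_left (traceNorm_nonneg X) hU)
  · exact (norm_trace_mul_le U Y).trans (mul_le_of_le_one_left (traceNorm_nonneg Y) hU)

lemma traceNorm_smul_le (c : ℂ) (X : Matrix d d ℂ) : traceNorm (c • X) ≤ ‖c‖ * traceNorm X := by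
  refine traceNorm_le_of_forall fun U hU => ?_
  rw [Matrix.mul_smul, Matrix.trace_smul, norm_smul]
  gcongr
  exact (norm_trace_mul_le U X).trans (mul_le_of_le_one_left (traceNorm_nonneg X) hU)

lemma traceNorm_zero : traceNorm (0 : Matrix d d ℂ) = 0 :=
  le_antisymm (traceNorm_le_of_forall fun U _ => by simp) (traceNorm_nonneg _)

lemma traceNorm_neg_le (X : Matrix d d ℂ) : traceNorm (-X) ≤ traceNorm X := by
  simpa using traceNorm_smul_le (-1) X

lemma traceNorm_sub_le (X Y : Matrix d d ℂ) : traceNorm (X - Y) ≤ traceNorm X + traceNorm Y := by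
  rw [sub_eq_add_neg]
  exact (traceNorm_add_le _ _).trans (add_le_add_right (traceNorm_neg_le Y) _)

lemma traceNorm_sum_le {ι : Type*} (s : Finset ι) (f : ι → Matrix d d ℂ) :
    traceNorm (∑ i ∈ s, f i) ≤ ∑ i ∈ s, traceNorm (f i) :=
  Finset.le_sum_of_subadditive _ traceNorm_zero.le traceNorm_add_le s f

lemma traceNorm_mul_mul_le (A X B : Matrix d d ℂ) :
    traceNorm (A * X * B) ≤ ‖A‖ * traceNorm X * ‖B‖ := by
  refine traceNorm_le_of_forall fun U hU => ?_
  rw [show U * (A * X * B) = (U * A * X) * B by simp only [mul_assoc], Matrix.trace_mul_comm,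
    show B * (U * A * X) = (B * U * A) * X by simp only [mul_assoc]]
  refine (norm_trace_mul_le _ X).trans ?_
  have : ‖B * U * A‖ ≤ ‖B‖ * 1 * ‖A‖ := (norm_mul_le _ _).trans (by
    gcongr
    exact (norm_mul_le _ _).trans (by gcongr))
  calc _ ≤ ‖B‖ * 1 * ‖A‖ * traceNorm X := by
        gcongr
        exact traceNorm_nonneg X
    _ = _ := by ring

lemma traceNorm_mul_le_left (A X : Matrix d d ℂ) : traceNorm (A * X) ≤ ‖A‖ * traceNorm X := by
  have h := traceNorm_mul_mul_le A X 1
  rw [mul_one] at h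
  exact h.trans (mul_le_of_le_one_right
    (mul_nonneg (norm_nonneg _) (traceNorm_nonneg _)) norm_one_matrix_le)

lemma traceNorm_mul_le_right (X A : Matrix d d ℂ) : traceNorm (X * A) ≤ traceNorm X * ‖A‖ := by
  have h := traceNorm_mul_mul_le 1 X A
  rw [one_mul] at h
  refine h.trans ?_
  gcongr
  exact mul_le_of_le_one_left (traceNorm_nonneg _) norm_one_matrix_le

lemma IsDensity.traceNorm_le_one {ρ : Matrix d d ℂ} (hρ : IsDensity ρ) : traceNorm ρ ≤ 1 := by
  have hpos := hρ.1.eigenvalues_nonneg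
  have hsum := hρ.1.1.trace_eq_sum_eigenvalues
  obtain ⟨V, hVV, hVV', hX⟩ := exists_unitary_diagonalization hρ.1.1
  have hVn' : ‖Vᴴ‖ ≤ 1 := norm_le_one_of_conjTranspose_mul_self (by simpa using hVV)
  obtain ⟨l, hl⟩ : ∃ l, l = hρ.1.1.eigenvalues := ⟨_, rfl⟩
  rw [← hl] at hX hpos hsum
  have hsum' : ∑ i, l i = 1 := by
    rw [hρ.2] at hsum
    simpa using (congrArg Complex.re hsum).symm
  refine traceNorm_le_of_forall fun U hU => ?_
  have h1 : (U * ρ).trace = (Vᴴ * U * V * Matrix.diagonal fun i => (l i : ℂ)).trace := by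
    rw [hX, show U * (V * Matrix.diagonal (fun i => (l i : ℂ)) * Vᴴ) =
      (U * V * Matrix.diagonal (fun i => (l i : ℂ))) * Vᴴ by simp only [mul_assoc],
      Matrix.trace_mul_comm]
    simp only [mul_assoc]
  rw [h1, ← hsum', Matrix.trace]
  refine (norm_sum_le _ _).trans (Finset.sum_le_sum fun i _ => ?_)
  rw [Matrix.diag_apply, Matrix.mul_diagonal, norm_mul, Complex.norm_real,
    Real.norm_of_nonneg (hpos i)]
  refine mul_le_of_le_one_left (hpos i) ((norm_mul_apply_self_le (Vᴴ * U) V i).trans ?_)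
  rw [hVV', Matrix.one_apply_eq, Complex.one_re, Real.sqrt_one, mul_one]
  exact (norm_mul_le _ _).trans (mul_le_one₀ hVn' (norm_nonneg _) hU)

end TraceNorm

/-! ### One step with a given gate -/

section StepMap

variable {d : Type*} [Fintype d] [DecidableEq d]

/-- The channel `X ↦ Tr_anc[G (|0⟩⟨0| ⊗ X) Gᴴ]` implemented by a gate `G` on ancilla and system. -/
noncomputable def stepMap (G : Matrix (Fin 2 × d) (Fin 2 × d) ℂ) (X : Matrix d d ℂ) :
    Matrix d d ℂ :=
  trAnc (conjBy G (withAnc X))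

/-- The block `⟨k| G |l⟩` of a matrix on ancilla and system. -/
noncomputable def ancBlock (k l : Fin 2) (G : Matrix (Fin 2 × d) (Fin 2 × d) ℂ) : Matrix d d ℂ :=
  Matrix.of fun i j => G (k, i) (l, j)

/-- The isometry `|k⟩ ⊗ I` from the system to ancilla and system. -/
noncomputable def ancKet (k : Fin 2) : Matrix (Fin 2 × d) d ℂ :=
  Matrix.of fun p j => if p.1 = k ∧ p.2 = j then 1 else 0

lemma norm_ancKet_le (k : Fin 2) : ‖ancKet (d := d) k‖ ≤ 1 := by
  refine norm_le_one_of_conjTranspose_mul_self ?_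
  ext i j
  simp only [Matrix.mul_apply, Matrix.conjTranspose_apply, ancKet, Matrix.of_apply,
    Fintype.sum_prod_type, Matrix.one_apply]
  rw [Finset.sum_eq_single k (fun b _ hb => by simp [hb]) (by simp),
    Finset.sum_eq_single i (fun b _ hb => by simp [hb]) (by simp)]
  simp

lemma ancBlock_add (k l : Fin 2) (G G' : Matrix (Fin 2 × d) (Fin 2 × d) ℂ) :
    ancBlock k l (G + G') = ancBlock k l G + ancBlock k l G' := rfl

lemma ancBlock_sub (k l : Fin 2) (G G' : Matrix (Fin 2 × d) (Fin 2 × d) ℂ) :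
    ancBlock k l (G - G') = ancBlock k l G - ancBlock k l G' := rfl

lemma ancBlock_smul (k l : Fin 2) (c : ℂ) (G : Matrix (Fin 2 × d) (Fin 2 × d) ℂ) :
    ancBlock k l (c • G) = c • ancBlock k l G := rfl

lemma ancBlock_mul (k l : Fin 2) (G G' : Matrix (Fin 2 × d) (Fin 2 × d) ℂ) :
    ancBlock k l (G * G') = ancBlock k 0 G * ancBlock 0 l G' + ancBlock k 1 G * ancBlock 1 l G' := by
  ext i j
  simp [ancBlock, Matrix.mul_apply, Fintype.sum_prod_type]

lemma ancBlock_one (k l : Fin 2) : ancBlock k l (1 : Matrix (Fin 2 × d) (Fin 2 × d) ℂ) =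
    if k = l then 1 else 0 := by
  ext i j
  simp only [ancBlock, Matrix.of_apply, Matrix.one_apply, Prod.mk.injEq]
  split_ifs with h1 h2 h2 <;> simp_all [Matrix.one_apply]

lemma ancBlock_kronecker (k l : Fin 2) (M : Matrix (Fin 2) (Fin 2) ℂ) (A : Matrix d d ℂ) :
    ancBlock k l (M ⊗ₖ A) = M k l • A := by
  ext i j
  simp [ancBlock, Matrix.kroneckerMap_apply]

lemma ancBlock_eq (k l : Fin 2) (G : Matrix (Fin 2 × d) (Fin 2 × d) ℂ) :
    ancBlock k l G = (ancKet (d := d) k)ᴴ * G * ancKet (d := d) l := by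
  ext i j
  simp only [Matrix.mul_apply, Matrix.conjTranspose_apply, ancKet, Matrix.of_apply, ancBlock,
    Fintype.sum_prod_type]
  rw [Finset.sum_eq_single l (fun b _ hb => by simp [hb]) (by simp),
    Finset.sum_eq_single j (fun b _ hb => by simp [hb]) (by simp),
    Finset.sum_eq_single k (fun b _ hb => by simp [hb]) (by simp),
    Finset.sum_eq_single i (fun b _ hb => by simp [hb]) (by simp)]
  simp

lemma norm_ancBlock_le (k l : Fin 2) (G : Matrix (Fin 2 × d) (Fin 2 × d) ℂ) :
    ‖ancBlock k l G‖ ≤ ‖G‖ := by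
  rw [ancBlock_eq]
  have h1 := norm_ancKet_le (d := d) k
  have h2 := norm_ancKet_le (d := d) l
  rw [← Matrix.l2_opNorm_conjTranspose] at h1
  calc _ ≤ ‖(ancKet (d := d) k)ᴴ‖ * ‖G‖ * ‖ancKet (d := d) l‖ :=
        (Matrix.l2_opNorm_mul _ _).trans (by gcongr; exact Matrix.l2_opNorm_mul _ _)
    _ ≤ 1 * ‖G‖ * 1 := by gcongr
    _ = ‖G‖ := by ring

lemma onSystem_mul (U V : Matrix d d ℂ) : onSystem (U * V) = onSystem U * onSystem V := by
  simp [onSystem, ← Matrix.mul_kronecker_mul]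

lemma onSystem_one : onSystem (1 : Matrix d d ℂ) = 1 := by
  simp [onSystem]

lemma onSystem_conjTranspose (U : Matrix d d ℂ) : onSystem Uᴴ = (onSystem U)ᴴ := by
  simp [onSystem, Matrix.conjTranspose_kronecker]

lemma onSystem_sub (U V : Matrix d d ℂ) : onSystem (U - V) = onSystem U - onSystem V := by
  ext ⟨k, i⟩ ⟨l, j⟩
  simp [onSystem, mul_sub]

lemma onSystem_pow (U : Matrix d d ℂ) (k : ℕ) : onSystem (U ^ k) = onSystem U ^ k := by
  induction k with
  | zero => simp [onSystem_one]
  | succ k ih => rw [pow_succ, onSystem_mul, ih, pow_succ]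

/-- The embedding `U ↦ I ⊗ U` as a star homomorphism. -/
noncomputable def onSystemHom : Matrix d d ℂ →⋆ₙₐ[ℂ] Matrix (Fin 2 × d) (Fin 2 × d) ℂ where
  toFun := onSystem
  map_smul' c U := by simp [onSystem, Matrix.kronecker_smul]
  map_zero' := by simp [onSystem]
  map_add' U V := by simp [onSystem, Matrix.kronecker_add]
  map_mul' := onSystem_mul
  map_star' := onSystem_conjTranspose

lemma norm_onSystem_le (U : Matrix d d ℂ) : ‖onSystem U‖ ≤ ‖U‖ :=
  NonUnitalStarAlgHom.norm_apply_le onSystemHom U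

lemma trace_mul_trAnc (W : Matrix d d ℂ) (Y : Matrix (Fin 2 × d) (Fin 2 × d) ℂ) :
    (W * trAnc Y).trace = (onSystem W * Y).trace := by
  simp only [Matrix.trace, Matrix.diag_apply, Matrix.mul_apply, trAnc, onSystem, Matrix.of_apply,
    Fintype.sum_prod_type, Fin.sum_univ_two, Matrix.kroneckerMap_apply, mul_add]
  simp [Finset.sum_add_distrib]

lemma withAnc_eq (X : Matrix d d ℂ) : withAnc X = ancKet (d := d) 0 * X * (ancKet (d := d) 0)ᴴ := by
  ext ⟨k, i⟩ ⟨l, j⟩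
  simp only [withAnc, Matrix.kroneckerMap_apply, Matrix.mul_apply, Matrix.conjTranspose_apply,
    ancKet, Matrix.of_apply]
  rw [Finset.sum_eq_single j (fun b _ hb => by simp [hb.symm]) (by simp),
    Finset.sum_eq_single i (fun b _ hb => by simp [hb.symm]) (by simp)]
  fin_cases k <;> fin_cases l <;> simp

lemma trace_mul_stepMap (W X : Matrix d d ℂ) (G : Matrix (Fin 2 × d) (Fin 2 × d) ℂ) :
    (W * stepMap G X).trace = (ancBlock 0 0 (Gᴴ * onSystem W * G) * X).trace := by
  rw [stepMap, trace_mul_trAnc, conjBy, withAnc_eq, ancBlock_eq]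
  rw [show onSystem W * (G * (ancKet (d := d) 0 * X * (ancKet (d := d) 0)ᴴ) * Gᴴ) =
    (onSystem W * G * ancKet (d := d) 0 * X) * ((ancKet (d := d) 0)ᴴ * Gᴴ) by simp only [Matrix.mul_assoc],
    Matrix.trace_mul_comm]
  simp only [Matrix.mul_assoc]

/-- By duality it is enough that the adjoint map `W ↦ ⟨0| Gᴴ (I ⊗ W) G |0⟩` contracts the operator
norm. -/
lemma traceNorm_stepMap_le {G : Matrix (Fin 2 × d) (Fin 2 × d) ℂ} (hG : ‖G‖ ≤ 1)
    (X : Matrix d d ℂ) : traceNorm (stepMap G X) ≤ traceNorm X := by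
  refine traceNorm_le_of_forall fun W hW => ?_
  rw [trace_mul_stepMap]
  refine (norm_trace_mul_le _ _).trans
    (mul_le_of_le_one_left (traceNorm_nonneg X) ((norm_ancBlock_le _ _ _).trans ?_))
  calc _ ≤ ‖Gᴴ‖ * ‖onSystem W‖ * ‖G‖ := (norm_mul_le _ _).trans (by gcongr; exact norm_mul_le _ _)
    _ ≤ 1 * 1 * 1 := by
        rw [Matrix.l2_opNorm_conjTranspose]
        gcongr
        exact (norm_onSystem_le W).trans hW
    _ = 1 := by norm_num

lemma traceNorm_stepMap_sub_le {G G' : Matrix (Fin 2 × d) (Fin 2 × d) ℂ} (hG : ‖G‖ ≤ 1)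
    (hG' : ‖G'‖ ≤ 1) (X : Matrix d d ℂ) :
    traceNorm (stepMap G X - stepMap G' X) ≤ 2 * ‖G - G'‖ * traceNorm X := by
  refine traceNorm_le_of_forall fun W hW => ?_
  rw [mul_sub, Matrix.trace_sub, trace_mul_stepMap, trace_mul_stepMap, ← Matrix.trace_sub, ← sub_mul,
    ← ancBlock_sub]
  refine (norm_trace_mul_le _ _).trans
    (mul_le_mul_of_nonneg_right ((norm_ancBlock_le _ _ _).trans ?_) (traceNorm_nonneg X))
  have h : Gᴴ * onSystem W * G - G'ᴴ * onSystem W * G' =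
      (G - G')ᴴ * onSystem W * G + G'ᴴ * onSystem W * (G - G') := by
    rw [Matrix.conjTranspose_sub]
    noncomm_ring
  have hW' := (norm_onSystem_le W).trans hW
  rw [h]
  calc _ ≤ ‖(G - G')ᴴ‖ * ‖onSystem W‖ * ‖G‖ + ‖G'ᴴ‖ * ‖onSystem W‖ * ‖G - G'‖ :=
        (norm_add_le _ _).trans (add_le_add
          ((norm_mul_le _ _).trans (by gcongr; exact norm_mul_le _ _))
          ((norm_mul_le _ _).trans (by gcongr; exact norm_mul_le _ _)))
    _ ≤ ‖G - G'‖ * 1 * 1 + 1 * 1 * ‖G - G'‖ := by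
        rw [Matrix.l2_opNorm_conjTranspose, Matrix.l2_opNorm_conjTranspose]
        gcongr
    _ = 2 * ‖G - G'‖ := by ring

/-- The Kraus form of `stepMap G`. -/
lemma stepMap_eq (G : Matrix (Fin 2 × d) (Fin 2 × d) ℂ) (X : Matrix d d ℂ) :
    stepMap G X = ancBlock 0 0 G * X * (ancBlock 0 0 G)ᴴ +
      ancBlock 1 0 G * X * (ancBlock 1 0 G)ᴴ := by
  have h : ∀ Y : Matrix (Fin 2 × d) (Fin 2 × d) ℂ, trAnc Y = ancBlock 0 0 Y + ancBlock 1 1 Y := by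
    intro Y
    ext i j
    simp [trAnc, ancBlock]
  have h2 : ∀ k : Fin 2, ancBlock k k (conjBy G (withAnc X)) =
      ancBlock k 0 G * X * (ancBlock k 0 G)ᴴ := fun k => by
    rw [ancBlock_eq, conjBy, withAnc_eq, ancBlock_eq]
    simp only [Matrix.conjTranspose_mul, Matrix.conjTranspose_conjTranspose, Matrix.mul_assoc]
  rw [stepMap, h, h2, h2]

lemma stepMap_add (G : Matrix (Fin 2 × d) (Fin 2 × d) ℂ) (X Y : Matrix d d ℂ) :
    stepMap G (X + Y) = stepMap G X + stepMap G Y := by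
  simp only [stepMap_eq, mul_add, add_mul]
  abel

lemma stepMap_smul (G : Matrix (Fin 2 × d) (Fin 2 × d) ℂ) (c : ℂ) (X : Matrix d d ℂ) :
    stepMap G (c • X) = c • stepMap G X := by
  simp only [stepMap_eq, Matrix.mul_smul, Matrix.smul_mul, smul_add]

/-- If the first column of blocks of the gate `G` is `1 - θ²/2 Lᴴ L`, `-i θ L` up to errors of
orders `x⁴` and `x³`, then `stepMap G` is `1 + θ² 𝓓[L]` up to an error of order `x⁴`. -/
lemma traceNorm_stepMap_sub_dissipator_le {G : Matrix (Fin 2 × d) (Fin 2 × d) ℂ} (hG : ‖G‖ ≤ 1)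
    {L : Matrix d d ℂ} {θ x : ℝ} (hθ : 0 ≤ θ) (hL : θ * ‖L‖ ≤ x) (hx : x ≤ 1)
    (h0 : ‖ancBlock 0 0 G - (1 - ((θ ^ 2 / 2 : ℝ) : ℂ) • (Lᴴ * L))‖ ≤ x ^ 4)
    (h1 : ‖ancBlock 1 0 G - (-(Complex.I * θ)) • L‖ ≤ 2 * x ^ 3) (X : Matrix d d ℂ) :
    traceNorm (stepMap G X - X - ((θ ^ 2 : ℝ) : ℂ) • dissipator L X) ≤ 12 * x ^ 4 * traceNorm X := by
  have hx0 : 0 ≤ x := (mul_nonneg hθ (norm_nonneg _)).trans hL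
  set K0 := ancBlock 0 0 G with hK0
  set K1 := ancBlock 1 0 G with hK1
  set Q : Matrix d d ℂ := ((θ ^ 2 / 2 : ℝ) : ℂ) • (Lᴴ * L) with hQ
  set P : Matrix d d ℂ := (-(Complex.I * θ)) • L with hP
  have hQn : ‖Q‖ ≤ x ^ 2 / 2 := by
    rw [hQ, norm_smul, Matrix.l2_opNorm_conjTranspose_mul_self, Complex.norm_real,
      Real.norm_of_nonneg (by positivity)]
    calc θ ^ 2 / 2 * (‖L‖ * ‖L‖) = (θ * ‖L‖) ^ 2 / 2 := by ring
      _ ≤ x ^ 2 / 2 := by gcongr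
  have hQh : Qᴴ = Q := by
    rw [hQ, Matrix.conjTranspose_smul, Matrix.conjTranspose_mul, Matrix.conjTranspose_conjTranspose,
      Complex.star_def, Complex.conj_ofReal]
  have hPn : ‖P‖ ≤ x := by
    rw [hP, norm_smul, norm_neg, norm_mul, Complex.norm_I, Complex.norm_real, one_mul,
      Real.norm_of_nonneg hθ]
    exact hL
  have hK0n : ‖K0‖ ≤ 1 := (norm_ancBlock_le _ _ _).trans hG
  have hD0n : ‖1 - Q‖ ≤ 2 := by
    refine (norm_sub_le _ _).trans ?_
    have := norm_one_matrix_le (d := d)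
    nlinarith
  have hK1n : ‖K1‖ ≤ 3 * x := by
    calc ‖K1‖ = ‖(K1 - P) + P‖ := by rw [sub_add_cancel]
      _ ≤ 2 * x ^ 3 + x := (norm_add_le _ _).trans (add_le_add h1 hPn)
      _ ≤ 3 * x := by
        have : x ^ 3 ≤ x := pow_le_of_le_one hx0 hx (by norm_num)
        linarith
  have hPP : P * X * Pᴴ = ((θ ^ 2 : ℝ) : ℂ) • (L * X * Lᴴ) := by
    rw [hP, Matrix.conjTranspose_smul, Matrix.smul_mul, Matrix.smul_mul, Matrix.mul_smul, smul_smul]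
    congr 1
    simp only [Complex.star_def, map_neg, map_mul, Complex.conj_I, Complex.conj_ofReal]
    push_cast
    linear_combination (-(θ : ℂ) ^ 2) * Complex.I_mul_I
  have key : stepMap G X - X - ((θ ^ 2 : ℝ) : ℂ) • dissipator L X =
      ((K0 - (1 - Q)) * X * K0ᴴ + (1 - Q) * X * (K0 - (1 - Q))ᴴ) + Q * X * Q +
        ((K1 - P) * X * K1ᴴ + P * X * (K1 - P)ᴴ) := by
    have hdis : ((θ ^ 2 : ℝ) : ℂ) • dissipator L X = P * X * Pᴴ - (Q * X + X * Q) := by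
      rw [hPP, hQ]
      simp only [dissipator, LinearMap.coe_mk, AddHom.coe_mk, smul_sub, smul_add, smul_smul,
        Matrix.smul_mul, Matrix.mul_smul]
      push_cast
      simp only [mul_one_div]
    rw [hdis, stepMap_eq, ← hK0, ← hK1]
    simp only [Matrix.conjTranspose_sub, Matrix.conjTranspose_one, hQh]
    noncomm_ring
  have hX := traceNorm_nonneg X
  have bound : ∀ (A B : Matrix d d ℂ) (a b : ℝ), ‖A‖ ≤ a → ‖B‖ ≤ b →
      traceNorm (A * X * B) ≤ a * b * traceNorm X := by
    intro A B a b ha hb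
    have := (norm_nonneg A).trans ha
    calc _ ≤ ‖A‖ * traceNorm X * ‖B‖ := traceNorm_mul_mul_le _ _ _
      _ ≤ a * traceNorm X * b := by gcongr
      _ = _ := by ring
  have e1 := bound (K0 - (1 - Q)) K0ᴴ _ 1 h0 (by rwa [Matrix.l2_opNorm_conjTranspose])
  have e2 := bound (1 - Q) (K0 - (1 - Q))ᴴ 2 _ hD0n
    ((Matrix.l2_opNorm_conjTranspose _).trans_le h0)
  have e3 := bound Q Q _ _ hQn hQn
  have e4 := bound (K1 - P) K1ᴴ _ _ h1 ((Matrix.l2_opNorm_conjTranspose _).trans_le hK1n)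
  have e5 := bound P (K1 - P)ᴴ _ _ hPn ((Matrix.l2_opNorm_conjTranspose _).trans_le h1)
  rw [key]
  refine (traceNorm_add_le _ _).trans ?_
  refine (add_le_add ((traceNorm_add_le _ _).trans (add_le_add (traceNorm_add_le _ _) le_rfl))
    (traceNorm_add_le _ _)).trans ?_
  have : 0 ≤ x ^ 4 * traceNorm X := by positivity
  nlinarith

end StepMap

/-! ### Third-order jets of symmetric products of exponentials -/

section Jets

variable {R : Type*} [NormedRing R] [NormedAlgebra ℂ R] [CompleteSpace R]

/-- The Taylor remainder of the exponential is dominated by its scalar counterpart. -/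
lemma norm_exp_sub_sum_le {Y : R} {x : ℝ} (hY : ‖Y‖ ≤ x) {n : ℕ} (hn : 0 < n) :
    ‖NormedSpace.exp Y - ∑ k ∈ Finset.range n, ((k.factorial : ℂ)⁻¹) • Y ^ k‖ ≤
      Real.exp x - ∑ k ∈ Finset.range n, x ^ k / k.factorial := by
  have h1 := (hasSum_nat_add_iff' n).2 (NormedSpace.exp_series_hasSum_exp' (𝕂 := ℂ) Y)
  have h2 : HasSum (fun k : ℕ => x ^ k / k.factorial) (Real.exp x) := by
    rw [Real.exp_eq_exp_ℝ]
    exact NormedSpace.expSeries_div_hasSum_exp x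
  have h3 := (hasSum_nat_add_iff' n).2 h2
  rw [← h1.tsum_eq]
  refine tsum_of_norm_bounded h3 fun k => ?_
  rw [norm_smul, norm_inv, Complex.norm_natCast, inv_mul_eq_div]
  gcongr
  exact (norm_pow_le' Y (by omega)).trans (by gcongr)

/-- The fourth-order Taylor remainder of the real exponential. -/
noncomputable def expRem (x : ℝ) : ℝ := Real.exp x - (1 + x + x ^ 2 / 2 + x ^ 3 / 6)

lemma expRem_le {x : ℝ} (h0 : 0 ≤ x) (h1 : x ≤ 1) : expRem x ≤ x ^ 4 / 4 := by
  have h := Real.exp_bound (x := x) (by rwa [abs_of_nonneg h0]) (n := 4) (by norm_num)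
  have h' := (le_abs_self _).trans h
  rw [abs_of_nonneg h0] at h'
  simp only [Finset.sum_range_succ, Finset.sum_range_zero, Nat.factorial] at h'
  norm_num at h'
  rw [expRem]
  nlinarith [pow_nonneg h0 4]

/-- `A` has the jet `1 + A₁ + A₂ + A₃`, with all terms and the remainder dominated by those of
`exp x`. The odd terms lie in `O` and the even one in `E`. -/
structure HasJet (O E : Submodule ℂ R) (x : ℝ) (A A₁ A₂ A₃ : R) : Prop where
  norm_fst : ‖A₁‖ ≤ x
  norm_snd : ‖A₂‖ ≤ x ^ 2 / 2
  norm_thd : ‖A₃‖ ≤ x ^ 3 / 6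
  norm_rem : ‖A - (1 + A₁ + A₂ + A₃)‖ ≤ expRem x
  mem_fst : A₁ ∈ O
  mem_snd : A₂ ∈ E
  mem_thd : A₃ ∈ O

variable {O E : Submodule ℂ R}

lemma hasJet_exp (hOO : ∀ a ∈ O, ∀ b ∈ O, a * b ∈ E) (hEO : ∀ a ∈ E, ∀ b ∈ O, a * b ∈ O)
    {Y : R} {x : ℝ} (hY : ‖Y‖ ≤ x) (hO : Y ∈ O) :
    HasJet O E x (NormedSpace.exp Y) Y ((1 / 2 : ℂ) • Y ^ 2) ((1 / 6 : ℂ) • Y ^ 3) := by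
  have h2 : Y ^ 2 ∈ E := by rw [sq]; exact hOO _ hO _ hO
  refine ⟨hY, ?_, ?_, ?_, hO, E.smul_mem _ h2, O.smul_mem _ ?_⟩
  · rw [norm_smul]
    calc ‖(1 / 2 : ℂ)‖ * ‖Y ^ 2‖ ≤ ‖(1 / 2 : ℂ)‖ * x ^ 2 := by
          gcongr
          exact (norm_pow_le' Y (by norm_num)).trans (by gcongr)
      _ = _ := by norm_num; ring
  · rw [norm_smul]
    calc ‖(1 / 6 : ℂ)‖ * ‖Y ^ 3‖ ≤ ‖(1 / 6 : ℂ)‖ * x ^ 3 := by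
          gcongr
          exact (norm_pow_le' Y (by norm_num)).trans (by gcongr)
      _ = _ := by norm_num; ring
  · have := norm_exp_sub_sum_le hY (n := 4) (by norm_num)
    simpa [Finset.sum_range_succ, Nat.factorial, expRem] using this
  · rw [pow_succ]; exact hEO _ h2 _ hO

lemma HasJet.mul (h1 : ‖(1 : R)‖ ≤ 1) (hOO : ∀ a ∈ O, ∀ b ∈ O, a * b ∈ E)
    (hEO : ∀ a ∈ E, ∀ b ∈ O, a * b ∈ O) (hOE : ∀ a ∈ O, ∀ b ∈ E, a * b ∈ O)
    {x y : ℝ} {A A₁ A₂ A₃ B B₁ B₂ B₃ : R} (hA : HasJet O E x A A₁ A₂ A₃)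
    (hB : HasJet O E y B B₁ B₂ B₃) :
    HasJet O E (x + y) (A * B) (A₁ + B₁) (A₂ + A₁ * B₁ + B₂)
      (A₃ + A₂ * B₁ + A₁ * B₂ + B₃) := by
  obtain ⟨a1, a2, a3, ar, ao, ae, at'⟩ := hA
  obtain ⟨b1, b2, b3, br, bo, be, bt⟩ := hB
  have hx : 0 ≤ x := (norm_nonneg _).trans a1
  have hy : 0 ≤ y := (norm_nonneg _).trans b1
  have m : ∀ {u v : R} {p q : ℝ}, ‖u‖ ≤ p → ‖v‖ ≤ q → ‖u * v‖ ≤ p * q := fun hu hv =>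
    (norm_mul_le _ _).trans
      (mul_le_mul hu hv (norm_nonneg _) ((norm_nonneg _).trans hu))
  have p : ∀ {u v : R} {p q : ℝ}, ‖u‖ ≤ p → ‖v‖ ≤ q → ‖u + v‖ ≤ p + q := fun hu hv =>
    (norm_add_le _ _).trans (add_le_add hu hv)
  refine ⟨p a1 b1, ?_, ?_, ?_, O.add_mem ao bo,
    E.add_mem (E.add_mem ae (hOO _ ao _ bo)) be,
    O.add_mem (O.add_mem (O.add_mem at' (hEO _ ae _ bo)) (hOE _ ao _ be)) bt⟩
  · exact (p (p a2 (m a1 b1)) b2).trans_eq (by ring)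
  · exact (p (p (p a3 (m a2 b1)) (m a1 b2)) b3).trans_eq (by ring)
  · have hB : ‖B‖ ≤ Real.exp y := by
      calc ‖B‖ = ‖(B - (1 + B₁ + B₂ + B₃)) + (1 + B₁ + B₂ + B₃)‖ := by rw [sub_add_cancel]
        _ ≤ expRem y + (1 + y + y ^ 2 / 2 + y ^ 3 / 6) := p br (p (p (p h1 b1) b2) b3)
        _ = Real.exp y := by rw [expRem]; ring
    have key : A * B - (1 + (A₁ + B₁) + (A₂ + A₁ * B₁ + B₂) + (A₃ + A₂ * B₁ + A₁ * B₂ + B₃)) =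
        (A - (1 + A₁ + A₂ + A₃)) * B + (1 + A₁ + A₂ + A₃) * (B - (1 + B₁ + B₂ + B₃)) +
          (A₁ * B₃ + A₂ * B₂ + A₂ * B₃ + A₃ * B₁ + A₃ * B₂ + A₃ * B₃) := by
      noncomm_ring
    rw [key]
    refine (p (p (m ar hB) (m (p (p (p h1 a1) a2) a3) br))
      (p (p (p (p (p (m a1 b3) (m a2 b2)) (m a2 b3)) (m a3 b1)) (m a3 b2)) (m a3 b3))).trans_eq ?_
    rw [expRem, expRem, expRem, Real.exp_add]
    ring

/-- A symmetric product of exponentials agrees with the exponential of the sum to second order. -/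
lemma exists_hasJet_symm_prod (h1 : ‖(1 : R)‖ ≤ 1) (hOO : ∀ a ∈ O, ∀ b ∈ O, a * b ∈ E)
    (hEO : ∀ a ∈ E, ∀ b ∈ O, a * b ∈ O) (hOE : ∀ a ∈ O, ∀ b ∈ E, a * b ∈ O)
    {ι : Type*} (Y : ι → R) (b : ι → ℝ) (l : List ι) (hY : ∀ i ∈ l, Y i ∈ O)
    (hb : ∀ i ∈ l, ‖Y i‖ ≤ b i) :
    ∃ A₃, HasJet O E (2 * (l.map b).sum)
      ((l.map fun i => NormedSpace.exp (Y i)).prod *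
        (l.reverse.map fun i => NormedSpace.exp (Y i)).prod)
      ((2 : ℂ) • (l.map Y).sum) ((1 / 2 : ℂ) • ((2 : ℂ) • (l.map Y).sum) ^ 2) A₃ := by
  induction l with
  | nil =>
    refine ⟨0, ?_, ?_, ?_, ?_, ?_, ?_, ?_⟩ <;> simp [expRem]
  | cons i l ih =>
    obtain ⟨A₃, h⟩ := ih (fun j hj => hY j (List.mem_cons_of_mem _ hj))
      (fun j hj => hb j (List.mem_cons_of_mem _ hj))
    have he := hasJet_exp hOO hEO (hb i List.mem_cons_self) (hY i List.mem_cons_self)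
    have key : ∀ {x x' : ℝ} {A A' B₁ B₁' B₂ B₂' B₃ : R}, HasJet O E x A B₁ B₂ B₃ → x' = x →
        A' = A → B₁' = B₁ → B₂' = B₂ → ∃ B, HasJet O E x' A' B₁' B₂' B := by
      rintro _ _ _ _ _ _ _ _ B h rfl rfl rfl rfl
      exact ⟨B, h⟩
    refine key ((he.mul h1 hOO hEO hOE h).mul h1 hOO hEO hOE he) ?_ ?_ ?_ ?_
    · simp only [List.map_cons, List.sum_cons]
      ring
    · simp only [List.map_cons, List.prod_cons, List.reverse_cons, List.map_append, List.prod_append,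
        List.map_nil, List.prod_nil, mul_one, mul_assoc]
    · simp only [List.map_cons, List.sum_cons, smul_add, two_smul]
      abel
    · simp only [List.map_cons, List.sum_cons]
      generalize (l.map Y).sum = S
      simp only [sq, smul_add, mul_add, add_mul, smul_mul_assoc, mul_smul_comm, smul_smul]
      module

end Jets

/-! ### Unitary evolutions and product formulas -/

section Evolution

variable {d : Type*} [Fintype d] [DecidableEq d]

lemma evol_zero (H : Matrix d d ℂ) : evol H 0 = 1 := by
  simp [evol]

lemma evol_add (H : Matrix d d ℂ) (s t : ℝ) : evol H (s + t) = evol H s * evol H t := by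
  rw [evol, evol, evol, ← Matrix.exp_add_of_commute _ _
    ((Commute.refl H).smul_left _ |>.smul_right _), ← add_smul]
  congr 2
  push_cast
  ring

lemma evol_conjTranspose {H : Matrix d d ℂ} (hH : H.IsHermitian) (t : ℝ) :
    (evol H t)ᴴ = evol H (-t) := by
  rw [evol, evol, ← Matrix.exp_conjTranspose, Matrix.conjTranspose_smul, hH.eq]
  congr 2
  simp

lemma evol_mul_evol_neg (H : Matrix d d ℂ) (t : ℝ) : evol H t * evol H (-t) = 1 := by
  rw [← evol_add, add_neg_cancel, evol_zero]

lemma evol_neg_mul_evol (H : Matrix d d ℂ) (t : ℝ) : evol H (-t) * evol H t = 1 := by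
  rw [← evol_add, neg_add_cancel, evol_zero]

lemma norm_evol_le {H : Matrix d d ℂ} (hH : H.IsHermitian) (t : ℝ) : ‖evol H t‖ ≤ 1 :=
  norm_le_one_of_conjTranspose_mul_self (by rw [evol_conjTranspose hH, evol_neg_mul_evol])

lemma evol_pow (H : Matrix d d ℂ) (t : ℝ) (k : ℕ) : evol H t ^ k = evol H (k * t) := by
  induction k with
  | zero => simp [evol_zero]
  | succ k ih => rw [pow_succ, ih, ← evol_add]; push_cast; ring_nf

lemma norm_list_prod_le_one {l : List (Matrix d d ℂ)} (hl : ∀ A ∈ l, ‖A‖ ≤ 1) : ‖l.prod‖ ≤ 1 := by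
  induction l with
  | nil => exact norm_one_matrix_le
  | cons A l ih =>
    rw [List.prod_cons]
    exact (norm_mul_le _ _).trans (mul_le_one₀ (hl A List.mem_cons_self) (norm_nonneg _)
      (ih fun B hB => hl B (List.mem_cons_of_mem _ hB)))

lemma norm_pow_le_one {A : Matrix d d ℂ} (hA : ‖A‖ ≤ 1) (k : ℕ) : ‖A ^ k‖ ≤ 1 := by
  rw [← List.prod_replicate]
  exact norm_list_prod_le_one fun B hB => (List.eq_of_mem_replicate hB) ▸ hA

lemma norm_pow_sub_pow_le {A B : Matrix d d ℂ} (hA : ‖A‖ ≤ 1) (hB : ‖B‖ ≤ 1) (k : ℕ) :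
    ‖A ^ k - B ^ k‖ ≤ k * ‖A - B‖ := by
  induction k with
  | zero => simp
  | succ k ih =>
    have : A ^ (k + 1) - B ^ (k + 1) = A ^ k * (A - B) + (A ^ k - B ^ k) * B := by
      simp only [pow_succ]; noncomm_ring
    rw [this]
    calc _ ≤ ‖A ^ k‖ * ‖A - B‖ + ‖A ^ k - B ^ k‖ * ‖B‖ :=
          (norm_add_le _ _).trans (add_le_add (norm_mul_le _ _) (norm_mul_le _ _))
      _ ≤ 1 * ‖A - B‖ + (k * ‖A - B‖) * 1 := by
          gcongr
          exact norm_pow_le_one hA k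
      _ = _ := by push_cast; ring

lemma norm_strang_le {m : ℕ} {h : Fin m → Matrix d d ℂ} (hh : ∀ j, (h j).IsHermitian) (t : ℝ) :
    ‖strang h t‖ ≤ 1 := by
  refine (norm_mul_le _ _).trans (mul_le_one₀ ?_ (norm_nonneg _) ?_)
  all_goals
    refine norm_list_prod_le_one fun A hA => ?_
    simp only [List.mem_reverse, List.mem_ofFn] at hA
    obtain ⟨j, rfl⟩ := hA
    exact norm_evol_le (hh j) _

lemma norm_productFormula_le {m : ℕ} {h : Fin m → Matrix d d ℂ} (hh : ∀ j, (h j).IsHermitian)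
    (r : ℕ) (t : ℝ) : ‖productFormula h r t‖ ≤ 1 :=
  norm_pow_le_one (norm_strang_le hh _) r

lemma isHermitian_sum {m : ℕ} {h : Fin m → Matrix d d ℂ} (hh : ∀ j, (h j).IsHermitian) :
    (∑ j, h j).IsHermitian := by
  rw [Matrix.IsHermitian, Matrix.conjTranspose_sum]
  exact Finset.sum_congr rfl fun j _ => hh j

lemma norm_strang_sub_evol_le {m : ℕ} {h : Fin m → Matrix d d ℂ} (hh : ∀ j, (h j).IsHermitian)
    {t : ℝ} (ht : 0 ≤ t) {Λ : ℝ} (hΛ : ∑ j, ‖h j‖ ≤ Λ) :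
    ‖strang h t - evol (∑ j, h j) t‖ ≤ 3 * (Λ * t) ^ 3 := by
  set y : ℝ := (∑ j, ‖h j‖) * t with hy
  have hy0 : 0 ≤ y := by positivity
  suffices hs : ‖strang h t - evol (∑ j, h j) t‖ ≤ 3 * y ^ 3 by
    refine hs.trans ?_
    have : y ≤ Λ * t := mul_le_mul_of_nonneg_right hΛ ht
    gcongr
  rcases le_total 1 y with h1 | h1
  · -- for large times unitarity is enough
    have : (1 : ℝ) ≤ y ^ 3 := one_le_pow₀ h1
    refine (norm_sub_le _ _).trans ?_
    have := norm_strang_le hh t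
    have := norm_evol_le (isHermitian_sum hh) t
    linarith
  · set Y : Fin m → Matrix d d ℂ := fun j => (-(Complex.I * ((t / 2 : ℝ) : ℂ))) • h j with hY
    obtain ⟨A₃, hA⟩ := exists_hasJet_symm_prod (O := ⊤) (E := ⊤) (norm_one_matrix_le (d := d))
      (by simp) (by simp) (by simp) Y (fun j => ‖h j‖ * t / 2) (List.finRange m) (by simp)
      (fun j _ => by
        rw [hY]
        simp only [norm_smul, norm_neg, norm_mul, Complex.norm_I, one_mul, Complex.norm_real]
        rw [Real.norm_of_nonneg (by positivity)]
        exact le_of_eq (by ring))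
    have e1 : 2 * ((List.finRange m).map fun j => ‖h j‖ * t / 2).sum = y := by
      rw [← List.ofFn_eq_map, List.sum_ofFn, hy, ← Finset.sum_div, ← Finset.sum_mul]
      ring
    have e2 : (2 : ℂ) • ((List.finRange m).map Y).sum = (-(Complex.I * t)) • ∑ j, h j := by
      rw [← List.ofFn_eq_map, List.sum_ofFn, hY, ← Finset.smul_sum, smul_smul]
      congr 1
      push_cast
      ring
    have e3 : ((List.finRange m).map fun j => NormedSpace.exp (Y j)).prod *
        ((List.finRange m).reverse.map fun j => NormedSpace.exp (Y j)).prod = strang h t := by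
      rw [strang, List.map_reverse, List.ofFn_eq_map]
      rfl
    rw [e1, e2, e3] at hA
    have hE := hasJet_exp (O := (⊤ : Submodule ℂ (Matrix d d ℂ))) (E := ⊤) (by simp) (by simp)
      (Y := (-(Complex.I * t)) • ∑ j, h j) hA.norm_fst (by simp)
    have key : strang h t - evol (∑ j, h j) t =
        (strang h t - (1 + (-(Complex.I * t)) • ∑ j, h j +
          (1 / 2 : ℂ) • ((-(Complex.I * t)) • ∑ j, h j) ^ 2 + A₃)) -
        (evol (∑ j, h j) t - (1 + (-(Complex.I * t)) • ∑ j, h j +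
          (1 / 2 : ℂ) • ((-(Complex.I * t)) • ∑ j, h j) ^ 2 +
          (1 / 6 : ℂ) • ((-(Complex.I * t)) • ∑ j, h j) ^ 3)) +
        (A₃ - (1 / 6 : ℂ) • ((-(Complex.I * t)) • ∑ j, h j) ^ 3) := by
      abel
    rw [key]
    refine (norm_add_le _ _).trans ((add_le_add ((norm_sub_le _ _).trans
      (add_le_add hA.norm_rem hE.norm_rem)) ((norm_sub_le _ _).trans
      (add_le_add hA.norm_thd hE.norm_thd))).trans ?_)
    have h2 := expRem_le hy0 h1
    have h3 : y ^ 4 ≤ y ^ 3 := pow_le_pow_of_le_one hy0 h1 (by norm_num)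
    have h4 : 0 ≤ y ^ 3 := by positivity
    linarith

/-- The error of the second-order product formula with `r` steps. -/
lemma norm_productFormula_sub_evol_le {m : ℕ} {h : Fin m → Matrix d d ℂ}
    (hh : ∀ j, (h j).IsHermitian) {r : ℕ} (hr : 0 < r) {t : ℝ} (ht : 0 ≤ t) {Λ : ℝ}
    (hΛ : ∑ j, ‖h j‖ ≤ Λ) :
    ‖productFormula h r t - evol (∑ j, h j) t‖ ≤ 3 * Λ ^ 3 * t ^ 3 / (r : ℝ) ^ 2 := by
  have hr' : (0 : ℝ) < r := by exact_mod_cast hr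
  have e : evol (∑ j, h j) t = evol (∑ j, h j) (t / r) ^ r := by
    rw [evol_pow]; congr 1; field_simp
  rw [productFormula, e]
  refine (norm_pow_sub_pow_le (norm_strang_le hh _)
    (norm_evol_le (isHermitian_sum hh) _) r).trans ?_
  calc _ ≤ r * (3 * (Λ * (t / r)) ^ 3) := by
        gcongr
        exact norm_strang_sub_evol_le hh (by positivity) hΛ
    _ = _ := by field_simp

end Evolution

/-! ### Symmetric gates on ancilla and system -/

section SymGate

variable {d : Type*} [Fintype d] [DecidableEq d]

/-- The Hermitian dilation `|0⟩⟨1| ⊗ Mᴴ + |1⟩⟨0| ⊗ M`. -/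
noncomputable def dilation (M : Matrix d d ℂ) : Matrix (Fin 2 × d) (Fin 2 × d) ℂ :=
  !![0, 1; 0, 0] ⊗ₖ Mᴴ + !![0, 0; 1, 0] ⊗ₖ M

lemma ancBlock_ext {G G' : Matrix (Fin 2 × d) (Fin 2 × d) ℂ}
    (h : ∀ k l, ancBlock k l G = ancBlock k l G') : G = G' := by
  ext ⟨k, i⟩ ⟨l, j⟩
  exact congrFun (congrFun (h k l) i) j

lemma ancBlock_dilation (k l : Fin 2) (M : Matrix d d ℂ) :
    ancBlock k l (dilation M) =
      (!![0, 1; 0, 0] : Matrix (Fin 2) (Fin 2) ℂ) k l • Mᴴ +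
        (!![0, 0; 1, 0] : Matrix (Fin 2) (Fin 2) ℂ) k l • M := by
  rw [dilation, ancBlock_add, ancBlock_kronecker, ancBlock_kronecker]

lemma ancBlock_onSystem (k l : Fin 2) (U : Matrix d d ℂ) :
    ancBlock k l (onSystem U) = (1 : Matrix (Fin 2) (Fin 2) ℂ) k l • U := by
  rw [onSystem, ancBlock_kronecker]

lemma dilation_isHermitian (M : Matrix d d ℂ) : (dilation M).IsHermitian := by
  ext ⟨k, i⟩ ⟨l, j⟩
  fin_cases k <;> fin_cases l <;> simp [dilation, Matrix.conjTranspose_apply]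

lemma dilation_add (M N : Matrix d d ℂ) : dilation (M + N) = dilation M + dilation N := by
  rw [dilation, Matrix.conjTranspose_add, Matrix.kronecker_add, Matrix.kronecker_add, dilation,
    dilation]
  abel

lemma dilation_zero : dilation (0 : Matrix d d ℂ) = 0 := by
  simp [dilation]

lemma dilation_list_sum {ι : Type*} (M : ι → Matrix d d ℂ) (l : List ι) :
    (l.map fun i => dilation (M i)).sum = dilation (l.map M).sum := by
  induction l with
  | nil => simp [dilation_zero]
  | cons i l ih => simp [dilation_add, ih]

lemma norm_dilation_le (M : Matrix d d ℂ) : ‖dilation M‖ ≤ 2 * ‖M‖ := by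
  have h : ∀ k l : Fin 2, ∀ N : Matrix d d ℂ,
      ‖ancKet (d := d) k * N * (ancKet (d := d) l)ᴴ‖ ≤ ‖N‖ := by
    intro k l N
    have h1 := norm_ancKet_le (d := d) k
    have h2 := norm_ancKet_le (d := d) l
    rw [← Matrix.l2_opNorm_conjTranspose] at h2
    calc _ ≤ ‖ancKet (d := d) k‖ * ‖N‖ * ‖(ancKet (d := d) l)ᴴ‖ :=
          (Matrix.l2_opNorm_mul _ _).trans (by gcongr; exact Matrix.l2_opNorm_mul _ _)
      _ ≤ 1 * ‖N‖ * 1 := by gcongr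
      _ = ‖N‖ := by ring
  have e : dilation M = ancKet (d := d) 0 * Mᴴ * (ancKet (d := d) 1)ᴴ +
      ancKet (d := d) 1 * M * (ancKet (d := d) 0)ᴴ := by
    ext ⟨k, i⟩ ⟨l, j⟩
    fin_cases k <;> fin_cases l <;>
      simp [dilation, Matrix.mul_apply, Matrix.conjTranspose_apply, ancKet]
  rw [e, two_mul]
  exact (norm_add_le _ _).trans (add_le_add ((h 0 1 _).trans_eq (Matrix.l2_opNorm_conjTranspose M))
    (h 1 0 M))

/-- Conjugating a dilation by a unitary of the system. -/
lemma onSystem_mul_dilation_mul {U V : Matrix d d ℂ} (hU : Uᴴ = V) (M : Matrix d d ℂ) :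
    onSystem U * dilation M * onSystem V = dilation (U * M * V) := by
  subst hU
  simp only [dilation, onSystem, Matrix.mul_add, Matrix.add_mul, ← Matrix.mul_kronecker_mul,
    one_mul, mul_one, Matrix.conjTranspose_mul, Matrix.conjTranspose_conjTranspose, mul_assoc]

/-- The matrices that change the state of the ancilla. -/
def ancOdd : Submodule ℂ (Matrix (Fin 2 × d) (Fin 2 × d) ℂ) where
  carrier := {G | ∀ k, ancBlock k k G = 0}
  add_mem' ha hb k := by rw [ancBlock_add, ha k, hb k, add_zero]
  zero_mem' _ := rfl
  smul_mem' c _ ha k := by rw [ancBlock_smul, ha k, smul_zero]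

/-- The matrices that preserve the state of the ancilla. -/
def ancEven : Submodule ℂ (Matrix (Fin 2 × d) (Fin 2 × d) ℂ) where
  carrier := {G | ∀ k l, k ≠ l → ancBlock k l G = 0}
  add_mem' ha hb k l h := by rw [ancBlock_add, ha k l h, hb k l h, add_zero]
  zero_mem' _ _ _ := rfl
  smul_mem' c _ ha k l h := by rw [ancBlock_smul, ha k l h, smul_zero]

lemma ancOdd_mul_ancOdd : ∀ a ∈ ancOdd (d := d), ∀ b ∈ ancOdd (d := d), a * b ∈ ancEven (d := d) := by
  intro a ha b hb k l hkl
  rw [ancBlock_mul]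
  fin_cases k <;> fin_cases l <;> first | exact absurd rfl hkl | simp [ha 0, ha 1, hb 0, hb 1]

lemma ancEven_mul_ancOdd : ∀ a ∈ ancEven (d := d), ∀ b ∈ ancOdd (d := d), a * b ∈ ancOdd (d := d) := by
  intro a ha b hb k
  have h0 := ha 0 1 (by decide)
  have h1 := ha 1 0 (by decide)
  rw [ancBlock_mul]
  fin_cases k <;> simp [h0, h1, hb 0, hb 1]

lemma ancOdd_mul_ancEven : ∀ a ∈ ancOdd (d := d), ∀ b ∈ ancEven (d := d), a * b ∈ ancOdd (d := d) := by
  intro a ha b hb k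
  have h0 := hb 0 1 (by decide)
  have h1 := hb 1 0 (by decide)
  rw [ancBlock_mul]
  fin_cases k <;> simp [h0, h1, ha 0, ha 1]

lemma dilation_mem_ancOdd (M : Matrix d d ℂ) : dilation M ∈ ancOdd (d := d) := by
  intro k
  rw [ancBlock_dilation]
  fin_cases k <;> simp

/-- The symmetric product of the evolutions for time `θ / 2` under the dilations of the matrices
`M i`, for `i` running through `l` and back. -/
noncomputable def symGate {ι : Type*} (θ : ℝ) (M : ι → Matrix d d ℂ) (l : List ι) :
    Matrix (Fin 2 × d) (Fin 2 × d) ℂ :=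
  (l.map fun i => evol (dilation (M i)) (θ / 2)).prod *
    (l.reverse.map fun i => evol (dilation (M i)) (θ / 2)).prod

lemma norm_symGate_le {ι : Type*} (θ : ℝ) (M : ι → Matrix d d ℂ) (l : List ι) :
    ‖symGate θ M l‖ ≤ 1 := by
  refine (norm_mul_le _ _).trans (mul_le_one₀ ?_ (norm_nonneg _) ?_)
  all_goals
    refine norm_list_prod_le_one fun A hA => ?_
    obtain ⟨j, -, rfl⟩ := List.mem_map.1 hA
    exact norm_evol_le (dilation_isHermitian _) _

/-- The channel implemented by a symmetric gate is `1 + θ² 𝓓[L]` to fourth order, with `L` the sum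
of the dilated matrices: the terms of odd order flip the ancilla. -/
lemma traceNorm_stepMap_symGate_sub_le {ι : Type*} {θ : ℝ} (hθ : 0 ≤ θ) (M : ι → Matrix d d ℂ)
    (l : List ι) (b : ι → ℝ) (hb : ∀ i ∈ l, ‖M i‖ ≤ b i) {x : ℝ} (hx : 2 * θ * (l.map b).sum = x)
    (hx1 : x ≤ 1) (X : Matrix d d ℂ) :
    traceNorm (stepMap (symGate θ M l) X - X - ((θ ^ 2 : ℝ) : ℂ) • dissipator (l.map M).sum X) ≤
      12 * x ^ 4 * traceNorm X := by
  set L := (l.map M).sum with hL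
  set Y : ι → Matrix (Fin 2 × d) (Fin 2 × d) ℂ :=
    fun i => (-(Complex.I * ((θ / 2 : ℝ) : ℂ))) • dilation (M i) with hY
  obtain ⟨A₃, hA⟩ := exists_hasJet_symm_prod (norm_one_matrix_le (d := Fin 2 × d))
    (ancOdd_mul_ancOdd (d := d)) ancEven_mul_ancOdd ancOdd_mul_ancEven Y (fun i => θ * b i) l
    (fun i _ => ancOdd.smul_mem _ (dilation_mem_ancOdd _))
    (fun i hi => by
      simp only [hY]
      rw [norm_smul, norm_neg, norm_mul, Complex.norm_I, one_mul, Complex.norm_real,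
        Real.norm_of_nonneg (by positivity)]
      have h1 := norm_dilation_le (M i)
      have h2 := hb i hi
      calc θ / 2 * ‖dilation (M i)‖ ≤ θ / 2 * (2 * b i) := by
            gcongr
            linarith
        _ = _ := by ring)
  have e1 : 2 * (l.map fun i => θ * b i).sum = x := by
    rw [List.sum_map_mul_left, ← hx]
    ring
  have e2 : (2 : ℂ) • (l.map Y).sum = (-(Complex.I * θ)) • dilation L := by
    have : (l.map Y).sum = (-(Complex.I * ((θ / 2 : ℝ) : ℂ))) •
        (l.map fun i => dilation (M i)).sum := by
      rw [List.smul_sum, List.map_map]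
      rfl
    rw [this, dilation_list_sum, smul_smul]
    congr 1
    push_cast
    ring
  have e3 : (l.map fun i => NormedSpace.exp (Y i)).prod *
      (l.reverse.map fun i => NormedSpace.exp (Y i)).prod = symGate θ M l := rfl
  rw [e1, e2, e3] at hA
  have hx0 : 0 ≤ x := (norm_nonneg _).trans hA.norm_fst
  have hLx : θ * ‖L‖ ≤ x := by
    have h := (norm_ancBlock_le 1 0 _).trans hA.norm_fst
    rw [ancBlock_smul, ancBlock_dilation, norm_smul, norm_neg, norm_mul, Complex.norm_I, one_mul,
      Complex.norm_real, Real.norm_of_nonneg hθ] at h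
    simpa using h
  have hrem := expRem_le hx0 hx1
  have hx4 : x ^ 4 ≤ x ^ 3 := pow_le_pow_of_le_one hx0 hx1 (by norm_num)
  have hx3 : 0 ≤ x ^ 3 := by positivity
  have hx4' : 0 ≤ x ^ 4 := by positivity
  refine traceNorm_stepMap_sub_dissipator_le (norm_symGate_le _ _ _) hθ hLx hx1 ?_ ?_ X
  · have h := (norm_ancBlock_le 0 0 _).trans hA.norm_rem
    have h0 : ancBlock 0 0 (1 + (-(Complex.I * (θ : ℂ))) • dilation L +
        (1 / 2 : ℂ) • ((-(Complex.I * (θ : ℂ))) • dilation L) ^ 2 + A₃) =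
        1 - ((θ ^ 2 / 2 : ℝ) : ℂ) • (Lᴴ * L) := by
      rw [ancBlock_add, hA.mem_thd 0, ancBlock_add, ancBlock_smul, smul_pow, ancBlock_smul,
        ancBlock_add, ancBlock_smul, sq (dilation L), ancBlock_mul, ancBlock_one]
      simp only [ancBlock_dilation, smul_smul]
      simp only [Matrix.of_apply, Matrix.cons_val', Matrix.cons_val_zero, Matrix.cons_val_one,
        Matrix.cons_val_fin_one, zero_smul, one_smul, add_zero, zero_add, smul_zero, if_true, mul_zero]
      rw [sub_eq_add_neg, ← neg_smul]
      congr 2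
      push_cast
      linear_combination ((θ : ℂ) ^ 2 / 2) * Complex.I_mul_I
    rw [ancBlock_sub, h0] at h
    linarith
  · have h := (norm_ancBlock_le 1 0 _).trans hA.norm_rem
    have h0 : ancBlock 1 0 (1 + (-(Complex.I * (θ : ℂ))) • dilation L +
        (1 / 2 : ℂ) • ((-(Complex.I * (θ : ℂ))) • dilation L) ^ 2 + A₃) =
        (-(Complex.I * (θ : ℂ))) • L + ancBlock 1 0 A₃ := by
      rw [ancBlock_add, ancBlock_add, hA.mem_snd 1 0 (by decide), ancBlock_add, ancBlock_smul,
        ancBlock_one, ancBlock_dilation]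
      simp
    rw [ancBlock_sub, h0] at h
    have h3 := (norm_ancBlock_le 1 0 _).trans hA.norm_thd
    calc _ = ‖(ancBlock 1 0 (symGate θ M l) - ((-(Complex.I * (θ : ℂ))) • L + ancBlock 1 0 A₃)) +
          ancBlock 1 0 A₃‖ := by congr 1; abel
      _ ≤ expRem x + x ^ 3 / 6 := (norm_add_le _ _).trans (add_le_add h h3)
      _ ≤ _ := by linarith

end SymGate

/-! ### The gate `V` in the interaction picture -/

section Telescoping

variable {R : Type*} [Monoid R] {u v : R}

lemma prod_map_mul_right_eq (huv : u * v = 1) (B : ℕ → R) (N : ℕ) :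
    ((List.range N).map fun j => B j * v).prod =
      ((List.range N).map fun j => v ^ j * B j * u ^ j).prod * v ^ N := by
  induction N with
  | zero => simp
  | succ N ih =>
    rw [List.range_succ, List.map_append, List.prod_append, ih, List.map_append, List.prod_append]
    simp only [List.map_cons, List.map_nil, List.prod_cons, List.prod_nil, mul_one, mul_assoc]
    rw [pow_succ v N, ← mul_assoc (u ^ N), pow_mul_pow_eq_one N huv, one_mul]

lemma prod_reverse_map_mul_left_eq (huv : u * v = 1) (B : ℕ → R) (N : ℕ) :
    ((List.range N).reverse.map fun j => u * B j).prod =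
      u ^ N * ((List.range N).reverse.map fun j => v ^ j * B j * u ^ j).prod := by
  induction N with
  | zero => simp
  | succ N ih =>
    simp only [List.range_succ, List.reverse_append, List.reverse_singleton, List.singleton_append,
      List.map_cons, List.prod_cons]
    rw [ih, pow_succ' u N]
    simp only [mul_assoc]
    rw [← mul_assoc (u ^ N) (v ^ N), pow_mul_pow_eq_one N huv, one_mul]

lemma mul_list_prod_mul {u v : R} (hvu : v * u = 1) (huv : u * v = 1) {ι : Type*} (f : ι → R)
    (l : List ι) : u * (l.map f).prod * v = (l.map fun i => u * f i * v).prod := by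
  induction l with
  | nil => simp [huv]
  | cons i l ih =>
    simp only [List.map_cons, List.prod_cons]
    rw [← ih]
    simp only [mul_assoc]
    rw [← mul_assoc v u, hvu, one_mul]

/-- In the interaction picture the evolutions between the gates `B j` disappear. -/
lemma interaction_picture (huv : u * v = 1) (hvu : v * u = 1) (B : ℕ → R) (N S : ℕ) :
    u ^ S * (((List.range N).map fun j => B j * v).prod *
        ((List.range N).reverse.map fun j => u * B j).prod) * v ^ S =
      ((List.range N).map fun j => u ^ S * (v ^ j * B j * u ^ j) * v ^ S).prod *
        ((List.range N).reverse.map fun j => u ^ S * (v ^ j * B j * u ^ j) * v ^ S).prod := by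
  rw [prod_map_mul_right_eq huv, prod_reverse_map_mul_left_eq huv,
    ← mul_list_prod_mul (pow_mul_pow_eq_one S hvu) (pow_mul_pow_eq_one S huv),
    ← mul_list_prod_mul (pow_mul_pow_eq_one S hvu) (pow_mul_pow_eq_one S huv)]
  generalize ((List.range N).map fun j => v ^ j * B j * u ^ j).prod = P
  generalize ((List.range N).reverse.map fun j => v ^ j * B j * u ^ j).prod = Q
  simp only [mul_assoc]
  rw [← mul_assoc (v ^ N), pow_mul_pow_eq_one N hvu, one_mul, ← mul_assoc (v ^ S),
    pow_mul_pow_eq_one S hvu, one_mul]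

end Telescoping

section GateV

variable {d : Type*} [Fintype d] [DecidableEq d]

lemma norm_list_map_prod_sub_le {ι : Type*} (l : List ι) (f g : ι → Matrix d d ℂ) {c : ℝ}
    (hf : ∀ i, ‖f i‖ ≤ 1) (hg : ∀ i, ‖g i‖ ≤ 1) (h : ∀ i, ‖f i - g i‖ ≤ c) :
    ‖(l.map f).prod - (l.map g).prod‖ ≤ l.length * c := by
  induction l with
  | nil => simp
  | cons i l ih =>
    simp only [List.map_cons, List.prod_cons, List.length_cons]
    have hl : ‖(l.map g).prod‖ ≤ 1 := norm_list_prod_le_one fun A hA => by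
      obtain ⟨j, -, rfl⟩ := List.mem_map.1 hA
      exact hg j
    have : f i * (l.map f).prod - g i * (l.map g).prod =
        f i * ((l.map f).prod - (l.map g).prod) + (f i - g i) * (l.map g).prod := by
      noncomm_ring
    rw [this]
    calc _ ≤ ‖f i‖ * ‖(l.map f).prod - (l.map g).prod‖ + ‖f i - g i‖ * ‖(l.map g).prod‖ :=
          (norm_add_le _ _).trans (add_le_add (norm_mul_le _ _) (norm_mul_le _ _))
      _ ≤ 1 * (l.length * c) + c * 1 := by
          gcongr
          · exact hf i
          · exact (norm_nonneg _).trans (h i)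
          · exact h i
      _ = _ := by push_cast; ring

lemma evol_conj {U V : Matrix d d ℂ} (hUV : U * V = 1) (K : Matrix d d ℂ) (t : ℝ) :
    U * evol K t * V = evol (U * K * V) t := by
  have hU : IsUnit U := ⟨⟨U, V, hUV, mul_eq_one_comm.1 hUV⟩, rfl⟩
  have hV : U⁻¹ = V := Matrix.inv_eq_right_inv hUV
  rw [evol, evol, ← hV, ← Matrix.exp_conj U _ hU, Matrix.mul_smul, Matrix.smul_mul]

lemma onSystem_evol_mul_evol_dilation {H : Matrix d d ℂ} (hH : H.IsHermitian) (N : Matrix d d ℂ)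
    (s t : ℝ) :
    onSystem (evol H (-s)) * evol (dilation N) t * onSystem (evol H s) =
      evol (dilation (heisenberg H N s)) t := by
  rw [evol_conj (by rw [← onSystem_mul, evol_neg_mul_evol, onSystem_one]),
    onSystem_mul_dilation_mul (by rw [evol_conjTranspose hH, neg_neg])]
  rfl

end GateV

namespace Protocol

variable {m : ℕ} {ι d : Type*} [Fintype ι] [Fintype d] [DecidableEq d] (P : Protocol m ι d)

lemma H_isHermitian : P.H.IsHermitian := isHermitian_sum P.term_hermitian

/-- The dissipative coupling strength `√(δt γ)`. -/
noncomputable def θ : ℝ := Real.sqrt (P.δt * P.γ)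

/-- The jump operators being Hermitian, the generator of `Bₛᵃ` is the dilation of `Δtₛ g(s Δt) Aᵃ`. -/
lemma gateB_eq (a : ι) (s : ℤ) : P.gateB a s =
    evol (dilation (((P.weight s : ℂ) * filter P.β (s * P.Δt)) • P.jump a)) (P.θ / 2) := by
  rw [gateB, evol]
  congr 1
  have h : dilation (((P.weight s : ℂ) * filter P.β (s * P.Δt)) • P.jump a) =
      (P.weight s : ℂ) • ((((filter P.β (s * P.Δt)).re : ℂ) • pauliX +
        ((filter P.β (s * P.Δt)).im : ℂ) • pauliY) ⊗ₖ P.jump a) := by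
    refine ancBlock_ext fun k l => ?_
    rw [ancBlock_dilation, ancBlock_smul, ancBlock_kronecker, Matrix.conjTranspose_smul,
      (P.jump_hermitian a).eq, smul_smul, smul_smul, smul_smul, ← add_smul]
    congr 1
    generalize filter P.β (s * P.Δt) = g
    fin_cases k <;> fin_cases l <;>
      simp [pauliX, pauliY, Complex.ext_iff]
  rw [h, smul_smul]
  congr 1
  rw [θ]
  push_cast
  ring

/-- The gate `V` with a matrix `F` in place of the short evolution. -/
noncomputable def gateVWith (F : Matrix d d ℂ) (a : ι) : Matrix (Fin 2 × d) (Fin 2 × d) ℂ :=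
  ((List.range (2 * P.S + 1)).map fun j : ℕ => P.gateB a ((j : ℤ) - P.S) * onSystem Fᴴ).prod *
    ((List.range (2 * P.S + 1)).reverse.map fun j : ℕ =>
      onSystem F * P.gateB a ((j : ℤ) - P.S)).prod

lemma gateV_eq (a : ι) : P.gateV a = P.gateVWith P.shortEvol a := rfl

lemma norm_gateB_le (a : ι) (s : ℤ) : ‖P.gateB a s‖ ≤ 1 := by
  rw [gateB_eq]
  exact norm_evol_le (dilation_isHermitian _) _

lemma norm_onSystem_le_one {F : Matrix d d ℂ} (hF : ‖F‖ ≤ 1) : ‖onSystem F‖ ≤ 1 :=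
  (norm_onSystem_le F).trans hF

lemma norm_gateVWith_le {F : Matrix d d ℂ} (hF : ‖F‖ ≤ 1) (a : ι) : ‖P.gateVWith F a‖ ≤ 1 := by
  have hF' : ‖Fᴴ‖ ≤ 1 := by rwa [Matrix.l2_opNorm_conjTranspose]
  refine (norm_mul_le _ _).trans (mul_le_one₀ ?_ (norm_nonneg _) ?_)
  all_goals
    refine norm_list_prod_le_one fun A hA => ?_
    obtain ⟨j, -, rfl⟩ := List.mem_map.1 hA
    refine (norm_mul_le _ _).trans (mul_le_one₀ ?_ (norm_nonneg _) ?_)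
  · exact P.norm_gateB_le a _
  · exact norm_onSystem_le_one hF'
  · exact norm_onSystem_le_one hF
  · exact P.norm_gateB_le a _

lemma norm_gateVWith_sub_le {F F' : Matrix d d ℂ} (hF : ‖F‖ ≤ 1) (hF' : ‖F'‖ ≤ 1) (a : ι) :
    ‖P.gateVWith F a - P.gateVWith F' a‖ ≤ 2 * (2 * P.S + 1) * ‖F - F'‖ := by
  set l := List.range (2 * P.S + 1) with hl
  have hc : ∀ {G : Matrix d d ℂ}, ‖G‖ ≤ 1 → ‖Gᴴ‖ ≤ 1 := fun h => by
    rwa [Matrix.l2_opNorm_conjTranspose]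
  have n1 : ∀ {G : Matrix d d ℂ}, ‖G‖ ≤ 1 → ∀ j : ℕ,
      ‖P.gateB a ((j : ℤ) - P.S) * onSystem Gᴴ‖ ≤ 1 := fun h j =>
    (norm_mul_le _ _).trans
      (mul_le_one₀ (P.norm_gateB_le a _) (norm_nonneg _) (norm_onSystem_le_one (hc h)))
  have n2 : ∀ {G : Matrix d d ℂ}, ‖G‖ ≤ 1 → ∀ j : ℕ,
      ‖onSystem G * P.gateB a ((j : ℤ) - P.S)‖ ≤ 1 := fun h j =>
    (norm_mul_le _ _).trans
      (mul_le_one₀ (norm_onSystem_le_one h) (norm_nonneg _) (P.norm_gateB_le a _))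
  have d1 := norm_list_map_prod_sub_le l (fun j : ℕ => P.gateB a ((j : ℤ) - P.S) * onSystem Fᴴ)
    (fun j : ℕ => P.gateB a ((j : ℤ) - P.S) * onSystem F'ᴴ) (c := ‖F - F'‖) (n1 hF) (n1 hF')
    (fun j => by
      rw [← mul_sub, ← onSystem_sub, ← Matrix.conjTranspose_sub]
      refine (norm_mul_le _ _).trans ?_
      refine (mul_le_of_le_one_left (norm_nonneg _) (P.norm_gateB_le a _)).trans ?_
      exact (norm_onSystem_le _).trans_eq (Matrix.l2_opNorm_conjTranspose _))
  have d2 := norm_list_map_prod_sub_le l.reverse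
    (fun j : ℕ => onSystem F * P.gateB a ((j : ℤ) - P.S))
    (fun j : ℕ => onSystem F' * P.gateB a ((j : ℤ) - P.S)) (c := ‖F - F'‖) (n2 hF) (n2 hF')
    (fun j => by
      rw [← sub_mul, ← onSystem_sub]
      refine (norm_mul_le _ _).trans ?_
      exact (mul_le_of_le_one_right (norm_nonneg _) (P.norm_gateB_le a _)).trans
        (norm_onSystem_le _))
  rw [List.length_reverse] at d2
  have hlen : (l.length : ℝ) = 2 * P.S + 1 := by rw [hl, List.length_range]; push_cast; ring
  rw [hlen] at d1 d2
  have p1 : ‖(l.map fun j : ℕ => P.gateB a ((j : ℤ) - P.S) * onSystem Fᴴ).prod‖ ≤ 1 :=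
    norm_list_prod_le_one fun A hA => by
      obtain ⟨j, -, rfl⟩ := List.mem_map.1 hA
      exact n1 hF j
  have p2 : ‖(l.reverse.map fun j : ℕ => onSystem F' * P.gateB a ((j : ℤ) - P.S)).prod‖ ≤ 1 :=
    norm_list_prod_le_one fun A hA => by
      obtain ⟨j, -, rfl⟩ := List.mem_map.1 hA
      exact n2 hF' j
  rw [gateVWith, gateVWith, ← hl]
  revert d1 d2 p1 p2
  generalize (l.map fun j : ℕ => P.gateB a ((j : ℤ) - P.S) * onSystem Fᴴ).prod = X
  generalize (l.map fun j : ℕ => P.gateB a ((j : ℤ) - P.S) * onSystem F'ᴴ).prod = X'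
  generalize (l.reverse.map fun j : ℕ => onSystem F * P.gateB a ((j : ℤ) - P.S)).prod = Y
  generalize (l.reverse.map fun j : ℕ => onSystem F' * P.gateB a ((j : ℤ) - P.S)).prod = Y'
  intro d1 d2 p1 p2
  have : X * Y - X' * Y' = X * (Y - Y') + (X - X') * Y' := by noncomm_ring
  rw [this]
  calc _ ≤ ‖X‖ * ‖Y - Y'‖ + ‖X - X'‖ * ‖Y'‖ :=
        (norm_add_le _ _).trans (add_le_add (norm_mul_le _ _) (norm_mul_le _ _))
    _ ≤ 1 * ((2 * P.S + 1) * ‖F - F'‖) + ((2 * P.S + 1) * ‖F - F'‖) * 1 := by gcongr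
    _ = _ := by ring

/-- The terms of the trapezoidal sum for the Lindblad operator, indexed by `j = s + S`. -/
noncomputable def sample (a : ι) (j : ℕ) : Matrix d d ℂ :=
  ((P.weight ((j : ℤ) - P.S) : ℂ) * filter P.β (((j : ℤ) - P.S : ℤ) * P.Δt)) •
    heisenberg P.H (P.jump a) (((j : ℤ) - P.S : ℤ) * P.Δt)

/-- The gate `V` with exact evolutions, in the interaction picture. -/
noncomputable def idealGate (a : ι) : Matrix (Fin 2 × d) (Fin 2 × d) ℂ :=
  symGate P.θ (P.sample a) (List.range (2 * P.S + 1))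

lemma norm_idealGate_le (a : ι) : ‖P.idealGate a‖ ≤ 1 := norm_symGate_le _ _ _

lemma heisenberg_smul (H A : Matrix d d ℂ) (c : ℂ) (t : ℝ) :
    heisenberg H (c • A) t = c • heisenberg H A t := by
  simp [heisenberg]

lemma onSystem_mul_gateVWith_mul (a : ι) :
    onSystem (evol P.H P.T) * P.gateVWith (evol P.H P.Δt) a * onSystem (evol P.H (-P.T)) =
      P.idealGate a := by
  have hu : onSystem (evol P.H P.T) = onSystem (evol P.H P.Δt) ^ P.S := by
    rw [← onSystem_pow, evol_pow]; rfl
  have hv : onSystem (evol P.H (-P.T)) = onSystem (evol P.H (-P.Δt)) ^ P.S := by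
    rw [← onSystem_pow, evol_pow, T, mul_neg]
  rw [hu, hv, gateVWith, evol_conjTranspose P.H_isHermitian, interaction_picture
    (by rw [← onSystem_mul, evol_mul_evol_neg, onSystem_one])
    (by rw [← onSystem_mul, evol_neg_mul_evol, onSystem_one])
    (fun j : ℕ => P.gateB a ((j : ℤ) - P.S)), idealGate, symGate]
  have key : ∀ j : ℕ, onSystem (evol P.H P.Δt) ^ P.S * (onSystem (evol P.H (-P.Δt)) ^ j *
      P.gateB a ((j : ℤ) - P.S) * onSystem (evol P.H P.Δt) ^ j) *
      onSystem (evol P.H (-P.Δt)) ^ P.S = evol (dilation (P.sample a j)) (P.θ / 2) := by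
    intro j
    have e1 : onSystem (evol P.H P.Δt) ^ P.S * onSystem (evol P.H (-P.Δt)) ^ j =
        onSystem (evol P.H (-(((j : ℤ) - P.S : ℤ) * P.Δt))) := by
      rw [← onSystem_pow, ← onSystem_pow, ← onSystem_mul, evol_pow, evol_pow, ← evol_add]
      congr 2
      push_cast
      ring
    have e2 : onSystem (evol P.H P.Δt) ^ j * onSystem (evol P.H (-P.Δt)) ^ P.S =
        onSystem (evol P.H (((j : ℤ) - P.S : ℤ) * P.Δt)) := by
      rw [← onSystem_pow, ← onSystem_pow, ← onSystem_mul, evol_pow, evol_pow, ← evol_add]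
      congr 2
      push_cast
      ring
    calc _ = (onSystem (evol P.H P.Δt) ^ P.S * onSystem (evol P.H (-P.Δt)) ^ j) *
          P.gateB a ((j : ℤ) - P.S) *
          (onSystem (evol P.H P.Δt) ^ j * onSystem (evol P.H (-P.Δt)) ^ P.S) := by
          simp only [mul_assoc]
      _ = _ := by
          rw [e1, e2, gateB_eq, onSystem_evol_mul_evol_dilation P.H_isHermitian, heisenberg_smul,
            sample]
  simp only [key]

end Protocol

/-! ### Semigroups in the trace norm -/

section Semigroup

variable {d : Type*} [Fintype d] [DecidableEq d]

lemma semigroup_zero (𝓛 : Matrix d d ℂ →ₗ[ℂ] Matrix d d ℂ) (X : Matrix d d ℂ) :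
    semigroup 𝓛 0 X = X := by
  have h : ((0 : ℝ) : ℂ) • LinearMap.toContinuousLinearMap 𝓛 = 0 := by
    ext1 Y
    simp
  rw [semigroup, h, NormedSpace.exp_zero]
  rfl

lemma semigroup_add (𝓛 : Matrix d d ℂ →ₗ[ℂ] Matrix d d ℂ) (s t : ℝ) (X : Matrix d d ℂ) :
    semigroup 𝓛 (s + t) X = semigroup 𝓛 s (semigroup 𝓛 t X) := by
  set T := LinearMap.toContinuousLinearMap 𝓛 with hT
  have h : ((s + t : ℝ) : ℂ) • T = (s : ℂ) • T + (t : ℂ) • T := by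
    ext1 Y
    simp [add_smul]
  have hc : Commute ((s : ℂ) • T) ((t : ℂ) • T) := by
    ext1 Y
    simp only [ContinuousLinearMap.mul_def, ContinuousLinearMap.comp_smul,
      ContinuousLinearMap.smul_comp]
    rw [smul_comm]
  rw [semigroup, ← hT, h]
  let _ : NormedAlgebra ℚ (Matrix d d ℂ →L[ℂ] Matrix d d ℂ) := NormedAlgebra.restrictScalars ℚ ℂ _
  exact congrArg (fun F : Matrix d d ℂ →L[ℂ] Matrix d d ℂ => F X)
    (NormedSpace.exp_add_of_commute (𝔸 := Matrix d d ℂ →L[ℂ] Matrix d d ℂ) hc)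

lemma traceNorm_semigroup_sub_le {𝓛 : Matrix d d ℂ →ₗ[ℂ] Matrix d d ℂ} {c : ℝ}
    (h𝓛 : ∀ X, traceNorm (𝓛 X) ≤ c * traceNorm X) {t : ℝ} (ht : 0 ≤ t) (hc : 0 ≤ c)
    (hct : c * t ≤ 1) (X : Matrix d d ℂ) :
    traceNorm (semigroup 𝓛 t X - X - (t : ℂ) • 𝓛 X) ≤ (c * t) ^ 2 * traceNorm X := by
  set T := LinearMap.toContinuousLinearMap 𝓛 with hT
  refine traceNorm_le_of_forall fun U hU => ?_
  have h1 := NormedSpace.exp_series_hasSum_exp' (𝕂 := ℂ) ((t : ℂ) • T)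
  have h2 : HasSum (fun k : ℕ => (U * ((k.factorial : ℂ)⁻¹ • ((t : ℂ) • T) ^ k) X).trace)
      (U * semigroup 𝓛 t X).trace :=
    h1.mapL ((LinearMap.toContinuousLinearMap (Matrix.traceLinearMap d ℂ ℂ ∘ₗ
      LinearMap.mulLeft ℂ U)).comp (ContinuousLinearMap.apply ℂ (Matrix d d ℂ) X))
  have h3 := (hasSum_nat_add_iff' 2).2 h2
  have h4 : (U * semigroup 𝓛 t X).trace - ∑ k ∈ Finset.range 2,
      (U * ((k.factorial : ℂ)⁻¹ • ((t : ℂ) • T) ^ k) X).trace =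
      (U * (semigroup 𝓛 t X - X - (t : ℂ) • 𝓛 X)).trace := by
    have e1 : (((t : ℂ) • T) ^ 0) X = X := rfl
    have e2 : (((t : ℂ) • T) ^ 1) X = (t : ℂ) • 𝓛 X := by
      rw [pow_one]
      rfl
    simp only [Finset.sum_range_succ, Finset.sum_range_zero, zero_add, Nat.factorial,
      Nat.cast_one, inv_one, one_smul, mul_one, e1, e2, mul_sub, Matrix.trace_sub]
    ring
  rw [h4] at h3
  have hpow : ∀ k : ℕ, traceNorm ((((t : ℂ) • T) ^ k) X) ≤ (c * t) ^ k * traceNorm X := by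
    intro k
    induction k with
    | zero => simp
    | succ k ih =>
      rw [pow_succ', mul_apply_eq_comp]
      set Y := (((t : ℂ) • T) ^ k) X
      calc _ ≤ ‖(t : ℂ)‖ * traceNorm (𝓛 Y) := traceNorm_smul_le _ _
        _ ≤ t * (c * ((c * t) ^ k * traceNorm X)) := by
            rw [Complex.norm_real, Real.norm_of_nonneg ht]
            gcongr
            exact (h𝓛 Y).trans (by gcongr)
        _ = _ := by ring
  have h5 : HasSum (fun k : ℕ => (c * t) ^ k / k.factorial) (Real.exp (c * t)) := by
    rw [Real.exp_eq_exp_ℝ]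
    exact NormedSpace.expSeries_div_hasSum_exp _
  have h6 := ((hasSum_nat_add_iff' 2).2 h5).mul_right (traceNorm X)
  rw [← h3.tsum_eq]
  refine (tsum_of_norm_bounded h6 fun k => ?_).trans ?_
  · rw [FunLike.coe_smul, Pi.smul_apply, Matrix.mul_smul, Matrix.trace_smul, norm_smul, norm_inv,
      Complex.norm_natCast]
    calc _ ≤ ((k + 2).factorial : ℝ)⁻¹ * (1 * ((c * t) ^ (k + 2) * traceNorm X)) := by
          gcongr
          refine (norm_trace_mul_le _ _).trans ?_
          gcongr
          · exact traceNorm_nonneg _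
          · exact hpow _
      _ = _ := by rw [div_eq_inv_mul]; ring
  · have := traceNorm_nonneg X
    gcongr
    have hn : ‖c * t‖ ≤ 1 := by rwa [Real.norm_of_nonneg (by positivity)]
    have := (le_abs_self _).trans (Real.norm_exp_sub_one_sub_id_le hn)
    rw [Real.norm_of_nonneg (by positivity)] at this
    simpa [Finset.sum_range_succ, sub_sub] using this

/-- A semigroup that is a contraction up to second order is a contraction. -/
lemma traceNorm_semigroup_le {𝓛 : Matrix d d ℂ →ₗ[ℂ] Matrix d d ℂ} {K q : ℝ} (hK : 0 ≤ K)
    (h : ∀ δ, 0 ≤ δ → δ * q ≤ 1 → ∀ X, traceNorm (semigroup 𝓛 δ X) ≤ (1 + K * δ ^ 2) * traceNorm X)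
    {t : ℝ} (ht : 0 ≤ t) (X : Matrix d d ℂ) : traceNorm (semigroup 𝓛 t X) ≤ traceNorm X := by
  have hX := traceNorm_nonneg X
  have hn : ∀ δ, 0 ≤ δ → δ * q ≤ 1 → ∀ n : ℕ,
      traceNorm (semigroup 𝓛 (n * δ) X) ≤ (1 + K * δ ^ 2) ^ n * traceNorm X := by
    intro δ hδ hq n
    induction n with
    | zero => simp [semigroup_zero]
    | succ n ih =>
      rw [show ((n + 1 : ℕ) : ℝ) * δ = δ + n * δ by push_cast; ring, semigroup_add, pow_succ']
      refine (h δ hδ hq _).trans ?_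
      rw [mul_assoc]
      gcongr
  have hlim : Filter.Tendsto (fun n : ℕ => Real.exp (K * t ^ 2 / n) * traceNorm X) Filter.atTop
      (nhds (Real.exp 0 * traceNorm X)) :=
    ((Real.continuous_exp.tendsto 0).comp
      (tendsto_const_div_atTop_nhds_zero_nat (K * t ^ 2))).mul_const _
  rw [Real.exp_zero, one_mul] at hlim
  refine ge_of_tendsto hlim ?_
  have hq : ∀ᶠ n : ℕ in Filter.atTop, t * q ≤ n := Filter.eventually_atTop.2
    ⟨⌈t * q⌉₊, fun n hn => (Nat.le_ceil _).trans (by exact_mod_cast hn)⟩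
  filter_upwards [hq, Filter.eventually_gt_atTop 0] with n h1 h0
  have h0' : (0 : ℝ) < n := by exact_mod_cast h0
  have h2 := hn (t / n) (by positivity) (by rw [div_mul_eq_mul_div, div_le_one h0']; exact h1) n
  rw [mul_div_cancel₀ _ h0'.ne'] at h2
  refine h2.trans ?_
  gcongr
  calc (1 + K * (t / n) ^ 2) ^ n ≤ (Real.exp (K * (t / n) ^ 2)) ^ n := by
        gcongr
        linarith [Real.add_one_le_exp (K * (t / n) ^ 2)]
    _ = Real.exp (K * t ^ 2 / n) := by
        rw [← Real.exp_nat_mul]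
        congr 1
        field_simp

end Semigroup

/-! ### One step of the simulation and the Lindblad evolution -/

section StepError

variable {d : Type*} [Fintype d] [DecidableEq d]

lemma traceNorm_conjBy_le {U : Matrix d d ℂ} (hU : ‖U‖ ≤ 1) (X : Matrix d d ℂ) :
    traceNorm (conjBy U X) ≤ traceNorm X := by
  refine (traceNorm_mul_mul_le _ _ _).trans ?_
  rw [Matrix.l2_opNorm_conjTranspose]
  have := traceNorm_nonneg X
  calc _ ≤ 1 * traceNorm X * 1 := by gcongr
    _ = _ := by ring

lemma traceNorm_conjBy_sub_le {U V : Matrix d d ℂ} (hU : ‖U‖ ≤ 1) (hV : ‖V‖ ≤ 1)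
    (X : Matrix d d ℂ) : traceNorm (conjBy U X - conjBy V X) ≤ 2 * ‖U - V‖ * traceNorm X := by
  have e : conjBy U X - conjBy V X = (U - V) * X * Uᴴ + V * X * (U - V)ᴴ := by
    simp only [conjBy, Matrix.conjTranspose_sub]
    noncomm_ring
  have := traceNorm_nonneg X
  rw [e]
  refine (traceNorm_add_le _ _).trans ((add_le_add (traceNorm_mul_mul_le _ _ _)
    (traceNorm_mul_mul_le _ _ _)).trans ?_)
  rw [Matrix.l2_opNorm_conjTranspose, Matrix.l2_opNorm_conjTranspose]
  calc _ ≤ ‖U - V‖ * traceNorm X * 1 + 1 * traceNorm X * ‖U - V‖ := by gcongr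
    _ = _ := by ring

lemma traceNorm_coherentPart_le (H X : Matrix d d ℂ) :
    traceNorm (coherentPart H X) ≤ 2 * ‖H‖ * traceNorm X := by
  refine (traceNorm_smul_le _ _).trans ?_
  rw [norm_neg, Complex.norm_I, one_mul]
  refine (traceNorm_sub_le _ _).trans ?_
  have h1 := traceNorm_mul_le_left H X
  have h2 := traceNorm_mul_le_right X H
  linarith

lemma traceNorm_dissipator_sub_le (L L' X : Matrix d d ℂ) :
    traceNorm (dissipator L X - dissipator L' X) ≤
      2 * (‖L‖ + ‖L'‖) * ‖L - L'‖ * traceNorm X := by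
  set E := L - L' with hE
  set Q := Lᴴ * E + Eᴴ * L' with hQ
  have e : dissipator L X - dissipator L' X =
      E * X * Lᴴ + L' * X * Eᴴ - (1 / 2 : ℂ) • (Q * X + X * Q) := by
    have hq : Q = Lᴴ * L - L'ᴴ * L' := by
      rw [hQ, hE, Matrix.conjTranspose_sub]
      noncomm_ring
    rw [hq, hE]
    simp only [dissipator, LinearMap.coe_mk, AddHom.coe_mk, Matrix.conjTranspose_sub, sub_mul,
      mul_sub, smul_sub, smul_add, mul_assoc]
    abel
  have hQn : ‖Q‖ ≤ (‖L‖ + ‖L'‖) * ‖E‖ := by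
    refine (norm_add_le _ _).trans ((add_le_add (norm_mul_le _ _) (norm_mul_le _ _)).trans ?_)
    rw [Matrix.l2_opNorm_conjTranspose, Matrix.l2_opNorm_conjTranspose]
    exact le_of_eq (by ring)
  have hX := traceNorm_nonneg X
  have t1 := traceNorm_mul_mul_le E X Lᴴ
  have t2 := traceNorm_mul_mul_le L' X Eᴴ
  have t3 : traceNorm ((1 / 2 : ℂ) • (Q * X + X * Q)) ≤ (‖L‖ + ‖L'‖) * ‖E‖ * traceNorm X := by
    refine (traceNorm_smul_le _ _).trans ?_
    have h := (traceNorm_add_le (Q * X) (X * Q)).trans (add_le_add (traceNorm_mul_le_left Q X)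
      (traceNorm_mul_le_right X Q))
    calc _ ≤ ‖(1 / 2 : ℂ)‖ * (‖Q‖ * traceNorm X + traceNorm X * ‖Q‖) := by gcongr
      _ = ‖Q‖ * traceNorm X := by norm_num; ring
      _ ≤ _ := by gcongr
  rw [Matrix.l2_opNorm_conjTranspose] at t1 t2
  rw [e]
  refine (traceNorm_sub_le _ _).trans ((add_le_add ((traceNorm_add_le _ _).trans
    (add_le_add t1 t2)) t3).trans (le_of_eq (by ring)))

lemma traceNorm_dissipator_le (L X : Matrix d d ℂ) :
    traceNorm (dissipator L X) ≤ 2 * ‖L‖ ^ 2 * traceNorm X := by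
  have h := traceNorm_dissipator_sub_le L 0 X
  have h0 : dissipator (0 : Matrix d d ℂ) X = 0 := by simp [dissipator]
  rw [h0, sub_zero, sub_zero, norm_zero, add_zero] at h
  exact h.trans_eq (by ring)

lemma norm_neg_I_smul (H : Matrix d d ℂ) {t : ℝ} (ht : 0 ≤ t) :
    ‖(-(Complex.I * t)) • H‖ = ‖H‖ * t := by
  rw [norm_smul, norm_neg, norm_mul, Complex.norm_I, one_mul, Complex.norm_real,
    Real.norm_of_nonneg ht, mul_comm]

lemma norm_evol_sub_one_le {H : Matrix d d ℂ} {t : ℝ} (ht : 0 ≤ t) (h1 : ‖H‖ * t ≤ 1) :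
    ‖evol H t - 1‖ ≤ 2 * (‖H‖ * t) := by
  have h := norm_exp_sub_sum_le (norm_neg_I_smul H ht).le (n := 1) one_pos
  have hn : ‖‖H‖ * t‖ ≤ 1 := by rwa [Real.norm_of_nonneg (by positivity)]
  have h' := (le_abs_self _).trans (Real.norm_exp_sub_one_sub_id_le hn)
  rw [Real.norm_of_nonneg (by positivity)] at h'
  simp only [Finset.range_one, Finset.sum_singleton, Nat.factorial, pow_zero, Nat.cast_one, inv_one,
    one_smul, div_one] at h
  have h0 : 0 ≤ ‖H‖ * t := by positivity
  refine h.trans ?_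
  nlinarith

lemma norm_evol_sub_one_sub_le {H : Matrix d d ℂ} {t : ℝ} (ht : 0 ≤ t) (h1 : ‖H‖ * t ≤ 1) :
    ‖evol H t - 1 - (-(Complex.I * t)) • H‖ ≤ (‖H‖ * t) ^ 2 := by
  have h := norm_exp_sub_sum_le (norm_neg_I_smul H ht).le (n := 2) two_pos
  have hn : ‖‖H‖ * t‖ ≤ 1 := by rwa [Real.norm_of_nonneg (by positivity)]
  have h' := (le_abs_self _).trans (Real.norm_exp_sub_one_sub_id_le hn)
  rw [Real.norm_of_nonneg (by positivity)] at h'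
  simp only [Finset.sum_range_succ, Finset.sum_range_zero, Nat.factorial, pow_zero, Nat.cast_one,
    inv_one, one_smul, div_one, pow_one, zero_add, mul_one] at h
  rw [sub_sub]
  refine h.trans ?_
  linarith

lemma traceNorm_conjBy_evol_sub_self_le {H : Matrix d d ℂ} (hH : H.IsHermitian) {t : ℝ}
    (ht : 0 ≤ t) (h1 : ‖H‖ * t ≤ 1) (X : Matrix d d ℂ) :
    traceNorm (conjBy (evol H t) X - X) ≤ 4 * (‖H‖ * t) * traceNorm X := by
  have h := traceNorm_conjBy_sub_le (norm_evol_le hH t) norm_one_matrix_le X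
  have e : conjBy 1 X = X := by simp [conjBy]
  rw [e] at h
  refine h.trans ?_
  have := traceNorm_nonneg X
  have := norm_evol_sub_one_le ht h1
  calc _ ≤ 2 * (2 * (‖H‖ * t)) * traceNorm X := by gcongr
    _ = _ := by ring

lemma traceNorm_conjBy_evol_sub_le {H : Matrix d d ℂ} (hH : H.IsHermitian) {t : ℝ}
    (ht : 0 ≤ t) (h1 : ‖H‖ * t ≤ 1) (X : Matrix d d ℂ) :
    traceNorm (conjBy (evol H t) X - X - (t : ℂ) • coherentPart H X) ≤
      4 * (‖H‖ * t) ^ 2 * traceNorm X := by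
  set U := evol H t with hU
  set Y := (-(Complex.I * t)) • H with hY
  have hYY : Yᴴ = -Y := by
    rw [hY, Matrix.conjTranspose_smul, hH.eq, ← neg_smul]
    congr 1
    simp
  have e : conjBy U X - X - (t : ℂ) • coherentPart H X =
      (U - 1 - Y) * X * Uᴴ + Y * X * (U - 1)ᴴ + X * (U - 1 - Y)ᴴ := by
    have hc : (t : ℂ) • coherentPart H X = Y * X - X * Y := by
      rw [hY]
      simp only [coherentPart, LinearMap.coe_mk, AddHom.coe_mk, smul_smul, Matrix.smul_mul,
        Matrix.mul_smul, ← smul_sub]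
      congr 1
      ring
    rw [hc, conjBy]
    simp only [Matrix.conjTranspose_sub, Matrix.conjTranspose_one, hYY]
    noncomm_ring
  have hX := traceNorm_nonneg X
  have hUn := norm_evol_le hH t
  have a1 := norm_evol_sub_one_le ht h1
  have a2 := norm_evol_sub_one_sub_le ht h1
  have a3 := norm_neg_I_smul H ht
  rw [← hU] at hUn a1 a2
  rw [← hY] at a2 a3
  have h0 : 0 ≤ ‖H‖ * t := by positivity
  rw [e]
  refine (traceNorm_add_le _ _).trans ((add_le_add ((traceNorm_add_le _ _).trans
    (add_le_add (traceNorm_mul_mul_le _ _ _) (traceNorm_mul_mul_le _ _ _)))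
    (traceNorm_mul_le_right _ _)).trans ?_)
  rw [Matrix.l2_opNorm_conjTranspose, Matrix.l2_opNorm_conjTranspose,
    Matrix.l2_opNorm_conjTranspose, a3]
  calc _ ≤ (‖H‖ * t) ^ 2 * traceNorm X * 1 + ‖H‖ * t * traceNorm X * (2 * (‖H‖ * t)) +
        traceNorm X * (‖H‖ * t) ^ 2 := by gcongr
    _ = _ := by ring

/-- The generator `X ↦ ∑ₐ pₐ (-i [H, X] + γ 𝓓[Lᵃ] X)`. -/
noncomputable def generator {ι : Type*} [Fintype ι] (p : ι → ℝ) (H : Matrix d d ℂ) (γ : ℝ)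
    (L : ι → Matrix d d ℂ) : Matrix d d ℂ →ₗ[ℂ] Matrix d d ℂ :=
  ∑ a, (p a : ℂ) • (coherentPart H + (γ : ℂ) • dissipator (L a))

variable {ι : Type*} [Fintype ι] {p : ι → ℝ} {H : Matrix d d ℂ} {γ b Q δ : ℝ}
  {L : ι → Matrix d d ℂ}

lemma generator_apply (X : Matrix d d ℂ) : generator p H γ L X =
    ∑ a, (p a : ℂ) • (coherentPart H X + (γ : ℂ) • dissipator (L a) X) := by
  simp [generator, LinearMap.sum_apply]

lemma traceNorm_convex_sum_le (hp : ∀ a, 0 ≤ p a) (hp1 : ∑ a, p a = 1) {f : ι → Matrix d d ℂ}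
    {B : ℝ} (hf : ∀ a, traceNorm (f a) ≤ B) : traceNorm (∑ a, (p a : ℂ) • f a) ≤ B := by
  calc _ ≤ ∑ a, p a * B := by
        refine (traceNorm_sum_le _ _).trans (Finset.sum_le_sum fun a _ => ?_)
        refine (traceNorm_smul_le _ _).trans ?_
        rw [Complex.norm_real, Real.norm_of_nonneg (hp a)]
        have := hp a
        gcongr
        exact hf a
    _ = B := by rw [← Finset.sum_mul, hp1, one_mul]

lemma traceNorm_generator_le (hp : ∀ a, 0 ≤ p a) (hp1 : ∑ a, p a = 1) (hγ : 0 ≤ γ)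
    (hL : ∀ a, ‖L a‖ ≤ b) (hQ : 2 * ‖H‖ + 4 * γ * b ^ 2 ≤ Q) (X : Matrix d d ℂ) :
    traceNorm (generator p H γ L X) ≤ Q * traceNorm X := by
  rw [generator_apply]
  refine traceNorm_convex_sum_le hp hp1 fun a => ?_
  have hX := traceNorm_nonneg X
  have hL2 : ‖L a‖ ^ 2 ≤ b ^ 2 := by
    have := hL a
    gcongr
  calc _ ≤ 2 * ‖H‖ * traceNorm X + γ * (2 * ‖L a‖ ^ 2 * traceNorm X) := by
        refine (traceNorm_add_le _ _).trans (add_le_add (traceNorm_coherentPart_le _ _)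
          ((traceNorm_smul_le _ _).trans ?_))
        rw [Complex.norm_real, Real.norm_of_nonneg hγ]
        gcongr
        exact traceNorm_dissipator_le _ _
    _ ≤ 2 * ‖H‖ * traceNorm X + γ * (2 * b ^ 2 * traceNorm X) := by gcongr
    _ ≤ (2 * ‖H‖ + 4 * γ * b ^ 2) * traceNorm X := by
        have : 0 ≤ γ * b ^ 2 * traceNorm X := by positivity
        nlinarith
    _ ≤ _ := by gcongr

lemma sum_smul_sub_sub {ι V : Type*} [Fintype ι] [AddCommGroup V] [Module ℂ V] {p : ι → ℝ}
    (hp1 : ∑ a, p a = 1) (A B : ι → V) (X : V) (c : ℂ) :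
    ∑ a, (p a : ℂ) • (A a - X - c • B a) = ∑ a, (p a : ℂ) • A a - X - c • ∑ a, (p a : ℂ) • B a := by
  have h1 : ∑ a, (p a : ℂ) • X = X := by
    rw [← Finset.sum_smul, ← Complex.ofReal_sum, hp1, Complex.ofReal_one, one_smul]
  simp only [smul_sub, Finset.sum_sub_distrib, h1, Finset.smul_sum]
  congr 1
  exact Finset.sum_congr rfl fun a _ => smul_comm _ _ _

/-- A symmetric gate after an evolution, to first order in the time step `δ`. -/
lemma traceNorm_stepMap_symGate_conjBy_sub_le {κ : Type*} {L : Matrix d d ℂ}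
    (hH : H.IsHermitian) (hγ : 0 ≤ γ) (hδ : 0 ≤ δ) (hL : ‖L‖ ≤ b)
    (M : κ → Matrix d d ℂ) (l : List κ) (w : κ → ℝ) (hw : ∀ i ∈ l, ‖M i‖ ≤ w i)
    (hb : (l.map w).sum ≤ b) {η : ℝ} (hη : ‖(l.map M).sum - L‖ ≤ η)
    (hQ : 2 * ‖H‖ + 4 * γ * b ^ 2 ≤ Q) (hδQ : δ * Q ≤ 1) (X : Matrix d d ℂ) :
    traceNorm (stepMap (symGate (Real.sqrt (δ * γ)) M l) (conjBy (evol H δ) X) - X -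
      (δ : ℂ) • (coherentPart H X + (γ : ℂ) • dissipator L X)) ≤
      (20 * (δ * Q) ^ 2 + 4 * δ * γ * b * η) * traceNorm X := by
  have hX := traceNorm_nonneg X
  have hQ0 : 0 ≤ Q := le_trans (by positivity) hQ
  have hHQ : ‖H‖ * δ ≤ δ * Q := by
    have : ‖H‖ ≤ Q := le_trans (by nlinarith [norm_nonneg H, mul_nonneg hγ (sq_nonneg b)]) hQ
    nlinarith
  have hγQ : 4 * (δ * γ) * b ^ 2 ≤ δ * Q := by
    have : 4 * γ * b ^ 2 ≤ Q := le_trans (by linarith [norm_nonneg H]) hQ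
    nlinarith
  set θ := Real.sqrt (δ * γ) with hθ
  have hθ0 : 0 ≤ θ := Real.sqrt_nonneg _
  have hθ2 : θ ^ 2 = δ * γ := Real.sq_sqrt (by positivity)
  set Y := conjBy (evol H δ) X with hY
  have hYX : traceNorm Y ≤ traceNorm X := traceNorm_conjBy_le (norm_evol_le hH δ) X
  have c1 := traceNorm_conjBy_evol_sub_self_le hH hδ (hHQ.trans hδQ) X
  have c2 := traceNorm_conjBy_evol_sub_le hH hδ (hHQ.trans hδQ) X
  rw [← hY] at c1 c2
  set L' := (l.map M).sum with hL'
  set x := 2 * θ * (l.map w).sum with hx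
  have hb0 : 0 ≤ (l.map w).sum := List.sum_nonneg fun y hy => by
    obtain ⟨i, hi, rfl⟩ := List.mem_map.1 hy
    exact (norm_nonneg _).trans (hw i hi)
  have hbb : 0 ≤ b := hb0.trans hb
  have hx0 : 0 ≤ x := by positivity
  have hx2 : x ^ 2 ≤ δ * Q := by
    refine le_trans ?_ hγQ
    calc x ^ 2 = 4 * (δ * γ) * (l.map w).sum ^ 2 := by rw [hx, ← hθ2]; ring
      _ ≤ _ := by gcongr
  have hx1 : x ≤ 1 := by
    have := hx2.trans hδQ
    nlinarith
  have hL'n : ‖L'‖ ≤ b := by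
    refine le_trans ?_ hb
    have : ∀ k : List κ, (∀ i ∈ k, i ∈ l) → ‖(k.map M).sum‖ ≤ (k.map w).sum := by
      intro k
      induction k with
      | nil => simp
      | cons i k ih =>
        intro hk
        simp only [List.map_cons, List.sum_cons]
        exact (norm_add_le _ _).trans (add_le_add (hw i (hk i List.mem_cons_self))
          (ih fun j hj => hk j (List.mem_cons_of_mem _ hj)))
    exact this l fun _ h => h
  have t1 := traceNorm_stepMap_symGate_sub_le hθ0 M l w hw hx.symm hx1 Y
  rw [← hL'] at t1
  have t2 : traceNorm (((θ ^ 2 : ℝ) : ℂ) • dissipator L' (Y - X)) ≤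
      4 * (δ * Q) ^ 2 * traceNorm X := by
    refine (traceNorm_smul_le _ _).trans ?_
    rw [Complex.norm_real, Real.norm_of_nonneg (by positivity), hθ2]
    calc _ ≤ δ * γ * (2 * b ^ 2 * (4 * (‖H‖ * δ) * traceNorm X)) := by
          gcongr
          refine (traceNorm_dissipator_le _ _).trans ?_
          gcongr
          exact traceNorm_nonneg _
      _ = 2 * (4 * (δ * γ) * b ^ 2) * (‖H‖ * δ) * traceNorm X := by ring
      _ ≤ 2 * (δ * Q) * (δ * Q) * traceNorm X := by gcongr
      _ ≤ _ := by nlinarith [mul_nonneg (sq_nonneg (δ * Q)) hX]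
  have t3 : traceNorm (((θ ^ 2 : ℝ) : ℂ) • (dissipator L' X - dissipator L X)) ≤
      4 * δ * γ * b * η * traceNorm X := by
    refine (traceNorm_smul_le _ _).trans ?_
    rw [Complex.norm_real, Real.norm_of_nonneg (by positivity), hθ2]
    have := hL
    have := hη
    calc _ ≤ δ * γ * (2 * (b + b) * η * traceNorm X) := by
          gcongr
          refine (traceNorm_dissipator_sub_le _ _ _).trans ?_
          gcongr
      _ = _ := by ring
  have e : stepMap (symGate θ M l) Y - X -
      (δ : ℂ) • (coherentPart H X + (γ : ℂ) • dissipator L X) =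
      (stepMap (symGate θ M l) Y - Y - ((θ ^ 2 : ℝ) : ℂ) • dissipator L' Y) +
      (Y - X - (δ : ℂ) • coherentPart H X) + ((θ ^ 2 : ℝ) : ℂ) • dissipator L' (Y - X) +
      ((θ ^ 2 : ℝ) : ℂ) • (dissipator L' X - dissipator L X) := by
    rw [map_sub, hθ2]
    push_cast
    module
  rw [e]
  refine (traceNorm_add_le _ _).trans ((add_le_add ((traceNorm_add_le _ _).trans
    (add_le_add ((traceNorm_add_le _ _).trans (add_le_add t1 c2)) t2)) t3).trans ?_)
  have u1 : 12 * x ^ 4 * traceNorm Y ≤ 12 * (δ * Q) ^ 2 * traceNorm X := by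
    have : x ^ 4 ≤ (δ * Q) ^ 2 := by
      calc x ^ 4 = (x ^ 2) ^ 2 := by ring
        _ ≤ _ := by gcongr
    exact mul_le_mul (by linarith) hYX (traceNorm_nonneg Y) (by positivity)
  have u2 : 4 * (‖H‖ * δ) ^ 2 * traceNorm X ≤ 4 * (δ * Q) ^ 2 * traceNorm X := by gcongr
  linarith

/-- One step of the Lindblad evolution and one step with the symmetric gates built from an
approximation `∑ᵢ Mᵃᵢ` of the Lindblad operators, for small time steps. -/
lemma traceNorm_semigroup_sub_symGate_le_of_small {κ : Type*} (hp : ∀ a, 0 ≤ p a)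
    (hp1 : ∑ a, p a = 1) (hH : H.IsHermitian) (hγ : 0 ≤ γ) (hδ : 0 ≤ δ) (hL : ∀ a, ‖L a‖ ≤ b)
    (M : ι → κ → Matrix d d ℂ) (l : List κ) (w : κ → ℝ) (hw : ∀ a, ∀ i ∈ l, ‖M a i‖ ≤ w i)
    (hb : (l.map w).sum ≤ b) {η : ℝ} (hη : ∀ a, ‖(l.map (M a)).sum - L a‖ ≤ η)
    (hQ : 2 * ‖H‖ + 4 * γ * b ^ 2 ≤ Q) (hδQ : δ * Q ≤ 1) (X : Matrix d d ℂ) :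
    traceNorm (semigroup (generator p H γ L) δ X - ∑ a, (p a : ℂ) •
      stepMap (symGate (Real.sqrt (δ * γ)) (M a) l) (conjBy (evol H δ) X)) ≤
      (21 * (δ * Q) ^ 2 + 4 * δ * γ * b * η) * traceNorm X := by
  have hQ0 : 0 ≤ Q := le_trans (by positivity) hQ
  have hsem := traceNorm_semigroup_sub_le (traceNorm_generator_le hp hp1 hγ hL hQ) hδ hQ0
    (by rwa [mul_comm]) X
  have step := fun a => traceNorm_stepMap_symGate_conjBy_sub_le hH hγ hδ (hL a) (M a) l w (hw a)
    hb (hη a) hQ hδQ X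
  have e := sum_smul_sub_sub hp1 (fun a => stepMap (symGate (Real.sqrt (δ * γ)) (M a) l)
    (conjBy (evol H δ) X)) (fun a => coherentPart H X + (γ : ℂ) • dissipator (L a) X) X δ
  rw [← generator_apply] at e
  have e' := traceNorm_convex_sum_le hp hp1 step
  rw [e] at e'
  refine le_trans (le_of_eq ?_) ((traceNorm_sub_le _ _).trans
    ((add_le_add hsem e').trans (le_of_eq ?_)))
  · congr 1
    abel
  · ring

/-- The Lindblad semigroup is a contraction in the trace norm. -/
lemma traceNorm_semigroup_generator_le (hp : ∀ a, 0 ≤ p a) (hp1 : ∑ a, p a = 1)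
    (hH : H.IsHermitian) (hγ : 0 ≤ γ) (hδ : 0 ≤ δ) (X : Matrix d d ℂ) :
    traceNorm (semigroup (generator p H γ L) δ X) ≤ traceNorm X := by
  set b : ℝ := ∑ a, ‖L a‖ with hb
  have hL : ∀ a, ‖L a‖ ≤ b := fun a =>
    Finset.single_le_sum (f := fun a => ‖L a‖) (fun _ _ => norm_nonneg _) (Finset.mem_univ a)
  have hb0 : 0 ≤ b := Finset.sum_nonneg fun _ _ => norm_nonneg _
  set Q := 2 * ‖H‖ + 4 * γ * b ^ 2 with hQ
  refine traceNorm_semigroup_le (K := 21 * Q ^ 2) (q := Q) (by positivity) ?_ hδ X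
  intro δ hδ hδQ X
  have h := traceNorm_semigroup_sub_symGate_le_of_small hp hp1 hH hγ hδ hL
    (fun a (_ : Unit) => L a) [()] (fun _ => b) (fun a _ _ => hL a) (by simp) (η := 0)
    (fun a => by simp) le_rfl hδQ X
  set W := ∑ a, (p a : ℂ) • stepMap (symGate (Real.sqrt (δ * γ)) (fun _ : Unit => L a) [()])
    (conjBy (evol H δ) X) with hW
  have hWn : traceNorm W ≤ traceNorm X := traceNorm_convex_sum_le hp hp1 fun a =>
    (traceNorm_stepMap_le (norm_symGate_le _ _ _) _).trans (traceNorm_conjBy_le (norm_evol_le hH δ) X)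
  calc _ = traceNorm ((semigroup (generator p H γ L) δ X - W) + W) := by rw [sub_add_cancel]
    _ ≤ (21 * (δ * Q) ^ 2 + 4 * δ * γ * b * 0) * traceNorm X + traceNorm X :=
        (traceNorm_add_le _ _).trans (add_le_add h hWn)
    _ = _ := by ring

/-- One step of the Lindblad evolution and one step with symmetric gates. -/
lemma traceNorm_semigroup_sub_symGate_le {κ : Type*} (hp : ∀ a, 0 ≤ p a)
    (hp1 : ∑ a, p a = 1) (hH : H.IsHermitian) (hγ : 0 ≤ γ) (hδ : 0 ≤ δ) (hL : ∀ a, ‖L a‖ ≤ b)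
    (M : ι → κ → Matrix d d ℂ) (l : List κ) (w : κ → ℝ) (hw : ∀ a, ∀ i ∈ l, ‖M a i‖ ≤ w i)
    (hb : (l.map w).sum ≤ b) (hb0 : 0 ≤ b) {η : ℝ} (hη : ∀ a, ‖(l.map (M a)).sum - L a‖ ≤ η)
    (hη0 : 0 ≤ η) (hQ : 2 * ‖H‖ + 4 * γ * b ^ 2 ≤ Q) (X : Matrix d d ℂ) :
    traceNorm (semigroup (generator p H γ L) δ X - ∑ a, (p a : ℂ) •
      stepMap (symGate (Real.sqrt (δ * γ)) (M a) l) (conjBy (evol H δ) X)) ≤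
      (21 * (δ * Q) ^ 2 + 4 * δ * γ * b * η) * traceNorm X := by
  rcases le_total (δ * Q) 1 with h | h
  · exact traceNorm_semigroup_sub_symGate_le_of_small hp hp1 hH hγ hδ hL M l w hw hb hη hQ h X
  · -- for large steps contractivity is enough
    have h1 := traceNorm_semigroup_generator_le (L := L) hp hp1 hH hγ hδ X
    have h2 : traceNorm (∑ a, (p a : ℂ) • stepMap (symGate (Real.sqrt (δ * γ)) (M a) l)
        (conjBy (evol H δ) X)) ≤ traceNorm X := traceNorm_convex_sum_le hp hp1 fun a =>
      (traceNorm_stepMap_le (norm_symGate_le _ _ _) _).trans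
        (traceNorm_conjBy_le (norm_evol_le hH δ) X)
    refine (traceNorm_sub_le _ _).trans ((add_le_add h1 h2).trans ?_)
    have hX := traceNorm_nonneg X
    have h3 : 1 ≤ (δ * Q) ^ 2 := one_le_pow₀ h
    have h4 : 0 ≤ 4 * δ * γ * b * η * traceNorm X := by positivity
    nlinarith

end StepError

/-! ### The trapezoidal rule for the Gaussian filter -/

section Poisson

lemma summable_exp_neg_abs {c : ℝ} (hc : 0 < c) :
    Summable fun n : ℤ => Real.exp (-c * |(n : ℝ)|) := by
  have h : Summable fun n : ℕ => Real.exp (-c * n) := by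
    simpa [mul_comm] using Real.summable_exp_nat_mul_iff.2 (neg_lt_zero.2 hc)
  refine Summable.of_nat_of_neg ?_ ?_ <;> simpa using h

/-- The constant `∑ₙ e^{-c |n|}`, with `n` running through the integers. -/
noncomputable def expSum (c : ℝ) : ℝ := ∑' n : ℤ, Real.exp (-c * |(n : ℝ)|)

lemma expSum_nonneg (c : ℝ) : 0 ≤ expSum c := tsum_nonneg fun _ => (Real.exp_pos _).le

lemma summable_gaussian_int {c : ℝ} (hc : 0 < c) :
    Summable fun n : ℤ => Real.exp (-c * (n : ℝ) ^ 2) := by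
  refine Summable.of_nonneg_of_le (fun _ => (Real.exp_pos _).le) (fun n => ?_)
    (summable_exp_neg_abs hc)
  refine Real.exp_le_exp.2 ?_
  have : |(n : ℝ)| ≤ (n : ℝ) ^ 2 := by
    have h : |n| ≤ n ^ 2 := by
      rw [← sq_abs]
      nlinarith [abs_nonneg n, Int.le_self_sq |n|]
    exact_mod_cast h
  nlinarith

variable {β h : ℝ}

/-- Poisson summation for the Gaussian filter at frequency `ω`. -/
lemma tsum_gaussian_eq (hβ : 0 < β) (hh : 0 < h) (ω : ℝ) :
    ∑' s : ℤ, (h : ℂ) * Complex.exp (Complex.I * ω * (s * h : ℝ) - 2 * ((s * h : ℝ) : ℂ) ^ 2 / β ^ 2) =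
      ((β * Real.sqrt (Real.pi / 2) : ℝ) : ℂ) *
        ∑' n : ℤ, ((Real.exp (-(1 / 8) * (n * (2 * Real.pi * (β / h)) - β * ω) ^ 2) : ℝ) : ℂ) := by
  have hπ := Real.pi_pos
  have hπ' : (Real.pi : ℂ) ≠ 0 := by exact_mod_cast hπ.ne'
  have hβ' : (β : ℂ) ≠ 0 := by exact_mod_cast hβ.ne'
  have hh' : (h : ℂ) ≠ 0 := by exact_mod_cast hh.ne'
  set a : ℝ := 2 * h ^ 2 / (Real.pi * β ^ 2) with ha
  have ha0 : 0 < a := by positivity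
  have P := Complex.tsum_exp_neg_quadratic (a := (a : ℂ)) (by simpa using ha0)
    (Complex.I * ω * h / (2 * Real.pi))
  have hs : (a : ℂ) ^ (1 / 2 : ℂ) = ((Real.sqrt a : ℝ) : ℂ) := by
    rw [Real.sqrt_eq_rpow, Complex.ofReal_cpow ha0.le]
    norm_num
  have hsq : h * (1 / Real.sqrt a) = β * Real.sqrt (Real.pi / 2) := by
    have h1 : Real.sqrt a * (β * Real.sqrt (Real.pi / 2)) = h := by
      have e : a * (β ^ 2 * (Real.pi / 2)) = h ^ 2 := by rw [ha]; field_simp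
      rw [show β * Real.sqrt (Real.pi / 2) = Real.sqrt (β ^ 2 * (Real.pi / 2)) by
        rw [Real.sqrt_mul (by positivity), Real.sqrt_sq hβ.le], ← Real.sqrt_mul ha0.le, e,
        Real.sqrt_sq hh.le]
    have h2 : Real.sqrt a ≠ 0 := (Real.sqrt_pos.2 ha0).ne'
    rw [mul_one_div, div_eq_iff h2, mul_comm, h1]
  rw [tsum_mul_left]
  have e1 : ∀ s : ℤ, Complex.exp (Complex.I * ω * (s * h : ℝ) -
      2 * ((s * h : ℝ) : ℂ) ^ 2 / β ^ 2) =
      Complex.exp (-Real.pi * a * s ^ 2 + 2 * Real.pi * (Complex.I * ω * h / (2 * Real.pi)) * s) := by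
    intro s
    congr 1
    rw [ha]
    push_cast
    field_simp
    ring
  have e2 : ∀ n : ℤ, Complex.exp (-Real.pi / a *
      (n + Complex.I * (Complex.I * ω * h / (2 * Real.pi))) ^ 2) =
      ((Real.exp (-(1 / 8) * (n * (2 * Real.pi * (β / h)) - β * ω) ^ 2) : ℝ) : ℂ) := by
    intro n
    rw [Complex.ofReal_exp]
    congr 1
    have : Complex.I * (Complex.I * ω * h / (2 * Real.pi)) = -(ω * h / (2 * Real.pi)) := by
      linear_combination (ω * h / (2 * Real.pi) : ℂ) * Complex.I_mul_I
    rw [this, ha]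
    push_cast
    field_simp
    ring
  rw [tsum_congr e1, P, hs, tsum_congr e2, ← mul_assoc, ← hsq]
  push_cast
  ring

lemma integral_gaussian_eq (hβ : 0 < β) (ω : ℝ) :
    ∫ t : ℝ, Complex.exp (Complex.I * ω * t - 2 * (t : ℂ) ^ 2 / β ^ 2) =
      ((β * Real.sqrt (Real.pi / 2) : ℝ) : ℂ) *
        ((Real.exp (-(1 / 8) * (β * ω) ^ 2) : ℝ) : ℂ) := by
  have hπ := Real.pi_pos
  have hβ' : (β : ℂ) ≠ 0 := by exact_mod_cast hβ.ne'
  have hb : 0 < (((2 / β ^ 2 : ℝ) : ℂ)).re := by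
    rw [Complex.ofReal_re]; positivity
  have P := fourierIntegral_gaussian hb ω
  have e1 : ∀ t : ℝ, Complex.exp (Complex.I * ω * t - 2 * (t : ℂ) ^ 2 / β ^ 2) =
      Complex.exp (Complex.I * ω * t) * Complex.exp (-((2 / β ^ 2 : ℝ) : ℂ) * t ^ 2) := by
    intro t
    rw [← Complex.exp_add]
    congr 1
    push_cast
    ring
  have e2 : (Real.pi / ((2 / β ^ 2 : ℝ) : ℂ)) ^ (1 / 2 : ℂ) =
      ((β * Real.sqrt (Real.pi / 2) : ℝ) : ℂ) := by
    rw [← Complex.ofReal_div, show (1 / 2 : ℂ) = ((1 / 2 : ℝ) : ℂ) by norm_num,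
      ← Complex.ofReal_cpow (by positivity), ← Real.sqrt_eq_rpow]
    congr 1
    rw [show Real.pi / (2 / β ^ 2) = β ^ 2 * (Real.pi / 2) by field_simp,
      Real.sqrt_mul (by positivity), Real.sqrt_sq hβ.le]
  rw [MeasureTheory.integral_congr_ae (Filter.Eventually.of_forall e1), P, e2, Complex.ofReal_exp]
  congr 2
  push_cast
  field_simp
  ring

/-- Every term of Poisson's sum other than the central one is at distance at least
`X + (|n| - 1)` from the peak of the Gaussian. -/
lemma exp_poisson_le {X Y z : ℝ} (hX : 0 ≤ X) (hY : 1 ≤ Y) (hz : |z| ≤ Y - X) {n : ℤ} (hn : n ≠ 0) :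
    Real.exp (-(1 / 8) * (n * Y - z) ^ 2) ≤
      Real.exp (-(1 / 8) * X ^ 2) * (Real.exp (1 / 8) * Real.exp (-(1 / 8) * |(n : ℝ)|)) := by
  rw [← Real.exp_add, ← Real.exp_add]
  refine Real.exp_le_exp.2 ?_
  set k : ℝ := |(n : ℝ)| - 1 with hk
  have hk1 : k = 0 ∨ 1 ≤ k := by
    have h1 : (1 : ℤ) ≤ |n| := Int.one_le_abs hn
    rcases h1.eq_or_lt with h | h
    · left
      rw [hk, ← Int.cast_abs, ← h]
      norm_num
    · right
      have : (2 : ℝ) ≤ |(n : ℝ)| := by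
        rw [← Int.cast_abs]
        exact_mod_cast h
      linarith
  have hk0 : 0 ≤ k := by rcases hk1 with h | h <;> linarith
  have hkk : k ≤ k ^ 2 := by
    rcases hk1 with h | h
    · rw [h]; norm_num
    · nlinarith
  have h2 : X + k ≤ |n * Y - z| := by
    have h3 : |(n : ℝ) * Y| - |z| ≤ |n * Y - z| := abs_sub_abs_le_abs_sub _ _
    rw [abs_mul, abs_of_nonneg (by linarith : 0 ≤ Y)] at h3
    have : |(n : ℝ)| * Y = k * Y + Y := by rw [hk]; ring
    nlinarith
  have h4 : X ^ 2 + k ≤ (n * Y - z) ^ 2 := by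
    rw [← sq_abs (n * Y - z)]
    nlinarith
  have : |(n : ℝ)| = k + 1 := by rw [hk]; ring
  rw [this]
  linarith

/-- The constant of the aliasing error of the trapezoidal rule. -/
noncomputable def aliasConst : ℝ := Real.exp (1 / 8) * expSum (1 / 8)

lemma aliasConst_nonneg : 0 ≤ aliasConst := mul_nonneg (Real.exp_pos _).le (expSum_nonneg _)

lemma poisson_sub_le {X Y z : ℝ} (hX : 0 ≤ X) (hY : 1 ≤ Y) (hz : |z| ≤ Y - X) :
    (Summable fun n : ℤ => Real.exp (-(1 / 8) * (n * Y - z) ^ 2)) ∧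
    |∑' n : ℤ, Real.exp (-(1 / 8) * (n * Y - z) ^ 2) - Real.exp (-(1 / 8) * z ^ 2)| ≤
      aliasConst * Real.exp (-(1 / 8) * X ^ 2) := by
  set F : ℤ → ℝ := fun n => Real.exp (-(1 / 8) * (n * Y - z) ^ 2) with hF
  set G : ℤ → ℝ := fun n =>
    Real.exp (-(1 / 8) * X ^ 2) * (Real.exp (1 / 8) * Real.exp (-(1 / 8) * |(n : ℝ)|)) with hG
  have hGs : Summable G := ((summable_exp_neg_abs (by norm_num)).mul_left _).mul_left _
  have hGt : ∑' n, G n = aliasConst * Real.exp (-(1 / 8) * X ^ 2) := by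
    rw [tsum_mul_left, tsum_mul_left, aliasConst, expSum, mul_comm]
  have hG0 : ∀ n, 0 ≤ G n := fun n => by positivity
  have hle : ∀ n, (if n = 0 then 0 else F n) ≤ G n := fun n => by
    split_ifs with h
    · exact hG0 n
    · exact exp_poisson_le hX hY hz h
  have hs' : Summable fun n => if n = 0 then 0 else F n :=
    Summable.of_nonneg_of_le (fun n => by split_ifs <;> positivity) hle hGs
  have hs : Summable F := by
    refine (hs'.add (summable_of_ne_finset_zero (s := {0})
      (f := fun n => if n = 0 then F n else 0) fun n hn => by simp at hn; simp [hn])).congr fun n => ?_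
    split_ifs <;> simp
  refine ⟨hs, ?_⟩
  have h0 : F 0 = Real.exp (-(1 / 8) * z ^ 2) := by simp [hF]
  rw [hs.tsum_eq_add_tsum_ite 0, h0, add_sub_cancel_left, abs_of_nonneg
    (tsum_nonneg fun n => by split_ifs <;> positivity), ← hGt]
  exact hs'.tsum_le_tsum hle hGs

/-- The error of the infinite trapezoidal rule for the Gaussian filter at frequency `ω`. -/
lemma norm_tsum_gaussian_sub_integral_le (hβ : 0 < β) (hh : 0 < h) {ω X : ℝ} (hX : 0 ≤ X)
    (hY : 1 ≤ 2 * Real.pi * (β / h)) (hz : |β * ω| ≤ 2 * Real.pi * (β / h) - X) :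
    ‖∑' s : ℤ, (h : ℂ) * Complex.exp (Complex.I * ω * (s * h : ℝ) -
        2 * ((s * h : ℝ) : ℂ) ^ 2 / β ^ 2) -
      ∫ t : ℝ, Complex.exp (Complex.I * ω * t - 2 * (t : ℂ) ^ 2 / β ^ 2)‖ ≤
      β * Real.sqrt (Real.pi / 2) * (aliasConst * Real.exp (-(1 / 8) * X ^ 2)) := by
  have hπ := Real.pi_pos
  rw [tsum_gaussian_eq hβ hh, integral_gaussian_eq hβ, ← mul_sub, ← Complex.ofReal_tsum,
    ← Complex.ofReal_sub, norm_mul, Complex.norm_real, Complex.norm_real,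
    Real.norm_of_nonneg (by positivity), Real.norm_eq_abs]
  gcongr
  exact (poisson_sub_le hX hY hz).2

lemma tsum_exp_neg_le (hβ : 0 < β) (hh : 0 < h) (hY : 1 ≤ 2 * Real.pi * (β / h)) :
    ∑' s : ℤ, h * Real.exp (-2 * (s * h) ^ 2 / β ^ 2) ≤
      β * Real.sqrt (Real.pi / 2) * (1 + aliasConst) := by
  have hπ := Real.pi_pos
  have P := tsum_gaussian_eq hβ hh 0
  have e : ∀ s : ℤ, (h : ℂ) * Complex.exp (Complex.I * (0 : ℝ) * (s * h : ℝ) -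
      2 * ((s * h : ℝ) : ℂ) ^ 2 / β ^ 2) = ((h * Real.exp (-2 * (s * h) ^ 2 / β ^ 2) : ℝ) : ℂ) := by
    intro s
    rw [Complex.ofReal_mul h, Complex.ofReal_exp]
    congr 2
    push_cast
    ring
  rw [tsum_congr e, ← Complex.ofReal_tsum, ← Complex.ofReal_tsum, ← Complex.ofReal_mul] at P
  rw [Complex.ofReal_injective P]
  gcongr
  have h1 := (poisson_sub_le (X := 2 * Real.pi * (β / h)) (z := β * 0) (by positivity) hY
    (by simp)).2
  have h2 := (le_abs_self _).trans h1
  have h3 : Real.exp (-(1 / 8) * (2 * Real.pi * (β / h)) ^ 2) ≤ 1 :=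
    Real.exp_le_one_iff.2 (by nlinarith [sq_nonneg (2 * Real.pi * (β / h))])
  have h4 : Real.exp (-(1 / 8) * (β * 0) ^ 2) = 1 := by simp
  rw [h4] at h2
  have h5 : aliasConst * Real.exp (-(1 / 8) * (2 * Real.pi * (β / h)) ^ 2) ≤ aliasConst * 1 := by
    have := aliasConst_nonneg
    gcongr
  linarith

end Poisson

/-! ### The filter -/

section Filter

variable {β : ℝ}

/-- The normalization `π^{-3/4} β^{-1/2}` of the filter. -/
noncomputable def filterConst (β : ℝ) : ℝ := 1 / (Real.pi ^ (3 / 4 : ℝ) * Real.sqrt β)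

lemma filterConst_nonneg (β : ℝ) : 0 ≤ filterConst β := by
  have := Real.pi_pos
  rw [filterConst]
  positivity

lemma norm_filter (β t : ℝ) : ‖filter β t‖ = filterConst β * Real.exp (-2 * t ^ 2 / β ^ 2) := by
  rw [filter, norm_mul, norm_mul, Complex.norm_real, Complex.norm_real, mul_comm Complex.I,
    Complex.norm_exp_ofReal_mul_I, mul_one, Real.norm_of_nonneg (Real.exp_pos _).le]
  congr 1
  exact Real.norm_of_nonneg (filterConst_nonneg β)

lemma filter_mul_exp (β t ν : ℝ) : filter β t * Complex.exp (Complex.I * ν * t) =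
    (filterConst β : ℂ) *
      Complex.exp (Complex.I * ((1 / β + ν : ℝ) : ℂ) * t - 2 * (t : ℂ) ^ 2 / β ^ 2) := by
  rw [filter, filterConst, Complex.ofReal_exp, mul_assoc, mul_assoc, ← Complex.exp_add,
    ← Complex.exp_add]
  congr 2
  push_cast
  ring

lemma filterConst_mul_le (hβ : 0 < β) :
    filterConst β * (β * Real.sqrt (Real.pi / 2)) ≤ Real.sqrt β := by
  have hπ := Real.pi_pos
  have h1 : Real.sqrt (Real.pi / 2) ≤ Real.pi ^ (3 / 4 : ℝ) := by
    calc Real.sqrt (Real.pi / 2) ≤ Real.sqrt Real.pi := Real.sqrt_le_sqrt (by linarith)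
      _ = Real.pi ^ (1 / 2 : ℝ) := Real.sqrt_eq_rpow _
      _ ≤ Real.pi ^ (3 / 4 : ℝ) :=
        Real.rpow_le_rpow_of_exponent_le (by linarith [Real.pi_gt_three]) (by norm_num)
  have h2 : 0 < Real.sqrt β := Real.sqrt_pos.2 hβ
  have h3 : 0 < Real.pi ^ (3 / 4 : ℝ) := by positivity
  rw [filterConst, one_div_mul_eq_div, div_le_iff₀ (by positivity)]
  calc β * Real.sqrt (Real.pi / 2) ≤ β * Real.pi ^ (3 / 4 : ℝ) := by gcongr
    _ = (Real.sqrt β * Real.sqrt β) * Real.pi ^ (3 / 4 : ℝ) := by rw [Real.mul_self_sqrt hβ.le]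
    _ = _ := by ring

lemma filterConst_le (hβ : 0 < β) : filterConst β ≤ 1 / Real.sqrt β := by
  have h2 : 0 < Real.sqrt β := Real.sqrt_pos.2 hβ
  rw [filterConst]
  gcongr
  exact le_mul_of_one_le_left h2.le
    (Real.one_le_rpow (by linarith [Real.pi_gt_three]) (by norm_num))

lemma exp_neg_two_mul_eq (β t : ℝ) : Real.exp (-2 * t ^ 2 / β ^ 2) = Real.exp (-(2 / β ^ 2) * t ^ 2) := by
  congr 1
  ring

lemma integrable_filterBound (hβ : 0 < β) :
    MeasureTheory.Integrable fun t : ℝ => filterConst β * Real.exp (-2 * t ^ 2 / β ^ 2) := by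
  simp only [exp_neg_two_mul_eq]
  exact (integrable_exp_neg_mul_sq (by positivity)).const_mul _

lemma integral_filterBound_le (hβ : 0 < β) :
    ∫ t : ℝ, filterConst β * Real.exp (-2 * t ^ 2 / β ^ 2) ≤ Real.sqrt β := by
  have hπ := Real.pi_pos
  simp only [exp_neg_two_mul_eq]
  rw [MeasureTheory.integral_const_mul, integral_gaussian,
    show Real.pi / (2 / β ^ 2) = β ^ 2 * (Real.pi / 2) by field_simp,
    Real.sqrt_mul (by positivity), Real.sqrt_sq hβ.le]
  exact filterConst_mul_le hβ

lemma continuous_filter (β : ℝ) : Continuous (filter β) := by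
  unfold filter
  fun_prop

end Filter

/-! ### Decomposition into Bohr frequencies -/

section Bohr

variable {d : Type*} [Fintype d] [DecidableEq d]

lemma matrix_norm_le_of_forall {M : Matrix d d ℂ} {c : ℝ} (hc : 0 ≤ c)
    (h : ∀ v : EuclideanSpace ℂ d, ‖WithLp.toLp 2 (M *ᵥ v.ofLp)‖ ≤ c * ‖v‖) : ‖M‖ ≤ c := by
  rw [Matrix.l2_opNorm_def]
  exact ContinuousLinearMap.opNorm_le_bound _ hc h

/-- The part of a matrix that connects eigenvalues with difference `ν` is not larger in norm: by
orthogonality of the eigenspaces its square on a vector is a sum over the eigenspaces. -/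
lemma norm_bohr_component_le (M : Matrix d d ℂ) (e : d → ℝ) (ν : ℝ) :
    ‖(Matrix.of fun i j => if e i - e j = ν then M i j else 0 : Matrix d d ℂ)‖ ≤ ‖M‖ := by
  refine matrix_norm_le_of_forall (norm_nonneg _) fun v => ?_
  set N : Matrix d d ℂ := Matrix.of fun i j => if e i - e j = ν then M i j else 0 with hN
  -- the component of `v` in the eigenspace of `x - ν`
  set w : ℝ → EuclideanSpace ℂ d := fun x => WithLp.toLp 2 fun j => if x - e j = ν then v j else 0
    with hw
  have hNw : ∀ i, (N *ᵥ v.ofLp) i = (M *ᵥ (w (e i)).ofLp) i := by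
    intro i
    simp only [Matrix.mulVec, dotProduct, hN, hw, Matrix.of_apply]
    exact Finset.sum_congr rfl fun j _ => by split_ifs <;> simp
  have hS : ∑ x ∈ Finset.univ.image e, ‖w x‖ ^ 2 ≤ ‖v‖ ^ 2 := by
    simp only [EuclideanSpace.norm_sq_eq]
    rw [Finset.sum_comm]
    refine Finset.sum_le_sum fun j _ => ?_
    have : ∀ x, ‖(w x) j‖ ^ 2 = if x = ν + e j then ‖v j‖ ^ 2 else 0 := by
      intro x
      simp only [hw]
      by_cases h : x = ν + e j
      · simp [h]
      · rw [if_neg h, if_neg (fun h' => h (by linarith))]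
        simp
    simp only [this, Finset.sum_ite_eq']
    split_ifs
    · exact le_rfl
    · positivity
  refine (sq_le_sq₀ (norm_nonneg _) (by positivity)).1 ?_
  calc ‖WithLp.toLp 2 (N *ᵥ v.ofLp)‖ ^ 2
      = ∑ i, ‖(M *ᵥ (w (e i)).ofLp) i‖ ^ 2 := by
        rw [EuclideanSpace.norm_sq_eq]
        exact Finset.sum_congr rfl fun i _ => by rw [← hNw i]
    _ ≤ ∑ i, ∑ x ∈ Finset.univ.image e, ‖(M *ᵥ (w x).ofLp) i‖ ^ 2 := by
        refine Finset.sum_le_sum fun i _ => ?_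
        exact Finset.single_le_sum (f := fun x => ‖(M *ᵥ (w x).ofLp) i‖ ^ 2)
          (fun _ _ => by positivity) (Finset.mem_image_of_mem e (Finset.mem_univ i))
    _ = ∑ x ∈ Finset.univ.image e, ‖WithLp.toLp 2 (M *ᵥ (w x).ofLp)‖ ^ 2 := by
        rw [Finset.sum_comm]
        exact Finset.sum_congr rfl fun x _ => by rw [EuclideanSpace.norm_sq_eq]
    _ ≤ ∑ x ∈ Finset.univ.image e, (‖M‖ * ‖w x‖) ^ 2 := by
        gcongr with x
        exact Matrix.l2_opNorm_mulVec M (w x)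
    _ = ‖M‖ ^ 2 * ∑ x ∈ Finset.univ.image e, ‖w x‖ ^ 2 := by
        rw [Finset.mul_sum]
        exact Finset.sum_congr rfl fun x _ => by ring
    _ ≤ ‖M‖ ^ 2 * ‖v‖ ^ 2 := by gcongr
    _ = _ := by ring

/-- The Heisenberg evolution is a trigonometric polynomial in time, whose frequencies are the Bohr
frequencies and whose coefficients are bounded by the norm of the operator. -/
lemma exists_bohr_decomposition {H : Matrix d d ℂ} (hH : H.IsHermitian) (A : Matrix d d ℂ) :
    ∃ (B : Finset ℝ) (C : ℝ → Matrix d d ℂ), (B : Set ℝ) = bohrFrequencies H ∧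
      (∀ ν ∈ B, |ν| ≤ 2 * ‖H‖) ∧ (∀ ν, ‖C ν‖ ≤ ‖A‖) ∧
      ∀ t : ℝ, heisenberg H A t = ∑ ν ∈ B, Complex.exp (Complex.I * ν * t) • C ν := by
  obtain ⟨V, hVV, hVV', hX⟩ := exists_unitary_diagonalization hH
  have hspec := hH.spectrum_real_eq_range_eigenvalues
  obtain ⟨e, he⟩ : ∃ e, e = hH.eigenvalues := ⟨_, rfl⟩
  rw [← he] at hX hspec
  have hVn : ‖V‖ ≤ 1 := norm_le_one_of_conjTranspose_mul_self hVV'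
  have hVn' : ‖Vᴴ‖ ≤ 1 := norm_le_one_of_conjTranspose_mul_self (by simpa using hVV)
  have hconj : ∀ {U W : Matrix d d ℂ}, ‖U‖ ≤ 1 → ‖W‖ ≤ 1 → ∀ Z : Matrix d d ℂ,
      ‖U * Z * W‖ ≤ ‖Z‖ := by
    intro U W hU hW Z
    calc _ ≤ ‖U‖ * ‖Z‖ * ‖W‖ := (norm_mul_le _ _).trans (by gcongr; exact norm_mul_le _ _)
      _ ≤ 1 * ‖Z‖ * 1 := by gcongr
      _ = _ := by ring
  have hdiag : Matrix.diagonal (fun i => (e i : ℂ)) = Vᴴ * H * V := by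
    rw [hX, show Vᴴ * (V * Matrix.diagonal (fun i => (e i : ℂ)) * Vᴴ) * V =
      (Vᴴ * V) * Matrix.diagonal (fun i => (e i : ℂ)) * (Vᴴ * V) by simp only [mul_assoc], hVV',
      one_mul, mul_one]
  have heH : ∀ i, |e i| ≤ ‖H‖ := by
    intro i
    have h1 := hconj hVn' hVn H
    rw [← hdiag, Matrix.l2_opNorm_diagonal] at h1
    have h2 := (norm_le_pi_norm (fun i => (e i : ℂ)) i).trans h1
    rwa [Complex.norm_real, Real.norm_eq_abs] at h2
  set A' := Vᴴ * A * V with hA'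
  set B : Finset ℝ := Finset.univ.image fun q : d × d => e q.1 - e q.2 with hB
  set C : ℝ → Matrix d d ℂ := fun ν =>
    V * (Matrix.of fun i j => if e i - e j = ν then A' i j else 0) * Vᴴ with hC
  refine ⟨B, C, ?_, ?_, ?_, ?_⟩
  · ext ν
    simp only [bohrFrequencies, hspec, hB, Finset.coe_image, Finset.coe_univ, Set.image_univ,
      Set.mem_range, Prod.exists, Set.mem_ofPred_eq, exists_exists_eq_and]
    constructor <;> rintro ⟨i, j, h⟩ <;> exact ⟨i, j, h.symm⟩
  · intro ν hν
    obtain ⟨⟨i, j⟩, -, rfl⟩ := Finset.mem_image.1 hν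
    have h1 := abs_le.1 (heH i)
    have h2 := abs_le.1 (heH j)
    exact abs_le.2 ⟨by dsimp only; linarith, by dsimp only; linarith⟩
  · intro ν
    exact (hconj hVn hVn' _).trans ((norm_bohr_component_le A' e ν).trans (hconj hVn' hVn A))
  · intro t
    have hev : ∀ s : ℝ, evol H s =
        V * Matrix.diagonal (fun i => Complex.exp (-(Complex.I * s) * e i)) * Vᴴ := by
      intro s
      rw [hX, ← evol_conj hVV]
      congr 2
      rw [evol, ← Matrix.diagonal_smul, Matrix.exp_diagonal]
      congr 1
      ext i
      rw [Pi.coe_exp, Complex.exp_eq_exp_ℂ]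
      rfl
    have h1 : heisenberg H A t = V * (Matrix.diagonal
        (fun i => Complex.exp (-(Complex.I * (-t : ℝ)) * e i)) * A' *
        Matrix.diagonal (fun i => Complex.exp (-(Complex.I * t) * e i))) * Vᴴ := by
      rw [heisenberg, hev, hev, hA']
      simp only [mul_assoc]
    have h2 : ∑ ν ∈ B, Complex.exp (Complex.I * ν * t) • C ν = V * (∑ ν ∈ B,
        Complex.exp (Complex.I * ν * t) •
          (Matrix.of fun i j => if e i - e j = ν then A' i j else 0 : Matrix d d ℂ)) * Vᴴ := by
      rw [Finset.mul_sum, Finset.sum_mul]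
      refine Finset.sum_congr rfl fun ν _ => ?_
      rw [Matrix.mul_smul, Matrix.smul_mul]
    rw [h1, h2]
    congr 2
    ext i j
    rw [Matrix.mul_diagonal, Matrix.diagonal_mul, Matrix.sum_apply]
    simp only [Matrix.smul_apply, Matrix.of_apply, smul_eq_mul, mul_ite, mul_zero]
    rw [Finset.sum_ite_eq, if_pos (Finset.mem_image_of_mem (fun q : d × d => e q.1 - e q.2)
      (Finset.mem_univ (i, j))), mul_right_comm, ← Complex.exp_add]
    congr 2
    push_cast
    ring

lemma norm_heisenberg_le {H : Matrix d d ℂ} (hH : H.IsHermitian) (A : Matrix d d ℂ) (t : ℝ) :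
    ‖heisenberg H A t‖ ≤ ‖A‖ := by
  have h1 := norm_evol_le hH t
  have h2 := norm_evol_le hH (-t)
  calc _ ≤ ‖evol H (-t)‖ * ‖A‖ * ‖evol H t‖ :=
        (norm_mul_le _ _).trans (by gcongr; exact norm_mul_le _ _)
    _ ≤ 1 * ‖A‖ * 1 := by gcongr
    _ = _ := by ring

end Bohr

/-! ### Discretization of the Lindblad operators -/

section Discretization

variable {d : Type*} [Fintype d] [DecidableEq d] {β h : ℝ}

lemma norm_lindbladOp_le (hβ : 0 < β) {H : Matrix d d ℂ} (hH : H.IsHermitian) (A : Matrix d d ℂ) :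
    ‖lindbladOp β H A‖ ≤ ‖A‖ * Real.sqrt β := by
  have hi := (integrable_filterBound hβ).mul_const ‖A‖
  refine (MeasureTheory.norm_integral_le_of_norm_le hi
    (Filter.Eventually.of_forall fun t => ?_)).trans ?_
  · rw [norm_smul, norm_filter]
    have := filterConst_nonneg β
    gcongr
    exact norm_heisenberg_le hH A t
  · rw [MeasureTheory.integral_mul_const, mul_comm]
    gcongr
    exact integral_filterBound_le hβ

lemma summable_filterBound (hβ : 0 < β) (hh : 0 < h) :
    Summable fun s : ℤ => h * (filterConst β * Real.exp (-2 * (s * h) ^ 2 / β ^ 2)) := by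
  refine ((summable_gaussian_int (c := 2 * h ^ 2 / β ^ 2) (by positivity)).mul_left
    (h * filterConst β)).congr fun s => ?_
  rw [mul_assoc]
  congr 3
  ring

lemma tsum_filterBound_le (hβ : 0 < β) (hh : 0 < h) (hY : 1 ≤ 2 * Real.pi * (β / h)) :
    ∑' s : ℤ, h * (filterConst β * Real.exp (-2 * (s * h) ^ 2 / β ^ 2)) ≤
      Real.sqrt β * (1 + aliasConst) := by
  have e : ∀ s : ℤ, h * (filterConst β * Real.exp (-2 * (s * h) ^ 2 / β ^ 2)) =
      filterConst β * (h * Real.exp (-2 * (s * h) ^ 2 / β ^ 2)) := fun s => by ring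
  rw [tsum_congr e, tsum_mul_left]
  have := filterConst_nonneg β
  have := aliasConst_nonneg
  calc _ ≤ filterConst β * (β * Real.sqrt (Real.pi / 2) * (1 + aliasConst)) := by
        gcongr
        exact tsum_exp_neg_le hβ hh hY
    _ = filterConst β * (β * Real.sqrt (Real.pi / 2)) * (1 + aliasConst) := by ring
    _ ≤ _ := by
        gcongr
        exact filterConst_mul_le hβ

lemma norm_trapezoid_term_le {H : Matrix d d ℂ} (hH : H.IsHermitian) (A : Matrix d d ℂ) (hh : 0 < h)
    (s : ℤ) : ‖((h : ℂ) * filter β (s * h)) • heisenberg H A (s * h)‖ ≤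
      h * (filterConst β * Real.exp (-2 * (s * h) ^ 2 / β ^ 2)) * ‖A‖ := by
  rw [norm_smul, norm_mul, Complex.norm_real, Real.norm_of_nonneg hh.le, norm_filter]
  have := filterConst_nonneg β
  gcongr
  exact norm_heisenberg_le hH A _

lemma summable_trapezoid (hβ : 0 < β) (hh : 0 < h) {H : Matrix d d ℂ} (hH : H.IsHermitian)
    (A : Matrix d d ℂ) :
    Summable fun s : ℤ => ((h : ℂ) * filter β (s * h)) • heisenberg H A (s * h) :=
  Summable.of_norm_bounded ((summable_filterBound hβ hh).mul_right ‖A‖)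
    (norm_trapezoid_term_le hH A hh)

/-- The error of the infinite trapezoidal rule for the Lindblad operator. -/
lemma norm_trapezoid_sub_lindbladOp_le (hβ : 0 < β) (hh : 0 < h) {H : Matrix d d ℂ}
    (hH : H.IsHermitian) (A : Matrix d d ℂ) {X : ℝ} (hX0 : 0 ≤ X)
    (hX : X = 2 * Real.pi * (β / h) - 2 * β * ‖H‖ - 1) :
    ‖∑' s : ℤ, ((h : ℂ) * filter β (s * h)) • heisenberg H A (s * h) - lindbladOp β H A‖ ≤
      (bohrFrequencies H).ncard * (Real.sqrt β * (aliasConst * Real.exp (-(1 / 8) * X ^ 2)) * ‖A‖) := by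
  have hf := filterConst_nonneg β
  have hal := aliasConst_nonneg
  obtain ⟨B, C, hB, hBn, hC, hdec⟩ := exists_bohr_decomposition hH A
  rw [← hB, Set.ncard_coe_finset]
  set T : ℝ → ℤ → ℂ := fun ν s => (h : ℂ) * (filter β (s * h) *
    Complex.exp (Complex.I * ν * (s * h : ℝ))) with hT
  have hTs : ∀ ν, Summable (T ν) := fun ν => by
    refine Summable.of_norm_bounded (summable_filterBound hβ hh) fun s => le_of_eq ?_
    rw [hT, norm_mul, norm_mul, norm_filter, Complex.norm_real, Real.norm_of_nonneg hh.le,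
      show Complex.I * ν * ((s * h : ℝ) : ℂ) = ((ν * (s * h) : ℝ) : ℂ) * Complex.I by
        push_cast; ring, Complex.norm_exp_ofReal_mul_I, mul_one]
  set J : ℝ → ℂ := fun ν => ∫ t : ℝ, filter β t * Complex.exp (Complex.I * ν * t) with hJ
  have hsum : ∑' s : ℤ, ((h : ℂ) * filter β (s * h)) • heisenberg H A (s * h) =
      ∑ ν ∈ B, (∑' s, T ν s) • C ν := by
    have h1 : ∀ s : ℤ, ((h : ℂ) * filter β (s * h)) • heisenberg H A (s * h) =
        ∑ ν ∈ B, T ν s • C ν := fun s => by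
      rw [hdec, Finset.smul_sum]
      refine Finset.sum_congr rfl fun ν _ => ?_
      rw [smul_smul, hT, mul_assoc]
    rw [tsum_congr h1, Summable.tsum_finsetSum fun ν _ => (hTs ν).smul_const _]
    exact Finset.sum_congr rfl fun ν _ => (hTs ν).tsum_smul_const _
  have hint : lindbladOp β H A = ∑ ν ∈ B, J ν • C ν := by
    have h1 : ∀ t : ℝ, filter β t • heisenberg H A t =
        ∑ ν ∈ B, (filter β t * Complex.exp (Complex.I * ν * t)) • C ν := fun t => by
      rw [hdec, Finset.smul_sum]
      exact Finset.sum_congr rfl fun ν _ => smul_smul _ _ _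
    have h2 : ∀ ν : ℝ, MeasureTheory.Integrable fun t : ℝ =>
        filter β t * Complex.exp (Complex.I * ν * t) := fun ν => by
      refine (integrable_filterBound hβ).mono'
        (((continuous_filter β).mul (by fun_prop)).aestronglyMeasurable)
        (Filter.Eventually.of_forall fun t => le_of_eq ?_)
      rw [norm_mul, norm_filter, show Complex.I * ν * t = ((ν * t : ℝ) : ℂ) * Complex.I by
        push_cast; ring, Complex.norm_exp_ofReal_mul_I, mul_one]
    rw [lindbladOp, MeasureTheory.integral_congr_ae (Filter.Eventually.of_forall h1),
      MeasureTheory.integral_finsetSum _ fun ν _ => (h2 ν).smul_const _]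
    exact Finset.sum_congr rfl fun ν _ => integral_smul_const _ _
  rw [hsum, hint, ← Finset.sum_sub_distrib, ← nsmul_eq_mul]
  refine (norm_sum_le _ _).trans (Finset.sum_le_card_nsmul _ _ _ fun ν hν => ?_)
  rw [← sub_smul, norm_smul]
  have hz : |β * (1 / β + ν)| ≤ 2 * Real.pi * (β / h) - X := by
    rw [mul_add, mul_one_div_cancel hβ.ne', hX]
    have h1 : |β * ν| ≤ β * (2 * ‖H‖) := by
      rw [abs_mul, abs_of_pos hβ]
      gcongr
      exact hBn ν hν
    refine (abs_add_le _ _).trans ?_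
    rw [abs_one]
    linarith
  have hY : 1 ≤ 2 * Real.pi * (β / h) := by
    have : 0 ≤ 2 * β * ‖H‖ := by positivity
    linarith
  have hdiff : ‖∑' s, T ν s - J ν‖ ≤
      Real.sqrt β * (aliasConst * Real.exp (-(1 / 8) * X ^ 2)) := by
    have e1 : ∀ s : ℤ, T ν s = (filterConst β : ℂ) * ((h : ℂ) *
        Complex.exp (Complex.I * ((1 / β + ν : ℝ) : ℂ) * (s * h : ℝ) -
          2 * ((s * h : ℝ) : ℂ) ^ 2 / β ^ 2)) := fun s => by
      rw [hT]
      simp only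
      rw [filter_mul_exp]
      ring
    have e2 : J ν = (filterConst β : ℂ) * ∫ t : ℝ, Complex.exp
        (Complex.I * ((1 / β + ν : ℝ) : ℂ) * t - 2 * (t : ℂ) ^ 2 / β ^ 2) := by
      rw [hJ, ← MeasureTheory.integral_const_mul]
      simp only [filter_mul_exp]
    rw [tsum_congr e1, tsum_mul_left, e2, ← mul_sub, norm_mul, Complex.norm_real,
      Real.norm_of_nonneg hf]
    calc _ ≤ filterConst β * (β * Real.sqrt (Real.pi / 2) *
          (aliasConst * Real.exp (-(1 / 8) * X ^ 2))) := by
          gcongr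
          exact norm_tsum_gaussian_sub_integral_le hβ hh hX0 hY hz
      _ = filterConst β * (β * Real.sqrt (Real.pi / 2)) *
          (aliasConst * Real.exp (-(1 / 8) * X ^ 2)) := by ring
      _ ≤ _ := by
          gcongr
          exact filterConst_mul_le hβ
  gcongr
  exact hC ν

end Discretization

/-! ### Channels of a gate and an evolution -/

section StepMapConj

variable {d : Type*} [Fintype d] [DecidableEq d]

lemma stepMap_onSystem_mul (U : Matrix d d ℂ) (G : Matrix (Fin 2 × d) (Fin 2 × d) ℂ)
    (X : Matrix d d ℂ) : stepMap (onSystem U * G) X = conjBy U (stepMap G X) := by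
  simp only [stepMap_eq, conjBy, ancBlock_mul, ancBlock_onSystem]
  simp [mul_add, add_mul, mul_assoc]

lemma stepMap_mul_onSystem (U : Matrix d d ℂ) (G : Matrix (Fin 2 × d) (Fin 2 × d) ℂ)
    (X : Matrix d d ℂ) : stepMap (G * onSystem U) X = stepMap G (conjBy U X) := by
  simp only [stepMap_eq, conjBy, ancBlock_mul, ancBlock_onSystem]
  simp [mul_assoc]

lemma conjBy_conjBy (U V X : Matrix d d ℂ) : conjBy U (conjBy V X) = conjBy (U * V) X := by
  simp only [conjBy, Matrix.conjTranspose_mul, mul_assoc]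

lemma conjBy_one (X : Matrix d d ℂ) : conjBy 1 X = X := by
  simp [conjBy]

/-- The channel `X ↦ Tr_anc[G (|0⟩⟨0| ⊗ U X Uᴴ) Gᴴ]` as a linear map. -/
noncomputable def stepLin (G : Matrix (Fin 2 × d) (Fin 2 × d) ℂ) (U : Matrix d d ℂ) :
    Matrix d d ℂ →ₗ[ℂ] Matrix d d ℂ where
  toFun X := stepMap G (conjBy U X)
  map_add' X Y := by rw [← stepMap_add]; congr 1; simp [conjBy, mul_add, add_mul]
  map_smul' c X := by rw [RingHom.id_apply, ← stepMap_smul]; congr 1; simp [conjBy]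

lemma traceNorm_stepLin_le {G : Matrix (Fin 2 × d) (Fin 2 × d) ℂ} {U : Matrix d d ℂ} (hG : ‖G‖ ≤ 1)
    (hU : ‖U‖ ≤ 1) (X : Matrix d d ℂ) : traceNorm (stepLin G U X) ≤ traceNorm X :=
  (traceNorm_stepMap_le hG _).trans (traceNorm_conjBy_le hU X)

lemma traceNorm_stepLin_sub_le {G G' : Matrix (Fin 2 × d) (Fin 2 × d) ℂ} {U U' : Matrix d d ℂ}
    (hG : ‖G‖ ≤ 1) (hG' : ‖G'‖ ≤ 1) (hU : ‖U‖ ≤ 1) (hU' : ‖U'‖ ≤ 1) (X : Matrix d d ℂ) :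
    traceNorm (stepLin G U X - stepLin G' U' X) ≤
      (2 * ‖G - G'‖ + 2 * ‖U - U'‖) * traceNorm X := by
  have h1 := traceNorm_stepMap_sub_le hG hG' (conjBy U X)
  have h2 := traceNorm_stepMap_le hG' (conjBy U X - conjBy U' X)
  have h3 := traceNorm_conjBy_sub_le hU hU' X
  have h4 := traceNorm_conjBy_le hU X
  have e : stepLin G U X - stepLin G' U' X =
      (stepMap G (conjBy U X) - stepMap G' (conjBy U X)) + stepMap G' (conjBy U X - conjBy U' X) := by
    have : stepMap G' (conjBy U X - conjBy U' X) =
        stepMap G' (conjBy U X) - stepMap G' (conjBy U' X) := by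
      rw [sub_eq_add_neg, stepMap_add, ← neg_one_smul ℂ (conjBy U' X), stepMap_smul, neg_one_smul,
        ← sub_eq_add_neg]
    rw [this]
    simp only [stepLin, LinearMap.coe_mk, AddHom.coe_mk]
    abel
  rw [e]
  refine (traceNorm_add_le _ _).trans ((add_le_add h1 (h2.trans h3)).trans ?_)
  rw [add_mul]
  gcongr

end StepMapConj

/-! ### The truncated trapezoidal sum of the protocol -/

namespace Protocol

variable {m : ℕ} {ι d : Type*} [Fintype ι] [Fintype d] [DecidableEq d] (P : Protocol m ι d)

/-- The weights of the truncated trapezoidal sum, extended by zero. -/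
noncomputable def cutWeight (s : ℤ) : ℝ := if s.natAbs ≤ P.S then P.weight s else 0

lemma weight_nonneg (s : ℤ) : 0 ≤ P.weight s := by
  have := P.Δt_pos
  rw [weight]
  split_ifs <;> linarith

lemma weight_le (s : ℤ) : P.weight s ≤ P.Δt := by
  have := P.Δt_pos
  rw [weight]
  split_ifs <;> linarith

lemma list_sum_range {V : Type*} [AddCommMonoid V] (f : ℕ → V) (N : ℕ) :
    ((List.range N).map f).sum = ∑ j ∈ Finset.range N, f j := by
  induction N with
  | zero => simp
  | succ N ih => rw [List.sum_range_succ, Finset.sum_range_succ, ih]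

/-- The grid points `s` of the protocol. -/
noncomputable def grid : Finset ℤ :=
  (Finset.range (2 * P.S + 1)).image fun j : ℕ => (j : ℤ) - P.S

lemma mem_grid {s : ℤ} : s ∈ P.grid ↔ s.natAbs ≤ P.S := by
  simp only [grid, Finset.mem_image, Finset.mem_range]
  constructor
  · rintro ⟨j, hj, rfl⟩
    omega
  · intro h
    exact ⟨(s + P.S).toNat, by omega, by omega⟩

lemma sum_range_eq_sum_grid {V : Type*} [AddCommMonoid V] (f : ℤ → V) :
    ∑ j ∈ Finset.range (2 * P.S + 1), f ((j : ℤ) - P.S) = ∑ s ∈ P.grid, f s := by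
  rw [grid, Finset.sum_image]
  intro i _ j _ hij
  simp only at hij
  omega

lemma list_sum_sample_eq (a : ι) : ((List.range (2 * P.S + 1)).map (P.sample a)).sum =
    ∑' s : ℤ, ((P.cutWeight s : ℂ) * filter P.β (s * P.Δt)) •
      heisenberg P.H (P.jump a) (s * P.Δt) := by
  rw [list_sum_range]
  simp only [sample]
  rw [P.sum_range_eq_sum_grid fun s : ℤ => ((P.weight s : ℂ) * filter P.β (s * P.Δt)) •
    heisenberg P.H (P.jump a) (s * P.Δt), tsum_eq_sum (s := P.grid)]
  · refine Finset.sum_congr rfl fun s hs => ?_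
    rw [cutWeight, if_pos (P.mem_grid.1 hs)]
  · intro s hs
    rw [cutWeight, if_neg (fun h => hs (P.mem_grid.2 h))]
    simp

/-- The neglected part of the trapezoidal sum is dominated by a geometric series: consecutive grid
points beyond `T` contribute a factor of at most `e^{-4κ}`. -/
lemma cut_term_le {κ : ℝ} (hκ : κ * P.β ^ 2 ≤ P.T * P.Δt) (s : ℤ) :
    |P.Δt - P.cutWeight s| * Real.exp (-2 * (s * P.Δt) ^ 2 / P.β ^ 2) ≤
      P.Δt * Real.exp (-2 * (P.T / P.β) ^ 2) *
        (Real.exp (-(4 * κ) * |((s - P.S : ℤ) : ℝ)|) +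
          Real.exp (-(4 * κ) * |((s + P.S : ℤ) : ℝ)|)) := by
  have hΔ := P.Δt_pos
  have hβ := P.β_pos
  rcases lt_or_ge s.natAbs P.S with hs | hs
  · have : P.cutWeight s = P.Δt := by
      rw [cutWeight, if_pos hs.le, weight, if_neg hs.ne]
    rw [this, sub_self, abs_zero, zero_mul]
    positivity
  · have h1 : |P.Δt - P.cutWeight s| ≤ P.Δt := by
      rw [cutWeight]
      split_ifs
      · have := P.weight_nonneg s
        have := P.weight_le s
        rw [abs_of_nonneg (by linarith)]
        linarith
      · rw [sub_zero, abs_of_pos hΔ]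
    obtain ⟨j, hj⟩ := Nat.exists_eq_add_of_le hs
    have hsq : (s : ℝ) ^ 2 = ((P.S : ℝ) + j) ^ 2 := by
      have : (s.natAbs : ℤ) ^ 2 = s ^ 2 := Int.natAbs_sq s
      rw [hj] at this
      exact_mod_cast this.symm
    have h2 : Real.exp (-2 * (s * P.Δt) ^ 2 / P.β ^ 2) ≤
        Real.exp (-2 * (P.T / P.β) ^ 2) * Real.exp (-(4 * κ) * j) := by
      rw [← Real.exp_add]
      refine Real.exp_le_exp.2 ?_
      have e : (s * P.Δt) ^ 2 = P.T ^ 2 + 2 * (P.T * P.Δt) * j + (j * P.Δt) ^ 2 := by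
        rw [mul_pow, hsq, T]
        ring
      have h3 : P.T ^ 2 + 2 * (κ * P.β ^ 2) * j ≤ (s * P.Δt) ^ 2 := by
        rw [e]
        have : 2 * (κ * P.β ^ 2) * j ≤ 2 * (P.T * P.Δt) * j := by gcongr
        have := sq_nonneg (j * P.Δt)
        linarith
      rw [div_pow, div_le_iff₀ (by positivity)]
      have : (-2 * (P.T ^ 2 / P.β ^ 2) + -(4 * κ) * j) * P.β ^ 2 =
          -2 * (P.T ^ 2 + 2 * (κ * P.β ^ 2) * j) := by field_simp; ring
      rw [this]
      linarith
    have h3 : Real.exp (-(4 * κ) * j) ≤ Real.exp (-(4 * κ) * |((s - P.S : ℤ) : ℝ)|) +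
        Real.exp (-(4 * κ) * |((s + P.S : ℤ) : ℝ)|) := by
      rcases Int.natAbs_eq s with h | h
      · have : ((s - P.S : ℤ) : ℝ) = ((j : ℕ) : ℝ) := by
          have : s - P.S = (j : ℤ) := by omega
          exact_mod_cast this
        rw [this, Nat.abs_cast]
        exact le_add_of_nonneg_right (Real.exp_pos _).le
      · have : ((s + P.S : ℤ) : ℝ) = -((j : ℕ) : ℝ) := by
          have : s + P.S = -(j : ℤ) := by omega
          exact_mod_cast this
        rw [this, abs_neg, Nat.abs_cast]
        exact le_add_of_nonneg_left (Real.exp_pos _).le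
    calc _ ≤ P.Δt * (Real.exp (-2 * (P.T / P.β) ^ 2) * Real.exp (-(4 * κ) * j)) := by gcongr
      _ ≤ P.Δt * (Real.exp (-2 * (P.T / P.β) ^ 2) *
          (Real.exp (-(4 * κ) * |((s - P.S : ℤ) : ℝ)|) +
            Real.exp (-(4 * κ) * |((s + P.S : ℤ) : ℝ)|))) := by gcongr
      _ = _ := by ring

lemma norm_truncation_le {κ : ℝ} (hκ0 : 0 < κ) (hκ : κ * P.β ^ 2 ≤ P.T * P.Δt) (a : ι) :
    ‖((List.range (2 * P.S + 1)).map (P.sample a)).sum -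
      ∑' s : ℤ, ((P.Δt : ℂ) * filter P.β (s * P.Δt)) • heisenberg P.H (P.jump a) (s * P.Δt)‖ ≤
      P.Δt / Real.sqrt P.β * Real.exp (-2 * (P.T / P.β) ^ 2) * (2 * expSum (4 * κ)) *
        ‖P.jump a‖ := by
  have hΔ := P.Δt_pos
  have hβ := P.β_pos
  have hf := filterConst_nonneg P.β
  have hsK := summable_exp_neg_abs (c := 4 * κ) (by positivity)
  have hs1 := (Equiv.subRight (P.S : ℤ)).summable_iff.2 hsK
  have hs2 := (Equiv.addRight (P.S : ℤ)).summable_iff.2 hsK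
  have ht1 := (Equiv.subRight (P.S : ℤ)).tsum_eq fun n : ℤ => Real.exp (-(4 * κ) * |(n : ℝ)|)
  have ht2 := (Equiv.addRight (P.S : ℤ)).tsum_eq fun n : ℤ => Real.exp (-(4 * κ) * |(n : ℝ)|)
  have hsum := hs1.hasSum.add hs2.hasSum
  simp only [Function.comp_def] at hsum
  rw [ht1, ht2, ← two_mul] at hsum
  have hsum' := (hsum.mul_left (filterConst P.β * (P.Δt * Real.exp (-2 * (P.T / P.β) ^ 2)))).mul_right
    ‖P.jump a‖
  have hcut : Summable fun s : ℤ => ((P.cutWeight s : ℂ) * filter P.β (s * P.Δt)) •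
      heisenberg P.H (P.jump a) (s * P.Δt) := by
    refine summable_of_ne_finset_zero (s := P.grid) fun s hs => ?_
    rw [cutWeight, if_neg (fun h => hs (P.mem_grid.2 h))]
    simp
  have hfull := summable_trapezoid hβ hΔ P.H_isHermitian (P.jump a)
  rw [list_sum_sample_eq, norm_sub_rev, ← hfull.tsum_sub hcut]
  refine (tsum_of_norm_bounded hsum' fun s => ?_).trans ?_
  · rw [← sub_smul, ← sub_mul, norm_smul, norm_mul, ← Complex.ofReal_sub, Complex.norm_real,
      norm_filter, Real.norm_eq_abs]
    have h1 := P.cut_term_le hκ s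
    calc _ = filterConst P.β * (|P.Δt - P.cutWeight s| *
          Real.exp (-2 * (s * P.Δt) ^ 2 / P.β ^ 2)) *
          ‖heisenberg P.H (P.jump a) (s * P.Δt)‖ := by ring
      _ ≤ filterConst P.β * (P.Δt * Real.exp (-2 * (P.T / P.β) ^ 2) *
          (Real.exp (-(4 * κ) * |((s - P.S : ℤ) : ℝ)|) +
          Real.exp (-(4 * κ) * |((s + P.S : ℤ) : ℝ)|))) * ‖P.jump a‖ := by
          gcongr
          exact norm_heisenberg_le P.H_isHermitian _ _
      _ = _ := by
          simp only [Equiv.subRight_apply, Equiv.coe_addRight]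
          ring
  · have := expSum_nonneg (4 * κ)
    change filterConst P.β * (P.Δt * Real.exp (-2 * (P.T / P.β) ^ 2)) * (2 * expSum (4 * κ)) *
      ‖P.jump a‖ ≤ _
    calc _ ≤ 1 / Real.sqrt P.β * (P.Δt * Real.exp (-2 * (P.T / P.β) ^ 2)) *
          (2 * expSum (4 * κ)) * ‖P.jump a‖ := by
          gcongr
          exact filterConst_le hβ
      _ = _ := by ring

/-- The error of the Lindblad operators of the protocol. -/
lemma norm_sample_sum_sub_le {κ α : ℝ} (hκ0 : 0 < κ) (hκ : κ * P.β ^ 2 ≤ P.T * P.Δt)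
    (hX : 0 < 2 * Real.pi * (P.β / P.Δt) - 2 * P.β * ‖P.H‖ - 1) (hα : ∀ a, ‖P.jump a‖ ≤ α) (a : ι) :
    ‖((List.range (2 * P.S + 1)).map (P.sample a)).sum - lindbladOp P.β P.H (P.jump a)‖ ≤
      α * (2 * expSum (4 * κ) + aliasConst) *
        (P.Δt / Real.sqrt P.β * Real.exp (-2 * (P.T / P.β) ^ 2) +
          Real.sqrt P.β * (bohrFrequencies P.H).ncard *
            Real.exp (-(1 / 8) * (2 * Real.pi * (P.β / P.Δt) - 2 * P.β * ‖P.H‖ - 1) ^ 2)) := by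
  have hΔ := P.Δt_pos
  have h1 := P.norm_truncation_le hκ0 hκ a
  have h2 := norm_trapezoid_sub_lindbladOp_le P.β_pos P.Δt_pos P.H_isHermitian (P.jump a) hX.le rfl
  have hα0 : 0 ≤ α := (norm_nonneg _).trans (hα a)
  have hE := expSum_nonneg (4 * κ)
  have hA := aliasConst_nonneg
  set r2 := P.Δt / Real.sqrt P.β * Real.exp (-2 * (P.T / P.β) ^ 2) with hr2
  set x := Real.exp (-(1 / 8) * (2 * Real.pi * (P.β / P.Δt) - 2 * P.β * ‖P.H‖ - 1) ^ 2) with hx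
  set nB : ℝ := ((bohrFrequencies P.H).ncard : ℝ) with hnB
  have hr20 : 0 ≤ r2 := by positivity
  have hx0 : 0 ≤ x := (Real.exp_pos _).le
  have hnB0 : 0 ≤ nB := Nat.cast_nonneg _
  refine (norm_sub_le_norm_sub_add_norm_sub _ _ _).trans ((add_le_add h1 h2).trans ?_)
  calc _ ≤ r2 * (2 * expSum (4 * κ)) * α + nB * (Real.sqrt P.β * (aliasConst * x) * α) := by
        have := hα a
        gcongr
    _ = α * (2 * expSum (4 * κ)) * r2 + α * aliasConst * (Real.sqrt P.β * nB * x) := by ring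
    _ ≤ α * (2 * expSum (4 * κ) + aliasConst) * r2 +
        α * (2 * expSum (4 * κ) + aliasConst) * (Real.sqrt P.β * nB * x) := by
        gcongr <;> linarith
    _ = _ := by ring

lemma norm_sample_le {α : ℝ} (hα : ∀ a, ‖P.jump a‖ ≤ α) (a : ι) (j : ℕ) :
    ‖P.sample a j‖ ≤ P.Δt * (filterConst P.β *
      Real.exp (-2 * ((((j : ℤ) - P.S : ℤ) : ℝ) * P.Δt) ^ 2 / P.β ^ 2)) * α := by
  have hΔ := P.Δt_pos
  have hf := filterConst_nonneg P.β
  rw [sample, norm_smul, norm_mul, Complex.norm_real, Real.norm_of_nonneg (P.weight_nonneg _),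
    norm_filter]
  gcongr
  · exact P.weight_le _
  · exact (norm_heisenberg_le P.H_isHermitian _ _).trans (hα a)

lemma sum_sample_bound_le {α : ℝ} (hα : 0 ≤ α) (hY : 1 ≤ 2 * Real.pi * (P.β / P.Δt)) :
    ((List.range (2 * P.S + 1)).map fun j : ℕ => P.Δt * (filterConst P.β *
      Real.exp (-2 * ((((j : ℤ) - P.S : ℤ) : ℝ) * P.Δt) ^ 2 / P.β ^ 2)) * α).sum ≤
      α * Real.sqrt P.β * (1 + aliasConst) := by
  have hΔ := P.Δt_pos
  have hf := filterConst_nonneg P.β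
  rw [list_sum_range, P.sum_range_eq_sum_grid fun s : ℤ => P.Δt * (filterConst P.β *
      Real.exp (-2 * ((s : ℝ) * P.Δt) ^ 2 / P.β ^ 2)) * α, ← Finset.sum_mul]
  calc _ ≤ (Real.sqrt P.β * (1 + aliasConst)) * α := by
        gcongr
        exact ((summable_filterBound P.β_pos P.Δt_pos).sum_le_tsum _
          (fun s _ => by positivity)).trans (tsum_filterBound_le P.β_pos P.Δt_pos hY)
    _ = _ := by ring

/-! ### One step of the protocol -/

/-- One step of the simulation with exact evolutions. -/
noncomputable def idealStep (a : ι) : Matrix d d ℂ →ₗ[ℂ] Matrix d d ℂ :=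
  stepLin (P.idealGate a) (evol P.H P.δt)

/-- The gate of `simulationStep`. -/
noncomputable def simulationGate (a : ι) : Matrix (Fin 2 × d) (Fin 2 × d) ℂ :=
  onSystem (P.shortEvol ^ P.S) * P.gateV a * onSystem (P.shortEvolᴴ ^ P.S)

lemma simulationStep_eq (a : ι) (X : Matrix d d ℂ) :
    P.simulationStep a X = stepLin (P.simulationGate a) P.stepEvol X := rfl

lemma circuitStep_eq (a : ι) (X : Matrix d d ℂ) :
    P.circuitStep a X = stepLin (P.gateV a) P.stepEvol X := rfl

lemma norm_shortEvol_le : ‖P.shortEvol‖ ≤ 1 := norm_productFormula_le P.term_hermitian _ _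

lemma norm_stepEvol_le : ‖P.stepEvol‖ ≤ 1 := norm_productFormula_le P.term_hermitian _ _

lemma norm_gateV_le (a : ι) : ‖P.gateV a‖ ≤ 1 := P.norm_gateVWith_le P.norm_shortEvol_le a

lemma norm_simulationGate_le (a : ι) : ‖P.simulationGate a‖ ≤ 1 := by
  have h := P.norm_shortEvol_le
  have h' : ‖P.shortEvolᴴ‖ ≤ 1 := by rwa [Matrix.l2_opNorm_conjTranspose]
  refine (norm_mul_le _ _).trans (mul_le_one₀ ((norm_mul_le _ _).trans (mul_le_one₀ ?_
    (norm_nonneg _) (P.norm_gateV_le a))) (norm_nonneg _) ?_)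
  · exact norm_onSystem_le_one (norm_pow_le_one h _)
  · exact norm_onSystem_le_one (norm_pow_le_one h' _)

/-- The relative error of one step caused by the product formulas. -/
noncomputable def trotterError (Λ : ℝ) : ℝ :=
  48 * Λ ^ 3 * (P.T * P.Δt ^ 2 / (P.rΔ : ℝ) ^ 2) + 6 * Λ ^ 3 * (P.δt ^ 3 / (P.rδ : ℝ) ^ 2)

variable {P} {Λ : ℝ}

lemma norm_shortEvol_sub_le (hΛ : ∑ j, ‖P.term j‖ ≤ Λ) :
    ‖P.shortEvol - evol P.H P.Δt‖ ≤ 3 * Λ ^ 3 * P.Δt ^ 3 / (P.rΔ : ℝ) ^ 2 :=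
  norm_productFormula_sub_evol_le P.term_hermitian P.rΔ_pos P.Δt_pos.le hΛ

lemma norm_stepEvol_sub_le (hΛ : ∑ j, ‖P.term j‖ ≤ Λ) :
    ‖P.stepEvol - evol P.H P.δt‖ ≤ 3 * Λ ^ 3 * P.δt ^ 3 / (P.rδ : ℝ) ^ 2 :=
  norm_productFormula_sub_evol_le P.term_hermitian P.rδ_pos P.δt_pos.le hΛ

lemma norm_gateV_sub_le (hΛ : ∑ j, ‖P.term j‖ ≤ Λ) (a : ι) :
    ‖P.gateV a - P.gateVWith (evol P.H P.Δt) a‖ ≤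
      2 * (2 * P.S + 1) * (3 * Λ ^ 3 * P.Δt ^ 3 / (P.rΔ : ℝ) ^ 2) := by
  rw [gateV_eq]
  refine (P.norm_gateVWith_sub_le P.norm_shortEvol_le (norm_evol_le P.H_isHermitian _) a).trans ?_
  gcongr
  exact norm_shortEvol_sub_le hΛ

lemma short_error_nonneg (hΛ : ∑ j, ‖P.term j‖ ≤ Λ) :
    0 ≤ 3 * Λ ^ 3 * P.Δt ^ 3 / (P.rΔ : ℝ) ^ 2 :=
  (norm_nonneg _).trans (norm_shortEvol_sub_le hΛ)

lemma one_le_S (P : Protocol m ι d) : (1 : ℝ) ≤ P.S := by exact_mod_cast P.S_pos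

lemma norm_simulationGate_sub_le (hΛ : ∑ j, ‖P.term j‖ ≤ Λ) (a : ι) :
    ‖P.simulationGate a - P.idealGate a‖ ≤
      8 * P.S * (3 * Λ ^ 3 * P.Δt ^ 3 / (P.rΔ : ℝ) ^ 2) := by
  set c := 3 * Λ ^ 3 * P.Δt ^ 3 / (P.rΔ : ℝ) ^ 2 with hc
  have hc0 : 0 ≤ c := short_error_nonneg hΛ
  have hF := norm_shortEvol_sub_le hΛ
  have hFn := P.norm_shortEvol_le
  have hE := norm_evol_le P.H_isHermitian P.Δt
  have hF'n : ‖P.shortEvolᴴ‖ ≤ 1 := by rwa [Matrix.l2_opNorm_conjTranspose]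
  have hE' : ‖(evol P.H P.Δt)ᴴ‖ ≤ 1 := by rwa [Matrix.l2_opNorm_conjTranspose]
  have hT : evol P.H P.T = evol P.H P.Δt ^ P.S := by rw [evol_pow]; rfl
  have hT' : evol P.H (-P.T) = (evol P.H P.Δt)ᴴ ^ P.S := by
    rw [evol_conjTranspose P.H_isHermitian, evol_pow, T, mul_neg]
  have d1 : ‖onSystem (P.shortEvol ^ P.S) - onSystem (evol P.H P.T)‖ ≤ P.S * c := by
    rw [← onSystem_sub, hT]
    refine (norm_onSystem_le _).trans ((norm_pow_sub_pow_le hFn hE _).trans ?_)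
    gcongr
  have d2 : ‖onSystem (P.shortEvolᴴ ^ P.S) - onSystem (evol P.H (-P.T))‖ ≤ P.S * c := by
    rw [← onSystem_sub, hT']
    refine (norm_onSystem_le _).trans ((norm_pow_sub_pow_le hF'n hE' _).trans ?_)
    rw [← Matrix.conjTranspose_sub, Matrix.l2_opNorm_conjTranspose]
    gcongr
  have d3 := norm_gateV_sub_le hΛ a
  rw [← hc] at d3
  have n1 : ‖onSystem (P.shortEvol ^ P.S)‖ ≤ 1 := norm_onSystem_le_one (norm_pow_le_one hFn _)
  have n2 : ‖onSystem (evol P.H (-P.T))‖ ≤ 1 :=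
    norm_onSystem_le_one (norm_evol_le P.H_isHermitian _)
  have n3 := P.norm_gateV_le a
  have n4 := P.norm_gateVWith_le hE a
  rw [← P.onSystem_mul_gateVWith_mul a, simulationGate]
  revert d1 d2 d3 n1 n2 n3 n4
  generalize onSystem (P.shortEvol ^ P.S) = U
  generalize onSystem (P.shortEvolᴴ ^ P.S) = U'
  generalize onSystem (evol P.H P.T) = E
  generalize onSystem (evol P.H (-P.T)) = E'
  generalize P.gateVWith (evol P.H P.Δt) a = V'
  generalize P.gateV a = V
  intro d1 d2 d3 n1 n2 n3 n4
  have e : U * V * U' - E * V' * E' =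
      U * V * (U' - E') + (U * (V - V') * E' + (U - E) * V' * E') := by noncomm_ring
  have tri : ∀ A B C : Matrix (Fin 2 × d) (Fin 2 × d) ℂ, ‖A * B * C‖ ≤ ‖A‖ * ‖B‖ * ‖C‖ :=
    fun A B C => (norm_mul_le _ _).trans (by gcongr; exact norm_mul_le _ _)
  rw [e]
  calc _ ≤ ‖U‖ * ‖V‖ * ‖U' - E'‖ + (‖U‖ * ‖V - V'‖ * ‖E'‖ + ‖U - E‖ * ‖V'‖ * ‖E'‖) :=
        (norm_add_le _ _).trans (add_le_add (tri _ _ _)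
          ((norm_add_le _ _).trans (add_le_add (tri _ _ _) (tri _ _ _))))
    _ ≤ 1 * 1 * (P.S * c) + (1 * (2 * (2 * P.S + 1) * c) * 1 + (P.S * c) * 1 * 1) := by gcongr
    _ ≤ _ := by nlinarith [P.one_le_S]

lemma trotterError_eq (P : Protocol m ι d) (Λ : ℝ) :
    2 * (8 * P.S * (3 * Λ ^ 3 * P.Δt ^ 3 / (P.rΔ : ℝ) ^ 2)) +
      2 * (3 * Λ ^ 3 * P.δt ^ 3 / (P.rδ : ℝ) ^ 2) = P.trotterError Λ := by
  rw [trotterError, T]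
  ring

lemma traceNorm_simulationStep_sub_le (hΛ : ∑ j, ‖P.term j‖ ≤ Λ) (a : ι) (X : Matrix d d ℂ) :
    traceNorm (P.simulationStep a X - P.idealStep a X) ≤ P.trotterError Λ * traceNorm X := by
  rw [simulationStep_eq, idealStep, ← trotterError_eq]
  refine (traceNorm_stepLin_sub_le (P.norm_simulationGate_le a) (P.norm_idealGate_le a)
    P.norm_stepEvol_le (norm_evol_le P.H_isHermitian _) X).trans ?_
  have := traceNorm_nonneg X
  gcongr
  · exact norm_simulationGate_sub_le hΛ a
  · exact norm_stepEvol_sub_le hΛ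

/-- With exact evolutions, the circuit without the outer evolutions is the conjugate of the simulation
by the evolution for time `T`. -/
lemma conjBy_idealStep_conjBy (a : ι) (X : Matrix d d ℂ) :
    conjBy (evol P.H (-P.T)) (P.idealStep a (conjBy (evol P.H P.T) X)) =
      stepLin (P.gateVWith (evol P.H P.Δt) a) (evol P.H P.δt) X := by
  change conjBy (evol P.H (-P.T)) (stepMap (P.idealGate a)
    (conjBy (evol P.H P.δt) (conjBy (evol P.H P.T) X))) = stepMap _ (conjBy (evol P.H P.δt) X)
  rw [conjBy_conjBy, ← evol_add, add_comm, evol_add, ← conjBy_conjBy, ← stepMap_mul_onSystem,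
    ← stepMap_onSystem_mul]
  congr 1
  rw [← P.onSystem_mul_gateVWith_mul a]
  have h : onSystem (evol P.H (-P.T)) * onSystem (evol P.H P.T) = 1 := by
    rw [← onSystem_mul, evol_neg_mul_evol, onSystem_one]
  simp only [mul_assoc]
  rw [h, mul_one, ← mul_assoc, h, one_mul]

lemma traceNorm_circuitStep_sub_le (hΛ : ∑ j, ‖P.term j‖ ≤ Λ) (a : ι) (X : Matrix d d ℂ) :
    traceNorm (P.circuitStep a X -
      conjBy (evol P.H (-P.T)) (P.idealStep a (conjBy (evol P.H P.T) X))) ≤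
      P.trotterError Λ * traceNorm X := by
  rw [circuitStep_eq, conjBy_idealStep_conjBy, ← trotterError_eq]
  refine (traceNorm_stepLin_sub_le (P.norm_gateV_le a)
    (P.norm_gateVWith_le (norm_evol_le P.H_isHermitian _) a)
    P.norm_stepEvol_le (norm_evol_le P.H_isHermitian _) X).trans ?_
  have := traceNorm_nonneg X
  gcongr
  · refine (norm_gateV_sub_le hΛ a).trans ?_
    have := short_error_nonneg hΛ
    have hS := P.one_le_S
    exact mul_le_mul_of_nonneg_right (by linarith) this
  · exact norm_stepEvol_sub_le hΛ

/-! ### Accumulation of the errors -/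

lemma expectedOutput_succ (W : ι → Matrix d d ℂ →ₗ[ℂ] Matrix d d ℂ) (M : ℕ) (ρ : Matrix d d ℂ) :
    P.expectedOutput (fun a => W a) (M + 1) ρ =
      ∑ b, (P.prob b : ℂ) • W b (P.expectedOutput (fun a => W a) M ρ) := by
  rw [expectedOutput, ← (Fin.snocEquiv fun _ : Fin (M + 1) => ι).sum_comp, Fintype.sum_prod_type]
  refine Finset.sum_congr rfl fun b _ => ?_
  rw [expectedOutput, map_sum, Finset.smul_sum]
  refine Finset.sum_congr rfl fun a _ => ?_
  rw [map_smul, smul_smul, Fin.prod_univ_castSucc, List.ofFn_succ']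
  simp only [Fin.snocEquiv_apply, Fin.snoc_castSucc, Fin.snoc_last, List.concat_eq_append,
    List.foldl_append, List.foldl_cons, List.foldl_nil]
  congr 1
  push_cast
  ring

/-- Errors of the single steps add up, since both the target `Φ` and the implemented maps are
contractions. -/
lemma traceNorm_iterate_sub_expectedOutput_le (W : ι → Matrix d d ℂ →ₗ[ℂ] Matrix d d ℂ)
    (hW : ∀ a X, traceNorm (W a X) ≤ traceNorm X) (Φ : Matrix d d ℂ → Matrix d d ℂ)
    (hΦ : ∀ X, traceNorm (Φ X) ≤ traceNorm X) {ε : ℝ} (hε : 0 ≤ ε)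
    (h : ∀ X, traceNorm (Φ X - ∑ a, (P.prob a : ℂ) • W a X) ≤ ε * traceNorm X) (M : ℕ)
    (ρ : Matrix d d ℂ) :
    traceNorm (Φ^[M] ρ - P.expectedOutput (fun a => W a) M ρ) ≤ M * ε * traceNorm ρ := by
  have hρ := traceNorm_nonneg ρ
  have hit : ∀ M : ℕ, traceNorm (Φ^[M] ρ) ≤ traceNorm ρ := by
    intro M
    induction M with
    | zero => exact le_rfl
    | succ M ih => rw [Function.iterate_succ_apply']; exact (hΦ _).trans ih
  induction M with
  | zero => simp [expectedOutput, traceNorm_zero]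
  | succ M ih =>
    rw [Function.iterate_succ_apply', expectedOutput_succ]
    set X := Φ^[M] ρ
    set Y := P.expectedOutput (fun a => W a) M ρ
    have e : Φ X - ∑ b, (P.prob b : ℂ) • W b Y =
        (Φ X - ∑ b, (P.prob b : ℂ) • W b X) + ∑ b, (P.prob b : ℂ) • W b (X - Y) := by
      simp only [map_sub, smul_sub, Finset.sum_sub_distrib]
      abel
    rw [e]
    refine (traceNorm_add_le _ _).trans ((add_le_add ((h X).trans
      (mul_le_mul_of_nonneg_left (hit M) hε))
      ((traceNorm_convex_sum_le P.prob_nonneg P.prob_sum fun a => hW a (X - Y)).trans ih)).trans ?_)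
    push_cast
    linarith

lemma semigroup_iterate (𝓛 : Matrix d d ℂ →ₗ[ℂ] Matrix d d ℂ) (t : ℝ) (M : ℕ) (ρ : Matrix d d ℂ) :
    (fun X => semigroup 𝓛 t X)^[M] ρ = semigroup 𝓛 (M * t) ρ := by
  induction M with
  | zero => simp [semigroup_zero]
  | succ M ih =>
    rw [Function.iterate_succ_apply', ih, ← semigroup_add]
    push_cast
    ring_nf

lemma conj_semigroup_iterate (𝓛 : Matrix d d ℂ →ₗ[ℂ] Matrix d d ℂ) {U V : Matrix d d ℂ}
    (hUV : U * V = 1) (t : ℝ) (M : ℕ) (ρ : Matrix d d ℂ) :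
    (fun X => conjBy V (semigroup 𝓛 t (conjBy U X)))^[M] ρ =
      conjBy V (semigroup 𝓛 (M * t) (conjBy U ρ)) := by
  induction M with
  | zero =>
    have hVU : V * U = 1 := mul_eq_one_comm.1 hUV
    simp [semigroup_zero, conjBy_conjBy, hVU, conjBy_one]
  | succ M ih =>
    rw [Function.iterate_succ_apply', ih, conjBy_conjBy U V, hUV, conjBy_one, ← semigroup_add]
    push_cast
    ring_nf

lemma traceNorm_semigroup_lindbladian_le (P : Protocol m ι d) (X : Matrix d d ℂ) :
    traceNorm (semigroup P.lindbladian P.δt X) ≤ traceNorm X :=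
  traceNorm_semigroup_generator_le P.prob_nonneg P.prob_sum P.H_isHermitian P.γ_nonneg P.δt_pos.le X

lemma norm_H_le (hΛ : ∑ j, ‖P.term j‖ ≤ Λ) : ‖P.H‖ ≤ Λ := (norm_sum_le _ _).trans hΛ

/-- The bound on the norms of the Lindblad operators and of their discretizations. -/
noncomputable def couplingBound (α β₀ : ℝ) : ℝ := α * Real.sqrt β₀ * (1 + aliasConst)

/-- The bound on the norm of the Lindbladian. -/
noncomputable def rateBound (Λ α Γ β₀ : ℝ) : ℝ := 2 * Λ + 4 * Γ * couplingBound α β₀ ^ 2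

/-- The constant of the error bound: the second summand comes from the second-order expansion of one
step, the third from the error of the Lindblad operators, the last from the product formulas; the first
only keeps the constant positive. -/
noncomputable def errorConst (Λ α Γ β₀ κ : ℝ) : ℝ :=
  1 + 21 * rateBound Λ α Γ β₀ ^ 2 +
    4 * Γ * couplingBound α β₀ * (α * (2 * expSum (4 * κ) + aliasConst)) + 54 * Λ ^ 3

lemma couplingBound_nonneg {α β₀ : ℝ} (hα : 0 ≤ α) : 0 ≤ couplingBound α β₀ := by
  have := aliasConst_nonneg
  rw [couplingBound]
  positivity

lemma errorConst_pos {α Γ β₀ κ : ℝ} (hΛ : 0 ≤ Λ) (hα : 0 ≤ α) (hΓ : 0 ≤ Γ) :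
    0 < errorConst Λ α Γ β₀ κ := by
  have := aliasConst_nonneg
  have := expSum_nonneg (4 * κ)
  have := couplingBound_nonneg (β₀ := β₀) hα
  rw [errorConst]
  positivity

variable {α Γ β₀ κ : ℝ}

/-- The error of one step with exact evolutions. -/
lemma traceNorm_semigroup_sub_idealStep_le (hΛ : ∑ j, ‖P.term j‖ ≤ Λ) (hα0 : 0 ≤ α)
    (hα : ∀ a, ‖P.jump a‖ ≤ α) (hΓ : P.γ ≤ Γ) (hβ : P.β ≤ β₀) (hκ0 : 0 < κ)
    (hκ : κ * P.β ^ 2 ≤ P.T * P.Δt)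
    (hX : 0 < 2 * Real.pi * (P.β / P.Δt) - 2 * P.β * ‖P.H‖ - 1) (X : Matrix d d ℂ) :
    traceNorm (semigroup P.lindbladian P.δt X - ∑ a, (P.prob a : ℂ) • P.idealStep a X) ≤
      (21 * (P.δt * rateBound Λ α Γ β₀) ^ 2 + 4 * P.δt * Γ * couplingBound α β₀ *
        (α * (2 * expSum (4 * κ) + aliasConst) *
        (P.Δt / Real.sqrt P.β * Real.exp (-2 * (P.T / P.β) ^ 2) +
          Real.sqrt P.β * (bohrFrequencies P.H).ncard *
            Real.exp (-(1 / 8) * (2 * Real.pi * (P.β / P.Δt) - 2 * P.β * ‖P.H‖ - 1) ^ 2)))) *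
        traceNorm X := by
  have hδ := P.δt_pos
  have hΔ := P.Δt_pos
  have hγ := P.γ_nonneg
  have hA := aliasConst_nonneg
  have hE := expSum_nonneg (4 * κ)
  have hY : 1 ≤ 2 * Real.pi * (P.β / P.Δt) := by
    have := P.β_pos
    have : 0 ≤ 2 * P.β * ‖P.H‖ := by positivity
    linarith
  have hb : α * Real.sqrt P.β * (1 + aliasConst) ≤ couplingBound α β₀ := by
    rw [couplingBound]
    gcongr
  have hb0 := couplingBound_nonneg (β₀ := β₀) hα0
  set η := α * (2 * expSum (4 * κ) + aliasConst) *
        (P.Δt / Real.sqrt P.β * Real.exp (-2 * (P.T / P.β) ^ 2) +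
          Real.sqrt P.β * (bohrFrequencies P.H).ncard *
            Real.exp (-(1 / 8) * (2 * Real.pi * (P.β / P.Δt) - 2 * P.β * ‖P.H‖ - 1) ^ 2)) with hη
  have hη0 : 0 ≤ η := by positivity
  have hL : ∀ a, ‖lindbladOp P.β P.H (P.jump a)‖ ≤ couplingBound α β₀ := fun a => by
    refine (norm_lindbladOp_le P.β_pos P.H_isHermitian _).trans (le_trans ?_ hb)
    calc _ ≤ α * Real.sqrt P.β := by gcongr; exact hα a
      _ ≤ _ := le_mul_of_one_le_right (by positivity) (by linarith)
  have hQ : 2 * ‖P.H‖ + 4 * P.γ * couplingBound α β₀ ^ 2 ≤ rateBound Λ α Γ β₀ := by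
    have := norm_H_le hΛ
    rw [rateBound]
    gcongr
  have main := traceNorm_semigroup_sub_symGate_le P.prob_nonneg P.prob_sum P.H_isHermitian hγ hδ.le hL
    P.sample (List.range (2 * P.S + 1)) _ (fun a j _ => P.norm_sample_le hα a j)
    ((P.sum_sample_bound_le hα0 hY).trans hb) hb0
    (P.norm_sample_sum_sub_le hκ0 hκ hX hα) hη0 hQ X
  refine main.trans ?_
  have := traceNorm_nonneg X
  gcongr

/-- The error of one step is of the order of `δt` times the error rate. -/
lemma step_error_le (hΛ0 : 0 ≤ Λ) (hα0 : 0 ≤ α) (hΓ0 : 0 ≤ Γ) :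
    21 * (P.δt * rateBound Λ α Γ β₀) ^ 2 + 4 * P.δt * Γ * couplingBound α β₀ *
        (α * (2 * expSum (4 * κ) + aliasConst) *
        (P.Δt / Real.sqrt P.β * Real.exp (-2 * (P.T / P.β) ^ 2) +
          Real.sqrt P.β * (bohrFrequencies P.H).ncard *
            Real.exp (-(1 / 8) * (2 * Real.pi * (P.β / P.Δt) - 2 * P.β * ‖P.H‖ - 1) ^ 2))) +
      P.trotterError Λ ≤ P.δt * (errorConst Λ α Γ β₀ κ * P.errorRate) := by
  have hδ := P.δt_pos
  have hΔ := P.Δt_pos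
  have hA := aliasConst_nonneg
  have hE := expSum_nonneg (4 * κ)
  have hT : 0 ≤ P.T := mul_nonneg (Nat.cast_nonneg _) hΔ.le
  have hb0 := couplingBound_nonneg (β₀ := β₀) hα0
  rw [errorRate, errorConst]
  set r2 := P.Δt / Real.sqrt P.β * Real.exp (-2 * (P.T / P.β) ^ 2) with hr2
  set r3 := Real.sqrt P.β * (bohrFrequencies P.H).ncard *
    Real.exp (-(1 / 8) * (2 * Real.pi * (P.β / P.Δt) - 2 * P.β * ‖P.H‖ - 1) ^ 2) with hr3
  set r4 := P.δt ^ 2 / (P.rδ : ℝ) ^ 2 with hr4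
  set r5 := P.T * P.Δt ^ 2 / (P.δt * (P.rΔ : ℝ) ^ 2) with hr5
  have h2 : 0 ≤ r2 := by positivity
  have h3 : 0 ≤ r3 := by positivity
  have h4 : 0 ≤ r4 := by positivity
  have h5 : 0 ≤ r5 := by positivity
  have hrΔ : (0 : ℝ) < P.rΔ := by exact_mod_cast P.rΔ_pos
  have e5 : P.T * P.Δt ^ 2 / (P.rΔ : ℝ) ^ 2 = P.δt * r5 := by rw [hr5]; field_simp
  have e4 : P.δt ^ 3 / (P.rδ : ℝ) ^ 2 = P.δt * r4 := by rw [hr4]; ring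
  rw [trotterError, e5, e4]
  set K := 4 * Γ * couplingBound α β₀ * (α * (2 * expSum (4 * κ) + aliasConst)) with hK
  set R := rateBound Λ α Γ β₀ ^ 2 with hR
  have hK0 : 0 ≤ K := by positivity
  have hR0 : 0 ≤ R := sq_nonneg _
  have hΛ3 : 0 ≤ Λ ^ 3 := by positivity
  have key : 21 * R * P.δt + K * (r2 + r3) + 48 * Λ ^ 3 * r5 + 6 * Λ ^ 3 * r4 ≤
      (1 + 21 * R + K + 54 * Λ ^ 3) * (P.δt + r2 + r3 + r4 + r5) := by
    have : (1 + 21 * R + K + 54 * Λ ^ 3) * (P.δt + r2 + r3 + r4 + r5) -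
        (21 * R * P.δt + K * (r2 + r3) + 48 * Λ ^ 3 * r5 + 6 * Λ ^ 3 * r4) =
        (1 + K + 54 * Λ ^ 3) * P.δt + (1 + 21 * R + 54 * Λ ^ 3) * (r2 + r3) +
          (1 + 21 * R + K + 6 * Λ ^ 3) * r5 + (1 + 21 * R + K + 48 * Λ ^ 3) * r4 := by ring
    have : 0 ≤ (1 + K + 54 * Λ ^ 3) * P.δt + (1 + 21 * R + 54 * Λ ^ 3) * (r2 + r3) +
          (1 + 21 * R + K + 6 * Λ ^ 3) * r5 + (1 + 21 * R + K + 48 * Λ ^ 3) * r4 := by positivity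
    linarith
  calc _ = P.δt * (21 * R * P.δt + K * (r2 + r3) + 48 * Λ ^ 3 * r5 + 6 * Λ ^ 3 * r4) := by
        rw [hK, hR]; ring
    _ ≤ _ := by gcongr

/-- The error bound after `M` steps. -/
lemma errors_le (hΛ0 : 0 ≤ Λ) (hα0 : 0 ≤ α) (hΓ0 : 0 ≤ Γ) (hΛ : ∑ j, ‖P.term j‖ ≤ Λ)
    (hα : ∀ a, ‖P.jump a‖ ≤ α) (hΓ : P.γ ≤ Γ) (hβ : P.β ≤ β₀) (hκ0 : 0 < κ)
    (hκ : κ * P.β ^ 2 ≤ P.T * P.Δt)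
    (hX : 0 < 2 * Real.pi * (P.β / P.Δt) - 2 * P.β * ‖P.H‖ - 1) (M : ℕ) {ρ : Matrix d d ℂ}
    (hρ : IsDensity ρ) :
    P.simulationError M ρ ≤ M * P.δt * (errorConst Λ α Γ β₀ κ * P.errorRate) ∧
      P.circuitError M ρ ≤ M * P.δt * (errorConst Λ α Γ β₀ κ * P.errorRate) := by
  have hideal := traceNorm_semigroup_sub_idealStep_le hΛ hα0 hα hΓ hβ hκ0 hκ hX
  have hstep := step_error_le (P := P) (κ := κ) (β₀ := β₀) hΛ0 hα0 hΓ0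
  set ε₁ := 21 * (P.δt * rateBound Λ α Γ β₀) ^ 2 + 4 * P.δt * Γ * couplingBound α β₀ *
        (α * (2 * expSum (4 * κ) + aliasConst) *
        (P.Δt / Real.sqrt P.β * Real.exp (-2 * (P.T / P.β) ^ 2) +
          Real.sqrt P.β * (bohrFrequencies P.H).ncard *
            Real.exp (-(1 / 8) * (2 * Real.pi * (P.β / P.Δt) - 2 * P.β * ‖P.H‖ - 1) ^ 2)))
  set ε := P.δt * (errorConst Λ α Γ β₀ κ * P.errorRate) with hε
  have hT : 0 ≤ P.T := mul_nonneg (Nat.cast_nonneg _) P.Δt_pos.le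
  have hε0 : 0 ≤ ε := by
    have h1 := errorConst_pos (β₀ := β₀) (κ := κ) hΛ0 hα0 hΓ0
    have h2 := P.δt_pos
    have h3 := P.Δt_pos
    rw [hε, errorRate]
    positivity
  have fin : ∀ (x : ℝ), x ≤ M * ε * traceNorm ρ →
      x ≤ M * P.δt * (errorConst Λ α Γ β₀ κ * P.errorRate) := fun x hx => by
    refine hx.trans ((mul_le_of_le_one_right (by positivity) hρ.traceNorm_le_one).trans_eq ?_)
    rw [hε]
    ring
  have hsim : ∀ X, traceNorm (semigroup P.lindbladian P.δt X -
      ∑ a, (P.prob a : ℂ) • stepLin (P.simulationGate a) P.stepEvol X) ≤ ε * traceNorm X := by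
    intro X
    have h1 := traceNorm_convex_sum_le P.prob_nonneg P.prob_sum
      (fun a => traceNorm_simulationStep_sub_le hΛ a X)
    have e : semigroup P.lindbladian P.δt X -
        ∑ a, (P.prob a : ℂ) • stepLin (P.simulationGate a) P.stepEvol X =
        (semigroup P.lindbladian P.δt X - ∑ a, (P.prob a : ℂ) • P.idealStep a X) -
          ∑ a, (P.prob a : ℂ) • (P.simulationStep a X - P.idealStep a X) := by
      simp only [smul_sub, Finset.sum_sub_distrib, simulationStep_eq]
      abel
    rw [e]
    refine (traceNorm_sub_le _ _).trans ((add_le_add (hideal X) h1).trans ?_)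
    rw [← add_mul]
    have := traceNorm_nonneg X
    gcongr
  have hcirc : ∀ X, traceNorm (conjBy (evol P.H (-P.T)) (semigroup P.lindbladian P.δt
      (conjBy (evol P.H P.T) X)) -
      ∑ a, (P.prob a : ℂ) • stepLin (P.gateV a) P.stepEvol X) ≤ ε * traceNorm X := by
    intro X
    have hX0 := traceNorm_nonneg X
    have hUn := norm_evol_le P.H_isHermitian P.T
    have hVn := norm_evol_le P.H_isHermitian (-P.T)
    have h1 := traceNorm_convex_sum_le P.prob_nonneg P.prob_sum
      (fun a => traceNorm_circuitStep_sub_le hΛ a X)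
    set Y := conjBy (evol P.H P.T) X with hY
    have hε₁ : 0 ≤ ε₁ := by
      have := P.δt_pos
      have := P.Δt_pos
      have := aliasConst_nonneg
      have := expSum_nonneg (4 * κ)
      have := couplingBound_nonneg (β₀ := β₀) hα0
      positivity
    have h2 : traceNorm (conjBy (evol P.H (-P.T)) (semigroup P.lindbladian P.δt Y -
        ∑ a, (P.prob a : ℂ) • P.idealStep a Y)) ≤ ε₁ * traceNorm X :=
      (traceNorm_conjBy_le hVn _).trans ((hideal Y).trans
        (mul_le_mul_of_nonneg_left (traceNorm_conjBy_le hUn X) hε₁))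
    have e : conjBy (evol P.H (-P.T)) (semigroup P.lindbladian P.δt Y) -
        ∑ a, (P.prob a : ℂ) • stepLin (P.gateV a) P.stepEvol X =
        conjBy (evol P.H (-P.T)) (semigroup P.lindbladian P.δt Y -
          ∑ a, (P.prob a : ℂ) • P.idealStep a Y) -
        ∑ a, (P.prob a : ℂ) •
          (P.circuitStep a X - conjBy (evol P.H (-P.T)) (P.idealStep a Y)) := by
      simp only [smul_sub, Finset.sum_sub_distrib, circuitStep_eq, conjBy, mul_sub, sub_mul,
        Finset.mul_sum, Finset.sum_mul, Matrix.mul_smul, Matrix.smul_mul]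
      abel
    rw [e]
    refine (traceNorm_sub_le _ _).trans ((add_le_add h2 h1).trans ?_)
    rw [← add_mul]
    gcongr
  constructor
  · refine fin _ ?_
    have h := traceNorm_iterate_sub_expectedOutput_le (P := P)
      (fun a => stepLin (P.simulationGate a) P.stepEvol)
      (fun a X => traceNorm_stepLin_le (P.norm_simulationGate_le a) P.norm_stepEvol_le X)
      (fun X => semigroup P.lindbladian P.δt X) P.traceNorm_semigroup_lindbladian_le hε0 hsim M ρ
    rw [semigroup_iterate] at h
    exact h
  · refine fin _ ?_
    have h := traceNorm_iterate_sub_expectedOutput_le (P := P)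
      (fun a => stepLin (P.gateV a) P.stepEvol)
      (fun a X => traceNorm_stepLin_le (P.norm_gateV_le a) P.norm_stepEvol_le X)
      (fun X => conjBy (evol P.H (-P.T)) (semigroup P.lindbladian P.δt (conjBy (evol P.H P.T) X)))
      (fun X => (traceNorm_conjBy_le (norm_evol_le P.H_isHermitian _) _).trans
        ((P.traceNorm_semigroup_lindbladian_le _).trans
          (traceNorm_conjBy_le (norm_evol_le P.H_isHermitian _) X))) hε0 hcirc M ρ
    rw [conj_semigroup_iterate _ (evol_mul_evol_neg P.H P.T)] at h
    exact h

end Protocol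

end GibbsProtocol

theorem mainTheorem5 (Λ α Γ β₀ κ : ℝ) (hκ : 0 < κ) :
    ∃ C : ℝ, 0 < C ∧
      ∀ (m : ℕ) (ι : Type*) (d : Type*) [Fintype ι] [Fintype d] [DecidableEq d]
        (P : GibbsProtocol.Protocol m ι d),
        (∑ j, ‖P.term j‖ ≤ Λ) → (∀ a, ‖P.jump a‖ ≤ α) → P.γ ≤ Γ → P.β ≤ β₀ →
        κ * P.β ^ 2 ≤ P.T * P.Δt →
        0 < 2 * Real.pi * (P.β / P.Δt) - 2 * P.β * ‖P.H‖ - 1 →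
        (∀ (M : ℕ) (ρ : Matrix d d ℂ), GibbsProtocol.IsDensity ρ →
          P.simulationError M ρ ≤ M * P.δt * (C * P.errorRate) ∧
          P.circuitError M ρ ≤ M * P.δt * (C * P.errorRate)) ∧
        (∀ (σ : Matrix d d ℂ) (ε : ℝ) (M : ℕ),
          GibbsProtocol.IsUniqueFullRankSteadyState P.lindbladian σ → 0 < ε →
          M * P.δt = GibbsProtocol.mixingTime P.lindbladian σ ε →
          ∀ ρ : Matrix d d ℂ, GibbsProtocol.IsDensity ρ →
            P.simulationError M ρ ≤
              GibbsProtocol.mixingTime P.lindbladian σ ε * (C * P.errorRate) ∧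
            P.circuitError M ρ ≤
              GibbsProtocol.mixingTime P.lindbladian σ ε * (C * P.errorRate)) := by
  -- absolute values only serve to make the constant positive when no protocol satisfies the bounds
  refine ⟨GibbsProtocol.Protocol.errorConst |Λ| |α| |Γ| β₀ κ,
    GibbsProtocol.Protocol.errorConst_pos (abs_nonneg _) (abs_nonneg _) (abs_nonneg _), ?_⟩
  intro m ι d _ _ _ P hΛ hα hΓ hβ hκ' hX
  have main : ∀ (M : ℕ) (ρ : Matrix d d ℂ), GibbsProtocol.IsDensity ρ → _ :=
    fun M ρ hρ => GibbsProtocol.Protocol.errors_le (P := P) (abs_nonneg Λ) (abs_nonneg α)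
      (abs_nonneg Γ) (hΛ.trans (le_abs_self _)) (fun a => (hα a).trans (le_abs_self _))
      (hΓ.trans (le_abs_self _)) hβ hκ hκ' hX M hρ
  refine ⟨main, ?_⟩
  intro σ ε M _ _ hM ρ hρ
  rw [← hM]
  exact main M ρ hρ
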